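/- **Setting.** Let $d\ge 1$, $T>0$, and let $\mathbb T^d=\mathbb R^d/\mathbb Z^d$. Let $0<\mu<1$ and let $H:\mathbb T^d\times\mathbb R^d\to\mathbb R$ be a $C^\infty$ Hamiltonian such that: 1. $p\mapsto H(x,p)$ is strictly convex for each $x$, $\lim_{|p|\to\infty}H(x,p)/|p|=+\infty$ for each $x$, and $H\ge 1$. 2. There are $c,C>0$ with $D_pH(x,p)\cdot p-H(x,p)\ge cH(x,p)-C$ for all $(x,p)$. 3. There is $C$ with $|D_xH|,\ |D^2_{xx}H|\le CH+C$, and for every $\delta>0$ there is $C_\delta$ with $\operatorname{tr}(D^2_{px}H\,M)\le\delta\operatorname{tr}(D^2_{pp}H\,M^2)+C_\delta H$ for all $(x,p)$ and all symmetric matrices $M$. 4. There are $c_1>0$ and $c_2,C_1,C_2\ge 0$ with $c_1|p|^{2+\mu}+C_1\le H(x,p)\le c_2|p|^{2+\mu}+C_2$ for all $(x,p)$. 5. There is $C$ with $|D_pH(x,p)|^2\le C|p|^\mu H(x,p)+C$ for all $(x,p)$. 6. There is $C$ with $|D^2_{xp}H|^2\le CH^{\frac{2+2\mu}{2+\mu}}$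 and $|D^2_{pp}H\,M|^2\le CH^{\frac{\mu}{2+\mu}}\operatorname{tr}(D^2_{pp}H\,M\,M)$ for all $(x,p)$ and all symmetric matrices $M$. Let $g(z)=z^\alpha$ on $[0,\infty)$ with $\alpha>0$. Let $u_T,m_0\in C^\infty(\mathbb T^d)$ with $\int_{\mathbb T^d}m_0=1$ and $m_0\ge\kappa_0$ for some constant $\kappa_0>0$. Let $\eta\in C_c^\infty(\mathbb R^d)$ be a symmetric mollifying kernel ($\eta\ge 0$, $\eta(-x)=\eta(x)$, supported in the closed unit ball, $\int\eta=1$), let $\eta_\epsilon(x)=\epsilon^{-d}\eta(x/\epsilon)$, $g_\epsilon(m)=\eta_\epsilon*g(\eta_\epsilon*m)$ for $\epsilon>0$, and $g_0(m)=g(m)$. Let $p$ be an exponent with $d<p\le\infty$. **Theorem.** There is a constant $C\ge 0$ (which may depend on the data $d,T,H,\mu,\alpha,u_T,m_0,\eta,p$, but not on $\epsilon$ or on the solution) such that for every $\epsilon\ge 0$ and every $C^\infty$ solution $(u^\epsilon,m^\epsilon)$ on $\mathbb T^d\times[0,T]$, with $m^\epsilon\ge 0$, of $$ \begin{cases} -u^\epsilon_t+H(x,Du^\epsilon)=\Delta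 u^\epsilon+g_\epsilon(m^\epsilon),\\ m^\epsilon_t-\operatorname{div}\big(D_pH(x,Du^\epsilon)\,m^\epsilon\big)=\Delta m^\epsilon, \end{cases} \qquad u^\epsilon(\cdot,T)=u_T,\quad m^\epsilon(\cdot,0)=m_0, $$ one has $$ \|Du^\epsilon\|_{L^\infty(0,T;L^\infty(\mathbb T^d))}\le C+C\|u^\epsilon\|_{L^\infty(0,T;L^\infty(\mathbb T^d))} +C\|g_\epsilon(m^\epsilon)\|_{L^\infty(0,T;L^p(\mathbb T^d))}\,\|Du^\epsilon\|_{L^\infty(0,T;L^\infty(\mathbb T^d))}^{\mu}\,\big(1+\|u^\epsilon\|_{L^\infty(0,T;L^\infty(\mathbb T^d))}\big). $$ -/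

import Mathlib

open MeasureTheory Filter Set Laplacian
open scoped ContDiff ENNReal NNReal

attribute [local instance] Matrix.frobeniusNormedAddCommGroup

noncomputable section

namespace MFG

/-- Euclidean space `ℝᵈ`. -/
abbrev Euc (d : ℕ) : Type := EuclideanSpace ℝ (Fin d)

/-- `f` is `ℤᵈ`-periodic, i.e. it is a function on the torus `𝕋ᵈ = ℝᵈ / ℤᵈ`. -/
def Periodic {d : ℕ} {F : Type*} (f : Euc d → F) : Prop :=
  ∀ (i : Fin d) (x : Euc d), f (x + EuclideanSpace.single i 1) = f x

/-- The fundamental domain `[0,1]ᵈ` of the torus. -/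
def cube (d : ℕ) : Set (Euc d) := {x | ∀ i, x i ∈ Icc (0 : ℝ) 1}

/-- The partial derivative `∂f/∂xᵢ`. -/
def pd {d : ℕ} (i : Fin d) (f : Euc d → ℝ) (x : Euc d) : ℝ :=
  fderiv ℝ f x (EuclideanSpace.single i 1)

/-- The divergence of a vector field on `ℝᵈ`. -/
def divergence {d : ℕ} (F : Euc d → Euc d) (x : Euc d) : ℝ :=
  ∑ i, pd i (fun y => F y i) x

/-! ### Derivatives of a Hamiltonian `H (x, p)` -/

/-- `D_x H (x, p)`. -/
def gradX {d : ℕ} (H : Euc d → Euc d → ℝ) (x p : Euc d) : Euc d :=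
  gradient (fun y => H y p) x

/-- `D_p H (x, p)`. -/
def gradP {d : ℕ} (H : Euc d → Euc d → ℝ) (x p : Euc d) : Euc d :=
  gradient (fun q => H x q) p

/-- `D²_{xx} H (x, p)`. -/
def hessXX {d : ℕ} (H : Euc d → Euc d → ℝ) (x p : Euc d) : Matrix (Fin d) (Fin d) ℝ :=
  Matrix.of fun i j => pd i (fun y => pd j (fun z => H z p) y) x

/-- `D²_{px} H (x, p)`, with entries `∂_{pᵢ} ∂_{xⱼ} H`. -/
def hessPX {d : ℕ} (H : Euc d → Euc d → ℝ) (x p : Euc d) : Matrix (Fin d) (Fin d) ℝ :=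
  Matrix.of fun i j => pd i (fun q => pd j (fun y => H y q) x) p

/-- `D²_{xp} H (x, p)`, with entries `∂_{xᵢ} ∂_{pⱼ} H`. -/
def hessXP {d : ℕ} (H : Euc d → Euc d → ℝ) (x p : Euc d) : Matrix (Fin d) (Fin d) ℝ :=
  Matrix.of fun i j => pd i (fun y => pd j (fun q => H y q) p) x

/-- `D²_{pp} H (x, p)`. -/
def hessPP {d : ℕ} (H : Euc d → Euc d → ℝ) (x p : Euc d) : Matrix (Fin d) (Fin d) ℝ :=
  Matrix.of fun i j => pd i (fun q => pd j (fun r => H x r) q) p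

/-- `L̂ (x, p) = D_p H (x, p) · p - H (x, p)`. -/
def lagr {d : ℕ} (H : Euc d → Euc d → ℝ) (x p : Euc d) : ℝ :=
  inner ℝ (gradP H x p) p - H x p

/-- The standing assumptions on the Hamiltonian `H : 𝕋ᵈ × ℝᵈ → ℝ`, with superquadratic
exponent `2 + μ`.  Matrices carry the Frobenius norm. -/
structure IsHamiltonian {d : ℕ} (H : Euc d → Euc d → ℝ) (μ : ℝ) : Prop where
  periodic : ∀ p, Periodic fun x => H x p
  smooth : ContDiff ℝ ∞ fun z : Euc d × Euc d => H z.1 z.2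
  strictConvex : ∀ x, StrictConvexOn ℝ univ (H x)
  coercive : ∀ x, Tendsto (fun p => H x p / ‖p‖) (Bornology.cobounded (Euc d)) atTop
  one_le : ∀ x p, 1 ≤ H x p
  lagr_ge : ∃ c C : ℝ, 0 < c ∧ 0 < C ∧ ∀ x p, c * H x p - C ≤ lagr H x p
  derivX_le : ∃ C : ℝ, ∀ x p, ‖gradX H x p‖ ≤ C * H x p + C ∧ ‖hessXX H x p‖ ≤ C * H x p + C
  trace_px_le : ∀ δ : ℝ, 0 < δ → ∃ Cδ : ℝ, ∀ x p, ∀ M : Matrix (Fin d) (Fin d) ℝ, M.IsSymm →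
    (hessPX H x p * M).trace ≤ δ * (hessPP H x p * M ^ 2).trace + Cδ * H x p
  mu_pos : 0 < μ
  mu_lt_one : μ < 1
  growth : ∃ c₁ c₂ C₁ C₂ : ℝ, 0 < c₁ ∧ 0 ≤ c₂ ∧ 0 ≤ C₁ ∧ 0 ≤ C₂ ∧ ∀ x p,
    c₁ * ‖p‖ ^ (2 + μ) + C₁ ≤ H x p ∧ H x p ≤ c₂ * ‖p‖ ^ (2 + μ) + C₂
  gradP_le : ∃ C : ℝ, ∀ x p, ‖gradP H x p‖ ^ 2 ≤ C * ‖p‖ ^ μ * H x p + C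
  hessP_le : ∃ C : ℝ, ∀ x p,
    ‖hessXP H x p‖ ^ 2 ≤ C * H x p ^ ((2 + 2 * μ) / (2 + μ)) ∧
    ∀ M : Matrix (Fin d) (Fin d) ℝ, M.IsSymm →
      ‖hessPP H x p * M‖ ^ 2 ≤ C * H x p ^ (μ / (2 + μ)) * (hessPP H x p * M * M).trace

/-! ### The nonlinearity -/

/-- A symmetric mollifying kernel on `ℝᵈ`. -/
structure IsMollifier {d : ℕ} (η : Euc d → ℝ) : Prop where
  smooth : ContDiff ℝ ∞ η
  nonneg : ∀ x, 0 ≤ η x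
  symm : ∀ x, η (-x) = η x
  support : Function.support η ⊆ Metric.closedBall 0 1
  integral : ∫ x, η x = 1

/-- `η_ε (x) = ε⁻ᵈ η (x / ε)`. -/
def scaled {d : ℕ} (η : Euc d → ℝ) (ε : ℝ) (x : Euc d) : ℝ :=
  (ε ^ d)⁻¹ * η (ε⁻¹ • x)

/-- `η_ε * f`; for periodic `f` this is the convolution on the torus. -/
def mollify {d : ℕ} (η : Euc d → ℝ) (ε : ℝ) (f : Euc d → ℝ) : Euc d → ℝ :=
  convolution (scaled η ε) f (ContinuousLinearMap.mul ℝ ℝ) volume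

/-- `g_ε (f) = η_ε * g (η_ε * f)` for `ε ≠ 0` and `g_0 = g`, where `g z = z ^ α`. -/
def gReg {d : ℕ} (η : Euc d → ℝ) (α ε : ℝ) (f : Euc d → ℝ) : Euc d → ℝ :=
  if ε = 0 then fun x => f x ^ α
  else mollify η ε fun x => mollify η ε f x ^ α

/-! ### The mean-field game system -/

/-- Assumptions on the terminal datum `u_T` and the initial datum `m_0`. -/
structure IsData {d : ℕ} (uT m0 : Euc d → ℝ) : Prop where
  periodic_uT : Periodic uT
  smooth_uT : ContDiff ℝ ∞ uT
  periodic_m0 : Periodic m0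
  smooth_m0 : ContDiff ℝ ∞ m0
  integral_m0 : ∫ x in cube d, m0 x = 1
  m0_ge : ∃ κ₀ : ℝ, 0 < κ₀ ∧ ∀ x, κ₀ ≤ m0 x

/-- `(u, m)` is a `C^∞` solution on `𝕋ᵈ × [0,T]` of
`-u_t + H(x, Du) = Δu + g_ε(m)`, `m_t - div(D_pH(x, Du) m) = Δm`,
`u(·, T) = u_T`, `m(·, 0) = m_0`. -/
structure IsSolution {d : ℕ} (H : Euc d → Euc d → ℝ) (η : Euc d → ℝ) (α T : ℝ)
    (uT m0 : Euc d → ℝ) (ε : ℝ) (u m : Euc d → ℝ → ℝ) : Prop where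
  periodic_u : ∀ t ∈ Icc 0 T, Periodic fun x => u x t
  periodic_m : ∀ t ∈ Icc 0 T, Periodic fun x => m x t
  smooth_u : ContDiffOn ℝ ∞ (fun z : Euc d × ℝ => u z.1 z.2) (univ ×ˢ Icc 0 T)
  smooth_m : ContDiffOn ℝ ∞ (fun z : Euc d × ℝ => m z.1 z.2) (univ ×ˢ Icc 0 T)
  m_nonneg : ∀ x, ∀ t ∈ Icc 0 T, 0 ≤ m x t
  hamiltonJacobi : ∀ x, ∀ t ∈ Ioo 0 T,
    -deriv (fun s => u x s) t + H x (gradient (fun y => u y t) x)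
      = Δ (fun y => u y t) x + gReg η α ε (fun y => m y t) x
  fokkerPlanck : ∀ x, ∀ t ∈ Ioo 0 T,
    deriv (fun s => m x s) t
        - divergence (fun y => m y t • gradP H y (gradient (fun z => u z t) y)) x
      = Δ (fun y => m y t) x
  terminal : ∀ x, u x T = uT x
  initial : ∀ x, m x 0 = m0 x

/-- The norm of `L^∞(0, T; L^q(𝕋ᵈ))`, where `f x t` is the value at the point `x` and time `t`. -/
def mixedNorm {d : ℕ} {F : Type*} [NormedAddCommGroup F] (T : ℝ) (q : ℝ≥0∞)
    (f : Euc d → ℝ → F) : ℝ≥0∞ :=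
  essSup (fun t => eLpNorm (fun x => f x t) q (volume.restrict (cube d)))
    (volume.restrict (Ioo 0 T))

end MFG

end

/-! The theorem is a gradient bound for `-u_t + H(x, Du) = Δu + f`, with `f = g_ε(m) ≥ 0` treated as
a given source. Put `K = sup |Du|`, `M = sup |u|` and `F = sup_t ‖f‖_q` for a finite `q` with `d <
q` and `q ≤ p`. If `K ≤ 1` or `F K^μ ≥ K` there is nothing to prove, so let `K ≥ 1` and `F K^μ ≤ K`.
Put `γ = 1/2 - d/(2q) > 0`.

The source is too rough to differentiate. It is removed by the corrector `v = ∫₀^θ P_s f(t+s) ds`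
with `P_s` the heat semigroup and `θ = K^(-μ)`: `U = u - v` satisfies `U_t + ΔU = H(x, Du) - P_θ
f(t+θ)`. Heat smoothing gives `|Dv| ≤ Λ`, where `Λ = C F K^(-μγ)`, and `|D P_θ f| ≤ C F K^μ`.

For `|ξ| ≤ 1` let `Φ = ∂_ξ U - κ u`, with `κ = κ₁ + κ₂ Λ K^μ`, and consider the energy `∫ exp(Φ/Λ)`.
The equation of `∂_ξ U` contains `∂_ξ R`, where `R = H(x, Du) - H(x, DU)`; this involves the
uncontrolled `D²v`. Integrated by parts against the exponential it meets the good term `-|DΦ|²/Λ`,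
which absorbs it at the price `Λ (1 + |DU|^(1+μ))²`, at most `C Λ K^μ H`. The term `-κ u` produces
`-κ (D_pH · p - H)`, and coercivity of this Lagrangian pays the price wherever `|DU| ≥ Γ Λ`. Where
`|DU| < Γ Λ`, `Φ` itself is at most `Γ Λ + κ M`, so the weight is under control. Gronwall's
inequality backward in time then bounds the energy (`IsHamiltonian.exists_energy_bound`).

To return to pointwise values, `∂_ξ u(t) ≤ P_τ ∂_ξ u(t+τ) + C` for a `τ` that is a negative power of
`K` (`IsHamiltonian.exists_short_time`). The `L¹`–`L^∞` smoothing of `P_τ` and a tangent line to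
`exp` convert the energy bound into a bound for `P_τ ∂_ξ u`. All polynomial losses in `K` enter as
`Λ log K`, which is at most `C F` thanks to the factor `K^(-μγ)` in `Λ`. The product `F K^μ M` of
the statement comes from `κ M` (`IsHamiltonian.exists_gradient_bound`). -/

namespace MFG

/-! ### Periodic functions and integrals over the fundamental domain -/

section Torus

open scoped Pointwise

variable {d : ℕ}

/-- The standard basis of `ℝᵈ`. -/
noncomputable def stdB (d : ℕ) : Module.Basis (Fin d) ℝ (Euc d) :=
  (EuclideanSpace.basisFun (Fin d) ℝ).toBasis

/-- The lattice `ℤᵈ`. -/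
noncomputable abbrev latt (d : ℕ) : Submodule ℤ (Euc d) :=
  Submodule.span ℤ (Set.range (stdB d))

theorem stdB_apply (i : Fin d) : stdB d i = EuclideanSpace.single i (1 : ℝ) := by
  simp [stdB]

theorem stdB_repr (x : Euc d) (i : Fin d) : (stdB d).repr x i = x i := by
  simp [stdB]

theorem Periodic.add_latt {F : Type*} {f : Euc d → F} (hf : Periodic f) {v : Euc d}
    (hv : v ∈ latt d) : ∀ x, f (x + v) = f x := by
  induction hv using Submodule.span_induction with
  | mem v hv =>
    obtain ⟨i, rfl⟩ := hv
    intro x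
    rw [stdB_apply]
    exact hf i x
  | zero => simp
  | add v w _ _ h1 h2 => intro x; rw [← add_assoc, h2, h1]
  | smul n v _ h =>
    intro x
    induction n using Int.induction_on generalizing x with
    | zero => simp
    | succ n ih => rw [add_smul, one_smul, ← add_assoc, h, ih]
    | pred n ih => rw [← h, sub_smul, one_smul, add_assoc, sub_add_cancel, ih]

theorem cube_eq_parallelepiped : cube d = parallelepiped (stdB d) := by
  refine Set.ext fun x => ?_
  rw [mem_parallelepiped_iff]
  constructor
  · intro hx
    refine ⟨fun i => x i, ⟨fun i => (hx i).1, fun i => (hx i).2⟩, ?_⟩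
    have := (stdB d).sum_repr x
    simp only [stdB_repr] at this
    exact this.symm
  · rintro ⟨t, ht, rfl⟩ i
    have : (∑ j, t j • stdB d j) i = t i := by
      rw [← stdB_repr]
      simp [Finsupp.single_apply]
    rw [this]
    exact ⟨ht.1 i, ht.2 i⟩

theorem cube_ae_eq : (cube d : Set (Euc d)) =ᵐ[volume] ZSpan.fundamentalDomain (stdB d) := by
  rw [cube_eq_parallelepiped]
  exact (ZSpan.fundamentalDomain_ae_parallelepiped (stdB d) (volume : Measure (Euc d))).symm

instance : VAddInvariantMeasure (latt d) (Euc d) volume :=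
  inferInstanceAs <| VAddInvariantMeasure (latt d).toAddSubgroup (Euc d) volume

theorem isAddFundamentalDomain_latt :
    IsAddFundamentalDomain (latt d) (ZSpan.fundamentalDomain (stdB d)) (volume : Measure (Euc d)) :=
  ZSpan.isAddFundamentalDomain (stdB d) volume

theorem isAddFundamentalDomain_vadd (y : Euc d) :
    IsAddFundamentalDomain (latt d) (y +ᵥ ZSpan.fundamentalDomain (stdB d))
      (volume : Measure (Euc d)) :=
  isAddFundamentalDomain_latt.vadd_of_comm y

theorem Periodic.vadd_latt {F : Type*} {f : Euc d → F} (hf : Periodic f) (g : latt d)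
    (x : Euc d) : f (g +ᵥ x) = f x := by
  have : g +ᵥ x = x + (g : Euc d) := by
    rw [Submodule.vadd_def, vadd_eq_add, add_comm]
  rw [this, hf.add_latt g.2]

/-- A translate of a fundamental domain of the lattice is again a fundamental domain, and a
lattice-invariant function has the same integral over both. The closed cube differs from the
half-open domain by a null set. -/
theorem Periodic.lintegral_translate {f : Euc d → ℝ≥0∞} (hf : Periodic f) (y : Euc d) :
    ∫⁻ x in cube d, f (y + x) = ∫⁻ x in cube d, f x := by
  rw [setLIntegral_congr cube_ae_eq, setLIntegral_congr cube_ae_eq,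
    ← (isAddFundamentalDomain_vadd y).setLIntegral_eq isAddFundamentalDomain_latt f
      (fun g x => hf.vadd_latt g x)]
  have hmp : MeasurePreserving (fun x : Euc d => y + x) volume volume :=
    measurePreserving_add_left volume y
  have := hmp.setLIntegral_comp_emb (MeasurableEquiv.addLeft y).measurableEmbedding f
    (ZSpan.fundamentalDomain (stdB d))
  rw [this]
  rfl

theorem Periodic.integral_translate {f : Euc d → ℝ} (hf : Periodic f) (y : Euc d) :
    ∫ x in cube d, f (y + x) = ∫ x in cube d, f x := by
  rw [setIntegral_congr_set cube_ae_eq, setIntegral_congr_set cube_ae_eq,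
    ← (isAddFundamentalDomain_vadd y).setIntegral_eq isAddFundamentalDomain_latt
      (f := f) (fun g x => hf.vadd_latt g x)]
  have hmp : MeasurePreserving (fun x : Euc d => y + x) volume volume :=
    measurePreserving_add_left volume y
  have := hmp.setIntegral_image_emb (MeasurableEquiv.addLeft y).measurableEmbedding f
    (ZSpan.fundamentalDomain (stdB d))
  rw [← this]
  rfl

theorem isCompact_cube : IsCompact (cube d) := by
  have : cube d = (EuclideanSpace.equiv (Fin d) ℝ) ⁻¹' (Icc 0 1) := by
    ext x
    simp only [cube, mem_ofPred_eq, mem_preimage, mem_Icc, Pi.le_def]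
    constructor
    · intro h; exact ⟨fun i => (h i).1, fun i => (h i).2⟩
    · intro h i; exact ⟨h.1 i, h.2 i⟩
  rw [this]
  exact (EuclideanSpace.equiv (Fin d) ℝ).toHomeomorph.isCompact_preimage.2 isCompact_Icc

theorem measurableSet_cube : MeasurableSet (cube d) := isCompact_cube.measurableSet

theorem volume_cube : volume (cube d) = 1 := by
  rw [cube_eq_parallelepiped]
  have := (EuclideanSpace.basisFun (Fin d) ℝ).volume_parallelepiped
  convert! this using 3

theorem Periodic.exists_mem_cube {F : Type*} {f : Euc d → F} (hf : Periodic f) (x : Euc d) :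
    ∃ y ∈ cube d, f y = f x := by
  refine ⟨ZSpan.fract (stdB d) x, ?_, ?_⟩
  · intro i
    have := (ZSpan.mem_fundamentalDomain _).1 (ZSpan.fract_mem_fundamentalDomain (stdB d) x) i
    rw [stdB_repr] at this
    exact Ico_subset_Icc_self this
  · rw [ZSpan.fract_apply, sub_eq_add_neg]
    exact hf.add_latt (neg_mem (SetLike.coe_mem _)) x

theorem norm_le_of_mem_cube {x : Euc d} (hx : x ∈ cube d) : ‖x‖ ^ 2 ≤ d := by
  rw [EuclideanSpace.norm_sq_eq]
  calc ∑ i, ‖x i‖ ^ 2 ≤ ∑ _i : Fin d, (1 : ℝ) := by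
        refine Finset.sum_le_sum fun i _ => ?_
        rw [Real.norm_eq_abs, sq_abs]
        have := hx i
        nlinarith [this.1, this.2]
    _ = d := by simp

theorem Periodic.exists_bound {F : Type*} [NormedAddCommGroup F] {f : Euc d → F}
    (hf : Periodic f) (hc : Continuous f) : ∃ C, 0 ≤ C ∧ ∀ x, ‖f x‖ ≤ C := by
  obtain ⟨C, hC⟩ := isCompact_cube.exists_bound_of_continuousOn (f := f) hc.continuousOn
  refine ⟨max C 0, le_max_right _ _, fun x => ?_⟩
  obtain ⟨y, hy, hxy⟩ := hf.exists_mem_cube x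
  rw [← hxy]
  exact (hC y hy).trans (le_max_left _ _)

theorem exists_bound_of_periodic {F : Type*} [NormedAddCommGroup F] {f : Euc d → ℝ → F}
    {I : Set ℝ} (hI : IsCompact I) (hf : ∀ t ∈ I, Periodic fun x => f x t)
    (hc : ContinuousOn (fun z : Euc d × ℝ => f z.1 z.2) (univ ×ˢ I)) :
    ∃ C, 0 ≤ C ∧ ∀ x, ∀ t ∈ I, ‖f x t‖ ≤ C := by
  obtain ⟨C, hC⟩ := (isCompact_cube.prod hI).exists_bound_of_continuousOn
    (f := fun z : Euc d × ℝ => f z.1 z.2) (hc.mono (prod_mono (subset_univ _) le_rfl))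
  refine ⟨max C 0, le_max_right _ _, fun x t ht => ?_⟩
  obtain ⟨y, hy, hxy⟩ := (hf t ht).exists_mem_cube x
  rw [← hxy]
  exact (hC (y, t) ⟨hy, ht⟩).trans (le_max_left _ _)

theorem Periodic.fderiv {f : Euc d → ℝ} (hf : Periodic f) : Periodic (fderiv ℝ f) := by
  intro i x
  have : (fun y => f (y + EuclideanSpace.single i 1)) = f := funext (hf i)
  conv_rhs => rw [← this]
  rw [fderiv_comp_add_right]

/-- The integral of `f (h • ξ + x)` over the cube does not depend on `h`; differentiating at `h = 0`
under the integral sign gives the claim. Every integration by parts on the torus rests on this. -/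
theorem integral_cube_fderiv_eq_zero {f : Euc d → ℝ} (hf : Periodic f) (hc : ContDiff ℝ 1 f)
    (ξ : Euc d) : ∫ x in cube d, fderiv ℝ f x ξ = 0 := by
  have hcont : Continuous (fderiv ℝ f) := hc.continuous_fderiv one_ne_zero
  obtain ⟨C, hC0, hC⟩ := hf.fderiv.exists_bound hcont
  have hfin : volume (cube d) ≠ ⊤ := isCompact_cube.measure_ne_top
  have : IsFiniteMeasure (volume.restrict (cube d)) := ⟨by simpa using hfin.lt_top⟩
  have key := hasDerivAt_integral_of_dominated_loc_of_deriv_le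
    (μ := volume.restrict (cube d)) (F := fun (h : ℝ) x => f (h • ξ + x))
    (F' := fun h x => fderiv ℝ f (h • ξ + x) ξ) (x₀ := 0) (s := univ)
    (bound := fun _ => C * ‖ξ‖) univ_mem
    (Eventually.of_forall fun h =>
      (hc.continuous.comp (by fun_prop)).aestronglyMeasurable)
    ?_ ?_ ?_ (integrable_const _) ?_
  · have h2 : (fun h : ℝ => ∫ x in cube d, f (h • ξ + x)) = fun _ => ∫ x in cube d, f x :=
      funext fun h => hf.integral_translate (h • ξ)
    have h3 := key.2
    rw [h2] at h3
    simpa using h3.unique (hasDerivAt_const 0 _)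
  · simpa [IntegrableOn] using
      hc.continuous.continuousOn.integrableOn_compact (μ := volume) (isCompact_cube (d := d))
  · exact ((hcont.comp (by fun_prop)).clm_apply continuous_const).aestronglyMeasurable
  · refine Eventually.of_forall fun x h _ => ?_
    exact (ContinuousLinearMap.le_opNorm _ _).trans
      (mul_le_mul_of_nonneg_right (hC _) (norm_nonneg _))
  · refine Eventually.of_forall fun x h _ => ?_
    have h1 : HasDerivAt (fun h : ℝ => h • ξ + x) ξ h := by
      simpa using ((hasDerivAt_id h).smul_const ξ).add_const x
    exact ((hc.differentiable one_ne_zero _).hasFDerivAt).comp_hasDerivAt h h1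

end Torus

end MFG

namespace MFG

/-! ### Gaussian averages of periodic functions are bounded by their mean over the cube. -/

section GaussianAverage

variable {d : ℕ}

/-- Halving the Gaussian exponent lets the centre move anywhere in the cube, since `‖y - w‖² ≤ 2‖y‖²
+ 2d`. -/
theorem exp_neg_sq_le (y w : Euc d) (hw : w ∈ cube d) :
    Real.exp (-(1 / 8) * ‖y‖ ^ 2) ≤
      Real.exp (d / 8) * Real.exp (-(1 / 16) * ‖y - w‖ ^ 2) := by
  rw [← Real.exp_add, Real.exp_le_exp]
  have h1 := norm_le_of_mem_cube hw
  have h2 : ‖y - w‖ ^ 2 ≤ 2 * ‖y‖ ^ 2 + 2 * ‖w‖ ^ 2 := by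
    have := parallelogram_law_with_norm ℝ y w
    nlinarith [sq_nonneg ‖y + w‖]
  nlinarith

/-- The weight is dominated by its mean over centres `w` in the cube. After exchanging the integrals
and shifting `y` by `w`, the inner integral runs over a translate of the cube, where periodicity
makes it independent of `x` and `y`. -/
theorem lintegral_gaussian_le (φ : Euc d → ℝ≥0∞) (hφ : Measurable φ) (hp : Periodic φ)
    (x : Euc d) :
    ∫⁻ y, φ (x + y) * ENNReal.ofReal (Real.exp (-(1 / 8) * ‖y‖ ^ 2)) ≤
      (ENNReal.ofReal (Real.exp (d / 8)) *
        ∫⁻ y : Euc d, ENNReal.ofReal (Real.exp (-(1 / 16) * ‖y‖ ^ 2))) * ∫⁻ w in cube d, φ w := by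
  set k : Euc d → ℝ≥0∞ := fun y => ENNReal.ofReal (Real.exp (-(1 / 16) * ‖y‖ ^ 2)) with hk
  set A : ℝ≥0∞ := ENNReal.ofReal (Real.exp (d / 8)) with hA
  have hkm : Measurable k := by
    apply Measurable.ennreal_ofReal
    fun_prop
  have h1 : ∀ y, ENNReal.ofReal (Real.exp (-(1 / 8) * ‖y‖ ^ 2)) ≤
      ∫⁻ w in cube d, A * k (y - w) := by
    intro y
    calc ENNReal.ofReal (Real.exp (-(1 / 8) * ‖y‖ ^ 2))
        = ∫⁻ w in cube d, ENNReal.ofReal (Real.exp (-(1 / 8) * ‖y‖ ^ 2)) := by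
          rw [setLIntegral_const, volume_cube, mul_one]
      _ ≤ _ := by
          refine setLIntegral_mono' measurableSet_cube fun w hw => ?_
          rw [hA, hk, ← ENNReal.ofReal_mul (Real.exp_pos _).le]
          exact ENNReal.ofReal_le_ofReal (exp_neg_sq_le y w hw)
  calc ∫⁻ y, φ (x + y) * ENNReal.ofReal (Real.exp (-(1 / 8) * ‖y‖ ^ 2))
      ≤ ∫⁻ y, φ (x + y) * ∫⁻ w in cube d, A * k (y - w) :=
        lintegral_mono fun y => mul_le_mul_right (h1 y) _
    _ = ∫⁻ y, ∫⁻ w in cube d, φ (x + y) * (A * k (y - w)) := by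
        refine lintegral_congr fun y => ?_
        exact (lintegral_const_mul _ (by fun_prop)).symm
    _ = ∫⁻ w in cube d, ∫⁻ y, φ (x + y) * (A * k (y - w)) := by
        rw [lintegral_lintegral_swap]
        apply Measurable.aemeasurable
        fun_prop
    _ = ∫⁻ w in cube d, ∫⁻ y, φ (x + (y + w)) * (A * k y) := by
        refine lintegral_congr fun w => ?_
        rw [← lintegral_add_right_eq_self _ w]
        simp
    _ = ∫⁻ y, ∫⁻ w in cube d, φ (x + (y + w)) * (A * k y) := by
        rw [lintegral_lintegral_swap]
        apply Measurable.aemeasurable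
        fun_prop
    _ = ∫⁻ y, (∫⁻ w in cube d, φ w) * (A * k y) := by
        refine lintegral_congr fun y => ?_
        rw [lintegral_mul_const _ (by fun_prop)]
        simp_rw [← add_assoc]
        rw [hp.lintegral_translate]
    _ = (A * ∫⁻ y, k y) * ∫⁻ w in cube d, φ w := by
        rw [lintegral_const_mul _ (by fun_prop), lintegral_const_mul _ (by fun_prop), mul_comm]

theorem integrable_exp_neg_sq {b : ℝ} (hb : 0 < b) :
    Integrable fun v : Euc d => Real.exp (-b * ‖v‖ ^ 2) := by
  by_contra h
  have h1 := GaussianFourier.integral_rexp_neg_mul_sq_norm (V := Euc d) hb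
  rw [integral_undef h] at h1
  exact absurd h1.symm (by positivity)

theorem exists_integral_gaussian_le (d : ℕ) : ∃ C : ℝ, 0 < C ∧ ∀ h : Euc d → ℝ, Continuous h →
    Periodic h → (∀ x, 0 ≤ h x) → ∀ s : ℝ, 0 < s → s ≤ 1 → ∀ x,
      ∫ z, Real.exp (-(1 / 2) * ‖z‖ ^ 2) * h (x + (2 * √s) • z) ≤
        C * s ^ (-(d / 2 : ℝ)) * ∫ w in cube d, h w := by
  set B : ℝ≥0∞ := ENNReal.ofReal (Real.exp (d / 8)) *
        ∫⁻ y : Euc d, ENNReal.ofReal (Real.exp (-(1 / 16) * ‖y‖ ^ 2)) with hB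
  have hBtop : B ≠ ⊤ := by
    refine ENNReal.mul_ne_top ENNReal.ofReal_ne_top ?_
    rw [← ofReal_integral_eq_lintegral_ofReal (integrable_exp_neg_sq (by norm_num))
      (Eventually.of_forall fun _ => (Real.exp_pos _).le)]
    exact ENNReal.ofReal_ne_top
  refine ⟨B.toReal + 1, by positivity, fun h hc hp h0 s hs hs1 x => ?_⟩
  have hfin : ∫⁻ w in cube d, ENNReal.ofReal (h w) = ENNReal.ofReal (∫ w in cube d, h w) :=
    (ofReal_integral_eq_lintegral_ofReal
      (hc.continuousOn.integrableOn_compact isCompact_cube)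
      (Eventually.of_forall h0)).symm
  have hI0 : 0 ≤ ∫ w in cube d, h w := integral_nonneg h0
  have main : ∫ y, Real.exp (-(1 / 8) * ‖y‖ ^ 2) * h (x + y) ≤ B.toReal * ∫ w in cube d, h w := by
    have := lintegral_gaussian_le (fun w => ENNReal.ofReal (h w)) (by fun_prop)
      (fun i x => congrArg ENNReal.ofReal (hp i x)) x
    rw [integral_eq_lintegral_of_nonneg_ae
      (Eventually.of_forall fun y => mul_nonneg (Real.exp_pos _).le (h0 _))
      (by apply Continuous.aestronglyMeasurable; fun_prop)]
    rw [hfin, ← hB] at this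
    have h2 := ENNReal.toReal_mono (ENNReal.mul_ne_top hBtop ENNReal.ofReal_ne_top) this
    rw [ENNReal.toReal_mul, ENNReal.toReal_ofReal hI0] at h2
    refine le_trans (le_of_eq ?_) h2
    congr 1
    refine lintegral_congr fun y => ?_
    rw [mul_comm, ENNReal.ofReal_mul (h0 _)]
  have hr : (0 : ℝ) < 2 * √s := by positivity
  -- In the variable `y = 2√s z` the weight is `exp (-‖y‖²/(8s))`, and `s ≤ 1` allows dropping `s`.
  -- The Jacobian then gives the power `s^(-d/2)`.
  have hle : ∀ z : Euc d, Real.exp (-(1 / 2) * ‖z‖ ^ 2) * h (x + (2 * √s) • z) ≤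
      (fun y => Real.exp (-(1 / 8) * ‖y‖ ^ 2) * h (x + y)) ((2 * √s) • z) := by
    intro z
    refine mul_le_mul_of_nonneg_right (Real.exp_le_exp.2 ?_) (h0 _)
    rw [norm_smul, Real.norm_of_nonneg hr.le, mul_pow, mul_pow, Real.sq_sqrt hs.le]
    nlinarith [sq_nonneg ‖z‖]
  obtain ⟨Ch, hCh0, hCh⟩ := hp.exists_bound hc
  have hint : Integrable (fun y => Real.exp (-(1 / 8) * ‖y‖ ^ 2) * h (x + y)) :=
    (integrable_exp_neg_sq (by norm_num)).mul_bdd (c := Ch)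
      (by apply Continuous.aestronglyMeasurable; fun_prop)
      (Eventually.of_forall fun y => hCh _)
  calc _ ≤ ∫ z, (fun y => Real.exp (-(1 / 8) * ‖y‖ ^ 2) * h (x + y)) ((2 * √s) • z) := by
        refine integral_mono_of_nonneg
          (Eventually.of_forall fun z => mul_nonneg (Real.exp_pos _).le (h0 _))
          (hint.comp_smul hr.ne') (Eventually.of_forall hle)
    _ = ((2 * √s) ^ d)⁻¹ * ∫ y, Real.exp (-(1 / 8) * ‖y‖ ^ 2) * h (x + y) := by
        rw [Measure.integral_comp_smul volume
          (fun y => Real.exp (-(1 / 8) * ‖y‖ ^ 2) * h (x + y)), finrank_euclideanSpace_fin, smul_eq_mul,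
          abs_of_nonneg (by positivity)]
    _ ≤ s ^ (-(d / 2 : ℝ)) * (B.toReal * ∫ w in cube d, h w) := by
        refine mul_le_mul ?_ main
          (integral_nonneg fun y => mul_nonneg (Real.exp_pos _).le (h0 _)) (by positivity)
        rw [Real.rpow_neg hs.le]
        refine inv_anti₀ (by positivity) ?_
        have : s ^ (d / 2 : ℝ) = (√s) ^ d := by
          rw [Real.sqrt_eq_rpow, ← Real.rpow_natCast, ← Real.rpow_mul hs.le]
          congr 1; ring
        rw [this]
        exact pow_le_pow_left₀ (Real.sqrt_nonneg _) (by linarith [Real.sqrt_nonneg s]) d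
    _ ≤ (B.toReal + 1) * s ^ (-(d / 2 : ℝ)) * ∫ w in cube d, h w := by
        have : 0 ≤ s ^ (-(d / 2 : ℝ)) * ∫ w in cube d, h w := by positivity
        nlinarith

end GaussianAverage

end MFG

namespace MFG

/-! ### Smooth periodic functions of space and time -/

section SmoothPeriodic

variable {d : ℕ}

/-- Smooth functions of `(x, t)` which are periodic in `x`. -/
structure PSmooth (φ : Euc d → ℝ → ℝ) : Prop where
  smooth : ContDiff ℝ ∞ fun z : Euc d × ℝ => φ z.1 z.2
  periodic : ∀ t, Periodic fun x => φ x t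

/-- The derivative of `φ` in the space-time direction `v`. -/
noncomputable def dd (v : Euc d × ℝ) (φ : Euc d → ℝ → ℝ) (x : Euc d) (t : ℝ) : ℝ :=
  fderiv ℝ (fun z : Euc d × ℝ => φ z.1 z.2) (x, t) v

theorem PSmooth.continuous {φ : Euc d → ℝ → ℝ} (hφ : PSmooth φ) :
    Continuous fun z : Euc d × ℝ => φ z.1 z.2 := hφ.smooth.continuous

theorem PSmooth.hasFDerivAt {φ : Euc d → ℝ → ℝ} (hφ : PSmooth φ) (z : Euc d × ℝ) :
    HasFDerivAt (fun z : Euc d × ℝ => φ z.1 z.2)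
      (fderiv ℝ (fun z : Euc d × ℝ => φ z.1 z.2) z) z :=
  (hφ.smooth.differentiable (by simp) z).hasFDerivAt

theorem PSmooth.smooth_space {φ : Euc d → ℝ → ℝ} (hφ : PSmooth φ) (t : ℝ) :
    ContDiff ℝ ∞ fun x => φ x t :=
  hφ.smooth.comp (contDiff_id.prodMk contDiff_const)

theorem PSmooth.hasDerivAt_line {φ : Euc d → ℝ → ℝ} (hφ : PSmooth φ) {X : ℝ → Euc d} {S : ℝ → ℝ}
    {X' : Euc d} {S' s : ℝ} (hX : HasDerivAt X X' s) (hS : HasDerivAt S S' s) :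
    HasDerivAt (fun r => φ (X r) (S r)) (dd (X', S') φ (X s) (S s)) s :=
  HasFDerivAt.comp_hasDerivAt (f := fun r => (X r, S r)) s (hφ.hasFDerivAt (X s, S s))
    (hX.prodMk hS)

theorem PSmooth.hasDerivAt_time {φ : Euc d → ℝ → ℝ} (hφ : PSmooth φ) (x : Euc d) (t : ℝ) :
    HasDerivAt (fun r => φ x r) (dd (0, 1) φ x t) t :=
  hφ.hasDerivAt_line (hasDerivAt_const t x) (hasDerivAt_id t)

theorem PSmooth.fderiv_space {φ : Euc d → ℝ → ℝ} (hφ : PSmooth φ) (x : Euc d) (t : ℝ)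
    (ξ : Euc d) : fderiv ℝ (fun y => φ y t) x ξ = dd (ξ, 0) φ x t := by
  have h2 : HasFDerivAt (fun y => φ y t) _ x :=
    HasFDerivAt.comp (f := fun y : Euc d => (y, t)) x (hφ.hasFDerivAt (x, t))
      ((hasFDerivAt_id x).prodMk (hasFDerivAt_const t x))
  rw [h2.fderiv]
  simp [dd]

theorem PSmooth.inner_gradient {φ : Euc d → ℝ → ℝ} (hφ : PSmooth φ) (x : Euc d) (t : ℝ)
    (ξ : Euc d) : inner ℝ (gradient (fun y => φ y t) x) ξ = dd (ξ, 0) φ x t := by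
  rw [gradient, InnerProductSpace.toDual_symm_apply, hφ.fderiv_space]

theorem periodic_fderiv_prod {φ : Euc d → ℝ → ℝ} (hp : ∀ t, Periodic fun x => φ x t) (t : ℝ) :
    Periodic fun x => fderiv ℝ (fun z : Euc d × ℝ => φ z.1 z.2) (x, t) := by
  intro i x
  have : (fun z : Euc d × ℝ => (fun z : Euc d × ℝ => φ z.1 z.2)
      (z + (EuclideanSpace.single i 1, 0))) = fun z : Euc d × ℝ => φ z.1 z.2 := by
    funext z
    simpa using hp z.2 i z.1
  conv_rhs => rw [← this]
  simp only
  rw [fderiv_comp_add_right (f := fun z : Euc d × ℝ => φ z.1 z.2) (EuclideanSpace.single i 1, 0)]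
  simp

theorem PSmooth.dd {φ : Euc d → ℝ → ℝ} (hφ : PSmooth φ) (v : Euc d × ℝ) : PSmooth (dd v φ) where
  smooth := by
    have := hφ.smooth.fderiv_right (m := ∞) le_rfl
    exact this.clm_apply contDiff_const
  periodic t i x := by
    have := periodic_fderiv_prod hφ.periodic t i x
    simp only [MFG.dd]
    simp only at this
    rw [this]

theorem PSmooth.dd_comm {φ : Euc d → ℝ → ℝ} (hφ : PSmooth φ) (v w : Euc d × ℝ) (x : Euc d)
    (t : ℝ) : MFG.dd v (MFG.dd w φ) x t = MFG.dd w (MFG.dd v φ) x t := by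
  have hs : IsSymmSndFDerivAt ℝ (fun z : Euc d × ℝ => φ z.1 z.2) (x, t) :=
    hφ.smooth.contDiffAt.isSymmSndFDerivAt (by simp; exact WithTop.coe_le_coe.2 le_top)
  have h1 : ∀ v w : Euc d × ℝ, MFG.dd v (MFG.dd w φ) x t =
      fderiv ℝ (fderiv ℝ (fun z : Euc d × ℝ => φ z.1 z.2)) (x, t) v w := by
    intro v w
    have hd : DifferentiableAt ℝ (fderiv ℝ (fun z : Euc d × ℝ => φ z.1 z.2)) (x, t) :=
      (hφ.smooth.fderiv_right (m := ∞) le_rfl).differentiable (by simp) _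
    have : MFG.dd v (MFG.dd w φ) x t =
      fderiv ℝ (fun z => fderiv ℝ (fun z : Euc d × ℝ => φ z.1 z.2) z w) (x, t) v := rfl
    rw [this, fderiv_clm_apply hd (differentiableAt_const w)]
    simp
  rw [h1, h1, hs]

theorem PSmooth.const_mul {φ : Euc d → ℝ → ℝ} (hφ : PSmooth φ) (c : ℝ) :
    PSmooth fun x t => c * φ x t :=
  ⟨contDiff_const.mul hφ.smooth, fun t i x => by
    have := hφ.periodic t i x
    simp only at this ⊢
    rw [this]⟩

theorem PSmooth.sub {φ ψ : Euc d → ℝ → ℝ} (hφ : PSmooth φ) (hψ : PSmooth ψ) :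
    PSmooth fun x t => φ x t - ψ x t :=
  ⟨hφ.smooth.sub hψ.smooth, fun t i x => by
    have h1 := hφ.periodic t i x
    have h2 := hψ.periodic t i x
    simp only at h1 h2 ⊢
    rw [h1, h2]⟩

theorem PSmooth.add {φ ψ : Euc d → ℝ → ℝ} (hφ : PSmooth φ) (hψ : PSmooth ψ) :
    PSmooth fun x t => φ x t + ψ x t :=
  ⟨hφ.smooth.add hψ.smooth, fun t i x => by
    have h1 := hφ.periodic t i x
    have h2 := hψ.periodic t i x
    simp only at h1 h2 ⊢
    rw [h1, h2]⟩

theorem PSmooth.sum {ι : Type*} (s : Finset ι) {φ : ι → Euc d → ℝ → ℝ} (hφ : ∀ i, PSmooth (φ i)) :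
    PSmooth fun x t => ∑ j ∈ s, φ j x t :=
  ⟨ContDiff.sum fun j _ => (hφ j).smooth, fun t i x => by
    exact Finset.sum_congr rfl fun j _ => (hφ j).periodic t i x⟩

theorem dd_const_mul {φ : Euc d → ℝ → ℝ} (hφ : PSmooth φ) (c : ℝ) (v : Euc d × ℝ) (x : Euc d)
    (t : ℝ) : dd v (fun x t => c * φ x t) x t = c * dd v φ x t := by
  have := ((hφ.hasFDerivAt (x, t)).const_mul c).fderiv
  rw [dd, this]
  simp [dd]

theorem dd_sub {φ ψ : Euc d → ℝ → ℝ} (hφ : PSmooth φ) (hψ : PSmooth ψ) (v : Euc d × ℝ) (x : Euc d)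
    (t : ℝ) : dd v (fun x t => φ x t - ψ x t) x t = dd v φ x t - dd v ψ x t := by
  have := ((hφ.hasFDerivAt (x, t)).sub (hψ.hasFDerivAt (x, t))).fderiv
  rw [dd]
  change fderiv ℝ ((fun z : Euc d × ℝ => φ z.1 z.2) - fun z : Euc d × ℝ => ψ z.1 z.2) (x, t) v = _
  rw [this]
  simp [dd]

theorem dd_add {φ ψ : Euc d → ℝ → ℝ} (hφ : PSmooth φ) (hψ : PSmooth ψ) (v : Euc d × ℝ) (x : Euc d)
    (t : ℝ) : dd v (fun x t => φ x t + ψ x t) x t = dd v φ x t + dd v ψ x t := by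
  have := ((hφ.hasFDerivAt (x, t)).add (hψ.hasFDerivAt (x, t))).fderiv
  rw [dd]
  change fderiv ℝ ((fun z : Euc d × ℝ => φ z.1 z.2) + fun z : Euc d × ℝ => ψ z.1 z.2) (x, t) v = _
  rw [this]
  simp [dd]

theorem dd_sum {ι : Type*} (s : Finset ι) {φ : ι → Euc d → ℝ → ℝ} (hφ : ∀ i, PSmooth (φ i))
    (v : Euc d × ℝ) (x : Euc d) (t : ℝ) :
    dd v (fun x t => ∑ i ∈ s, φ i x t) x t = ∑ i ∈ s, dd v (φ i) x t := by
  have := (HasFDerivAt.fun_sum (u := s) fun i _ => (hφ i).hasFDerivAt (x, t)).fderiv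
  rw [dd, this]
  simp [dd]

/-- The Laplacian in the space variables. -/
noncomputable def lap (φ : Euc d → ℝ → ℝ) (x : Euc d) (t : ℝ) : ℝ :=
  ∑ i : Fin d, dd (EuclideanSpace.single i 1, 0) (dd (EuclideanSpace.single i 1, 0) φ) x t

theorem PSmooth.lap {φ : Euc d → ℝ → ℝ} (hφ : PSmooth φ) : PSmooth (lap φ) :=
  PSmooth.sum _ fun _ => (hφ.dd _).dd _

theorem lap_sub {φ ψ : Euc d → ℝ → ℝ} (hφ : PSmooth φ) (hψ : PSmooth ψ) (x : Euc d)
    (t : ℝ) : lap (fun x t => φ x t - ψ x t) x t = lap φ x t - lap ψ x t := by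
  simp only [lap]
  rw [← Finset.sum_sub_distrib]
  refine Finset.sum_congr rfl fun i _ => ?_
  rw [← dd_sub (hφ.dd _) (hψ.dd _)]
  congr 1
  funext x t
  exact dd_sub hφ hψ _ x t

theorem lap_const_mul {φ : Euc d → ℝ → ℝ} (hφ : PSmooth φ) (c : ℝ) (x : Euc d)
    (t : ℝ) : lap (fun x t => c * φ x t) x t = c * lap φ x t := by
  simp only [lap]
  rw [Finset.mul_sum]
  refine Finset.sum_congr rfl fun i _ => ?_
  rw [← dd_const_mul (hφ.dd _)]
  congr 1
  funext x t
  exact dd_const_mul hφ c _ x t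

theorem dd_lap {φ : Euc d → ℝ → ℝ} (hφ : PSmooth φ) (v : Euc d × ℝ) (x : Euc d) (t : ℝ) :
    dd v (lap φ) x t = lap (dd v φ) x t := by
  have : dd v (lap φ) x t = _ := dd_sum Finset.univ
    (fun i => (hφ.dd (EuclideanSpace.single i 1, 0)).dd (EuclideanSpace.single i 1, 0)) v x t
  rw [this]
  refine Finset.sum_congr rfl fun i _ => ?_
  rw [(hφ.dd _).dd_comm]
  congr 1
  funext x t
  exact hφ.dd_comm _ _ x t

theorem PSmooth.laplacian_eq {φ : Euc d → ℝ → ℝ} (hφ : PSmooth φ) (x : Euc d) (t : ℝ) :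
    Δ (fun y => φ y t) x = MFG.lap φ x t := by
  rw [InnerProductSpace.laplacian_eq_iteratedFDeriv_orthonormalBasis _ (EuclideanSpace.basisFun (Fin d) ℝ)]
  refine Finset.sum_congr rfl fun i _ => ?_
  rw [iteratedFDeriv_two_apply]
  have hd : DifferentiableAt ℝ (fderiv ℝ (fun y => φ y t)) x :=
    ((hφ.smooth_space t).fderiv_right (m := ∞) le_rfl).differentiable (by simp) _
  have h1 : fderiv ℝ (fun y => fderiv ℝ (fun y => φ y t) y (EuclideanSpace.single i 1)) x
      (EuclideanSpace.single i 1) = fderiv ℝ (fderiv ℝ (fun y => φ y t)) x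
        (EuclideanSpace.single i 1) (EuclideanSpace.single i 1) := by
    rw [fderiv_clm_apply hd (differentiableAt_const _)]
    simp
  have h2 : (fun y => fderiv ℝ (fun y => φ y t) y (EuclideanSpace.single i 1)) =
      fun y => MFG.dd (EuclideanSpace.single i 1, 0) φ y t :=
    funext fun y => hφ.fderiv_space y t _
  rw [h2, (hφ.dd _).fderiv_space] at h1
  simpa using h1.symm

theorem PSmooth.exists_bound {φ : Euc d → ℝ → ℝ} (hφ : PSmooth φ) (R : ℝ) :
    ∃ C, 0 ≤ C ∧ ∀ x t, |t| ≤ R → |φ x t| ≤ C := by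
  obtain ⟨C, h0, h⟩ := exists_bound_of_periodic (isCompact_Icc (a := -R) (b := R))
    (fun t _ => hφ.periodic t) hφ.continuous.continuousOn
  exact ⟨C, h0, fun x t ht => h x t (abs_le.1 ht)⟩

/-! ### Averages of translates -/

variable {Ω : Type*} [MeasurableSpace Ω]

/-- The average of the translates of `φ` by `(Y, S)`. -/
noncomputable def avg (P : Measure Ω) (Y : Ω → Euc d) (S : Ω → ℝ) (φ : Euc d → ℝ → ℝ)
    (x : Euc d) (t : ℝ) : ℝ :=
  ∫ o, φ (x + Y o) (t + S o) ∂P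

variable {P : Measure Ω} [IsFiniteMeasure P] {Y : Ω → Euc d} {S : Ω → ℝ}

/-- Since `|S| ≤ 1` almost surely, the translated times stay in a compact interval. With periodicity
in space the derivative is bounded there, and a constant dominates. -/
theorem PSmooth.hasFDerivAt_avg {φ : Euc d → ℝ → ℝ} (hφ : PSmooth φ) (hY : Measurable Y)
    (hS : Measurable S) (hS1 : ∀ᵐ o ∂P, |S o| ≤ 1) (x : Euc d) (t : ℝ) :
    HasFDerivAt (fun z : Euc d × ℝ => avg P Y S φ z.1 z.2)
      (∫ o, fderiv ℝ (fun z : Euc d × ℝ => φ z.1 z.2) (x + Y o, t + S o) ∂P) (x, t) := by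
  set Φ := fun z : Euc d × ℝ => φ z.1 z.2 with hΦ
  have hF : ContDiff ℝ ∞ (fderiv ℝ Φ) := hφ.smooth.fderiv_right (m := ∞) le_rfl
  obtain ⟨C, hC0, hC⟩ := exists_bound_of_periodic
    (isCompact_Icc (a := -(|t| + 2)) (b := |t| + 2))
    (f := fun x t => fderiv ℝ Φ (x, t))
    (fun t _ => periodic_fderiv_prod hφ.periodic t) hF.continuous.continuousOn
  obtain ⟨C', -, hC'⟩ := hφ.exists_bound (|t| + 1)
  refine hasFDerivAt_integral_of_dominated_of_fderiv_le (𝕜 := ℝ)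
    (F := fun (z : Euc d × ℝ) o => φ (z.1 + Y o) (z.2 + S o))
    (F' := fun z o => fderiv ℝ Φ (z.1 + Y o, z.2 + S o))
    (bound := fun _ => C) (Metric.ball_mem_nhds (x, t) one_pos) ?_ ?_ ?_ ?_ (integrable_const _) ?_
  · refine Eventually.of_forall fun z => ?_
    exact (hφ.continuous.measurable.comp
      ((measurable_const.add hY).prodMk (measurable_const.add hS))).aestronglyMeasurable
  · refine Integrable.of_bound (C := C') ?_ ?_
    · exact (hφ.continuous.measurable.comp
        ((measurable_const.add hY).prodMk (measurable_const.add hS))).aestronglyMeasurable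
    · filter_upwards [hS1] with o ho
      exact hC' _ _ ((abs_add_le _ _).trans (by simpa using ho))
  · exact (hF.continuous.measurable.comp
        ((measurable_const.add hY).prodMk (measurable_const.add hS))).aestronglyMeasurable
  · filter_upwards [hS1] with o ho z hz
    apply hC
    rw [mem_Icc, ← abs_le]
    have h1 : dist z.2 t < 1 := lt_of_le_of_lt (le_max_right _ _) hz
    rw [Real.dist_eq] at h1
    have : z.2 + S o = t + (z.2 - t) + S o := by ring
    rw [this]
    refine (abs_add_le _ _).trans ?_
    have := abs_add_le t (z.2 - t)
    linarith
  · refine Eventually.of_forall fun o z _ => ?_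
    have h1 := hφ.hasFDerivAt ((z.1 + Y o, z.2 + S o) : Euc d × ℝ)
    have h2 : HasFDerivAt (fun z : Euc d × ℝ => Φ (z + (Y o, S o)))
        (fderiv ℝ Φ (z + (Y o, S o))) z := (hasFDerivAt_comp_add_right _).2 h1
    exact h2

theorem PSmooth.dd_avg {φ : Euc d → ℝ → ℝ} (hφ : PSmooth φ) (hY : Measurable Y)
    (hS : Measurable S) (hS1 : ∀ᵐ o ∂P, |S o| ≤ 1) (v : Euc d × ℝ) :
    MFG.dd v (avg P Y S φ) = avg P Y S (MFG.dd v φ) := by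
  funext x t
  rw [MFG.dd, (hφ.hasFDerivAt_avg hY hS hS1 x t).fderiv, ContinuousLinearMap.integral_apply]
  · rfl
  · obtain ⟨C, hC0, hC⟩ := exists_bound_of_periodic
      (isCompact_Icc (a := -(|t| + 1)) (b := |t| + 1))
      (f := fun x t => fderiv ℝ (fun z : Euc d × ℝ => φ z.1 z.2) (x, t))
      (fun t _ => periodic_fderiv_prod hφ.periodic t)
      (hφ.smooth.fderiv_right (m := ∞) le_rfl).continuous.continuousOn
    refine Integrable.of_bound (C := C) ?_ ?_
    · exact ((hφ.smooth.fderiv_right (m := ∞) le_rfl).continuous.measurable.comp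
        ((measurable_const.add hY).prodMk (measurable_const.add hS))).aestronglyMeasurable
    · filter_upwards [hS1] with o ho
      apply hC
      rw [mem_Icc, ← abs_le]
      exact (abs_add_le _ _).trans (by simpa using ho)

theorem PSmooth.avg {φ : Euc d → ℝ → ℝ} (hφ : PSmooth φ) (hY : Measurable Y)
    (hS : Measurable S) (hS1 : ∀ᵐ o ∂P, |S o| ≤ 1) : PSmooth (avg P Y S φ) where
  smooth := by
    rw [contDiff_infty]
    intro n
    induction n generalizing φ with
    | zero =>
      refine contDiff_zero.2 (Differentiable.continuous (𝕜 := ℝ) ?_)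
      exact fun z => (hφ.hasFDerivAt_avg hY hS hS1 z.1 z.2).differentiableAt
    | succ n ih =>
      push_cast
      rw [contDiff_succ_iff_fderiv_apply]
      refine ⟨fun z => (hφ.hasFDerivAt_avg hY hS hS1 z.1 z.2).differentiableAt, by simp, ?_⟩
      intro v
      have := ih (hφ.dd v)
      rw [← hφ.dd_avg hY hS hS1 v] at this
      exact this
  periodic t i x := by
    simp only [MFG.avg]
    congr 1
    funext o
    rw [add_right_comm]
    exact hφ.periodic _ i _

end SmoothPeriodic

end MFG

namespace MFG

/-! ### The heat semigroup on periodic functions -/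

section Heat

variable {d : ℕ}

/-- The mass of `exp (-|z|²)`. -/
noncomputable def gaussMass (d : ℕ) : ℝ := ∫ z : Euc d, Real.exp (-1 * ‖z‖ ^ 2)

theorem gaussMass_pos : 0 < gaussMass d := by
  rw [gaussMass, GaussianFourier.integral_rexp_neg_mul_sq_norm one_pos]
  positivity

/-- The density of the Gaussian measure `gaussM`. -/
noncomputable def gk (z : Euc d) : ℝ := (gaussMass d)⁻¹ * Real.exp (-1 * ‖z‖ ^ 2)

theorem gk_pos (z : Euc d) : 0 < gk z := mul_pos (inv_pos.2 gaussMass_pos) (Real.exp_pos _)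

theorem continuous_gk : Continuous (gk : Euc d → ℝ) := by
  unfold gk
  fun_prop

/-- The Gaussian probability measure with density proportional to `exp (-|z|²)`. -/
noncomputable def gaussM (d : ℕ) : Measure (Euc d) :=
  volume.withDensity fun z => ENNReal.ofReal (gk z)

theorem integrable_gk : Integrable (gk : Euc d → ℝ) :=
  (integrable_exp_neg_sq one_pos).const_mul _

instance : IsProbabilityMeasure (gaussM d) := by
  constructor
  rw [gaussM, withDensity_apply _ MeasurableSet.univ, Measure.restrict_univ,
    ← ofReal_integral_eq_lintegral_ofReal integrable_gk
      (Eventually.of_forall fun z => (gk_pos z).le)]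
  have : ∫ z : Euc d, gk z = 1 := by
    unfold gk
    rw [integral_const_mul]
    exact inv_mul_cancel₀ gaussMass_pos.ne'
  rw [this, ENNReal.ofReal_one]

theorem integral_gaussM (F : Euc d → ℝ) : ∫ z, F z ∂(gaussM d) = ∫ z, gk z * F z := by
  rw [gaussM, integral_withDensity_eq_integral_toReal_smul]
  · simp [ENNReal.toReal_ofReal (gk_pos _).le]
  · exact continuous_gk.measurable.ennreal_ofReal
  · simp

theorem integrable_gaussM_iff (F : Euc d → ℝ) :
    Integrable F (gaussM d) ↔ Integrable fun z => gk z * F z := by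
  rw [gaussM, integrable_withDensity_iff_integrable_smul₀']
  · simp [ENNReal.toReal_ofReal (gk_pos _).le]
  · exact continuous_gk.measurable.ennreal_ofReal.aemeasurable
  · simp

theorem norm_mul_exp_le (z : Euc d) :
    ‖z‖ * Real.exp (-1 * ‖z‖ ^ 2) ≤ Real.exp (-(1 / 2) * ‖z‖ ^ 2) := by
  have h1 : ‖z‖ ≤ Real.exp (1 / 2 * ‖z‖ ^ 2) := by
    have := Real.add_one_le_exp (1 / 2 * ‖z‖ ^ 2)
    nlinarith [sq_nonneg (‖z‖ - 1)]
  calc ‖z‖ * Real.exp (-1 * ‖z‖ ^ 2)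
      ≤ Real.exp (1 / 2 * ‖z‖ ^ 2) * Real.exp (-1 * ‖z‖ ^ 2) :=
        mul_le_mul_of_nonneg_right h1 (Real.exp_pos _).le
    _ = _ := by rw [← Real.exp_add]; ring_nf

theorem integrable_norm_gaussM : Integrable (fun z : Euc d => ‖z‖) (gaussM d) := by
  rw [integrable_gaussM_iff]
  refine Integrable.mono' ((integrable_exp_neg_sq (d := d) (b := 1 / 2) (by norm_num)).const_mul
    (gaussMass d)⁻¹) ?_ (Eventually.of_forall fun z => ?_)
  · exact (continuous_gk.mul continuous_norm).aestronglyMeasurable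
  · rw [Real.norm_of_nonneg (mul_nonneg (gk_pos z).le (norm_nonneg _)), gk, mul_assoc]
    refine mul_le_mul_of_nonneg_left ?_ (inv_pos.2 gaussMass_pos).le
    rw [mul_comm]
    exact norm_mul_exp_le z

theorem fderiv_gk (z ξ : Euc d) : fderiv ℝ gk z ξ = -2 * inner ℝ z ξ * gk z := by
  have h1 : HasFDerivAt (fun z : Euc d => ‖z‖ ^ 2) _ z :=
    (hasStrictFDerivAt_norm_sq z).hasFDerivAt
  have h2 := ((h1.const_mul (-1)).exp.const_mul (gaussMass d)⁻¹).fderiv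
  have h3 : fderiv ℝ (gk : Euc d → ℝ) z = _ := h2
  rw [h3]
  simp [gk]
  ring

theorem differentiable_gk : Differentiable ℝ (gk : Euc d → ℝ) := by
  intro z
  have h1 : HasFDerivAt (fun z : Euc d => ‖z‖ ^ 2) _ z :=
    (hasStrictFDerivAt_norm_sq z).hasFDerivAt
  exact ((h1.const_mul (-1)).exp.const_mul (gaussMass d)⁻¹).differentiableAt

theorem PSmooth.bdd_slice {ψ : Euc d → ℝ → ℝ} (hψ : PSmooth ψ) (τ : ℝ) :
    ∃ C, 0 ≤ C ∧ ∀ x, |ψ x τ| ≤ C := by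
  obtain ⟨C, h0, h⟩ := hψ.exists_bound |τ|
  exact ⟨C, h0, fun x => h x τ le_rfl⟩

/-- Gaussian integration by parts, from `∂_ξ gk = -2 ⟨z, ξ⟩ gk`. It is used in both directions: to
recognise the Laplacian in the derivative of the semigroup, and to take a derivative off a rough
function. -/
theorem PSmooth.integral_inner_mul {ψ : Euc d → ℝ → ℝ} (hψ : PSmooth ψ) (x ξ : Euc d)
    (τ r : ℝ) :
    ∫ z, inner ℝ z ξ * ψ (x + r • z) τ ∂(gaussM d) =
      r / 2 * ∫ z, MFG.dd (ξ, 0) ψ (x + r • z) τ ∂(gaussM d) := by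
  obtain ⟨C, hC0, hC⟩ := hψ.bdd_slice τ
  obtain ⟨C', hC'0, hC'⟩ := (hψ.dd (ξ, 0)).bdd_slice τ
  have hd : ∀ z, fderiv ℝ (fun z => ψ (x + r • z) τ) z ξ =
      r * MFG.dd (ξ, 0) ψ (x + r • z) τ := by
    intro z
    have h1 : HasFDerivAt (fun z : Euc d => x + r • z) (r • ContinuousLinearMap.id ℝ (Euc d)) z :=
      ((hasFDerivAt_id z).const_smul r).const_add x
    have h2 : HasFDerivAt (fun y => ψ y τ) (fderiv ℝ (fun y => ψ y τ) (x + r • z)) (x + r • z) :=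
      ((hψ.smooth_space τ).differentiable (by simp) _).hasFDerivAt
    have h3 := (h2.comp z h1).fderiv
    have h4 : fderiv ℝ (fun z => ψ (x + r • z) τ) z = _ := h3
    rw [h4, ← hψ.fderiv_space]
    simp
  have hcont : Continuous fun z => ψ (x + r • z) τ :=
    (hψ.smooth_space τ).continuous.comp (by fun_prop)
  have hcont' : Continuous fun z => MFG.dd (ξ, 0) ψ (x + r • z) τ :=
    ((hψ.dd _).smooth_space τ).continuous.comp (by fun_prop)
  have hin : Continuous fun z : Euc d => (inner ℝ z ξ : ℝ) := by fun_prop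
  have hI1 : Integrable fun z : Euc d => gk z * (inner ℝ z ξ * ψ (x + r • z) τ) := by
    rw [← integrable_gaussM_iff]
    refine Integrable.mono' (integrable_norm_gaussM.mul_const (‖ξ‖ * C)) ?_
      (Eventually.of_forall fun z => ?_)
    · exact (hin.mul hcont).aestronglyMeasurable
    · rw [norm_mul, ← mul_assoc]
      exact mul_le_mul (norm_inner_le_norm z ξ) (hC _) (norm_nonneg _) (by positivity)
  have hI2 : Integrable fun z : Euc d => gk z * MFG.dd (ξ, 0) ψ (x + r • z) τ := by
    rw [← integrable_gaussM_iff]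
    exact Integrable.of_bound hcont'.aestronglyMeasurable C' (Eventually.of_forall fun z => hC' _)
  have hI3 : Integrable fun z : Euc d => gk z * ψ (x + r • z) τ := by
    rw [← integrable_gaussM_iff]
    exact Integrable.of_bound hcont.aestronglyMeasurable C (Eventually.of_forall fun z => hC _)
  have key := integral_mul_fderiv_eq_neg_fderiv_mul_of_integrable
    (μ := (volume : Measure (Euc d))) (f := gk) (g := fun z => ψ (x + r • z) τ) (v := ξ) ?_ ?_ hI3
    (fun z _ => differentiable_gk z) ?_
  · rw [integral_gaussM, integral_gaussM]
    simp_rw [hd, fderiv_gk] at key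
    have e1 : ∫ z, gk z * (r * MFG.dd (ξ, 0) ψ (x + r • z) τ) =
        r * ∫ z, gk z * MFG.dd (ξ, 0) ψ (x + r • z) τ := by
      rw [← integral_const_mul]
      congr 1
      funext z
      ring
    have e2 : ∫ z, -2 * inner ℝ z ξ * gk z * ψ (x + r • z) τ =
        -2 * ∫ z, gk z * (inner ℝ z ξ * ψ (x + r • z) τ) := by
      rw [← integral_const_mul]
      congr 1
      funext z
      ring
    rw [e1, e2] at key
    linarith
  · simp_rw [fderiv_gk]
    convert! hI1.const_mul (-2) using 2
    ring
  · simp_rw [hd]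
    convert! hI2.const_mul r using 2
    ring
  · exact fun z _ => ((hψ.smooth_space τ).comp
      (by fun_prop : ContDiff ℝ ∞ fun z : Euc d => x + r • z)).differentiable (by simp) z

/-- The space-time heat operator: the heat semigroup at time `s` applied to `φ (·, t + s)`. -/
noncomputable def heat (s : ℝ) (φ : Euc d → ℝ → ℝ) : Euc d → ℝ → ℝ :=
  avg (gaussM d) (fun z => (2 * √s) • z) (fun _ => s) φ

theorem heat_apply (s : ℝ) (φ : Euc d → ℝ → ℝ) (x : Euc d) (t : ℝ) :
    heat s φ x t = ∫ z, φ (x + (2 * √s) • z) (t + s) ∂(gaussM d) := rfl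

theorem heat_zero (φ : Euc d → ℝ → ℝ) (x : Euc d) (t : ℝ) : heat 0 φ x t = φ x t := by
  simp [heat_apply]

theorem PSmooth.integrable_heat {φ : Euc d → ℝ → ℝ} (hφ : PSmooth φ) (r : ℝ) (x : Euc d) (τ : ℝ) :
    Integrable (fun z => φ (x + r • z) τ) (gaussM d) := by
  obtain ⟨C, hC0, hC⟩ := hφ.bdd_slice τ
  exact Integrable.of_bound (((hφ.smooth_space τ).continuous.comp
    (by fun_prop)).aestronglyMeasurable) C (Eventually.of_forall fun z => hC _)

theorem PSmooth.heat {φ : Euc d → ℝ → ℝ} (hφ : PSmooth φ) {s : ℝ} (hs : 0 ≤ s) (hs1 : s ≤ 1) :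
    PSmooth (heat s φ) :=
  hφ.avg (by fun_prop) measurable_const (Eventually.of_forall fun _ => by rwa [abs_of_nonneg hs])

theorem PSmooth.dd_heat {φ : Euc d → ℝ → ℝ} (hφ : PSmooth φ) {s : ℝ} (hs : 0 ≤ s) (hs1 : s ≤ 1)
    (v : Euc d × ℝ) : MFG.dd v (MFG.heat s φ) = MFG.heat s (MFG.dd v φ) :=
  hφ.dd_avg (by fun_prop) measurable_const
    (Eventually.of_forall fun _ => by rwa [abs_of_nonneg hs]) v

theorem heat_add {φ ψ : Euc d → ℝ → ℝ} (hφ : PSmooth φ) (hψ : PSmooth ψ) (s : ℝ) (x : Euc d)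
    (t : ℝ) : heat s (fun x t => φ x t + ψ x t) x t = heat s φ x t + heat s ψ x t :=
  integral_add (hφ.integrable_heat _ x _) (hψ.integrable_heat _ x _)

theorem heat_sub {φ ψ : Euc d → ℝ → ℝ} (hφ : PSmooth φ) (hψ : PSmooth ψ) (s : ℝ) (x : Euc d)
    (t : ℝ) : heat s (fun x t => φ x t - ψ x t) x t = heat s φ x t - heat s ψ x t :=
  integral_sub (hφ.integrable_heat _ x _) (hψ.integrable_heat _ x _)

theorem PSmooth.heat_le {φ : Euc d → ℝ → ℝ} (hφ : PSmooth φ) {s t c : ℝ}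
    (h : ∀ x, φ x (t + s) ≤ c) (x : Euc d) : MFG.heat s φ x t ≤ c := by
  have := integral_mono (hφ.integrable_heat (2 * √s) x (t + s))
    (integrable_const (μ := gaussM d) c) (fun _ => h _)
  simpa [heat_apply] using this

theorem PSmooth.continuousOn_heat {φ : Euc d → ℝ → ℝ} (hφ : PSmooth φ) (x : Euc d) (t : ℝ) :
    ContinuousOn (fun s => MFG.heat s φ x t) (Icc 0 1) := by
  obtain ⟨C, hC0, hC⟩ := hφ.exists_bound (|t| + 1)
  refine continuousOn_of_dominated (bound := fun _ => C) ?_ ?_ (integrable_const _) ?_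
  · intro s _
    exact ((hφ.smooth_space _).continuous.comp (by fun_prop)).aestronglyMeasurable
  · intro s hs
    refine Eventually.of_forall fun z => hC _ _ ((abs_add_le _ _).trans ?_)
    rw [abs_of_nonneg hs.1]
    linarith [hs.2]
  · refine Eventually.of_forall fun z => Continuous.continuousOn ?_
    exact hφ.continuous.comp (f := fun s : ℝ => (x + (2 * √s) • z, t + s)) (by fun_prop)

theorem dd_linear (φ : Euc d → ℝ → ℝ) (c : ℝ) (z : Euc d) (x : Euc d) (t : ℝ) :
    dd (c • z, 1) φ x t =
      c * ∑ i, inner ℝ z (EuclideanSpace.single i (1 : ℝ)) * dd (EuclideanSpace.single i 1, 0) φ x t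
        + dd (0, 1) φ x t := by
  have hz : z = ∑ i, (inner ℝ z (EuclideanSpace.single i (1 : ℝ)) : ℝ) •
      (EuclideanSpace.single i (1 : ℝ) : Euc d) := by
    have := (EuclideanSpace.basisFun (Fin d) ℝ).sum_repr' z
    simp only [EuclideanSpace.basisFun_apply, real_inner_comm] at this ⊢
    exact this.symm
  have h1 : ((c • z, 1) : Euc d × ℝ) = c • (∑ i, (inner ℝ z (EuclideanSpace.single i (1 : ℝ)) : ℝ) •
      ((EuclideanSpace.single i (1 : ℝ), 0) : Euc d × ℝ)) + (0, 1) := by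
    ext1
    · simp only [Prod.fst_add, Prod.smul_fst, Prod.fst_sum, add_zero]
      rw [← hz]
    · simp [Prod.snd_sum]
  simp only [dd]
  rw [h1, map_add, map_smul, map_sum, smul_eq_mul]
  simp_rw [map_smul, smul_eq_mul]

/-- The chain rule gives the derivative of `φ` in the direction `(z/√s, 1)`. The factor `z` becomes
a second space derivative times `√s` by Gaussian integration by parts, leaving `Δφ`; the time shift
built into `heat` contributes `φ_t`. -/
theorem PSmooth.hasDerivAt_heat {φ : Euc d → ℝ → ℝ} (hφ : PSmooth φ) (x : Euc d) (t : ℝ) {s : ℝ}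
    (hs : 0 < s) : HasDerivAt (fun s => MFG.heat s φ x t)
      (MFG.heat s (fun x t => MFG.lap φ x t + MFG.dd (0, 1) φ x t) x t) s := by
  obtain ⟨C, hC0, hC⟩ := exists_bound_of_periodic
    (isCompact_Icc (a := -(|t| + 2 * s)) (b := |t| + 2 * s))
    (f := fun x t => fderiv ℝ (fun z : Euc d × ℝ => φ z.1 z.2) (x, t))
    (fun t _ => periodic_fderiv_prod hφ.periodic t)
    (hφ.smooth.fderiv_right (m := ∞) le_rfl).continuous.continuousOn
  have hdd : ∀ σ, 0 < σ → ∀ z, HasDerivAt (fun s => φ (x + (2 * √s) • z) (t + s))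
      (MFG.dd ((√σ)⁻¹ • z, 1) φ (x + (2 * √σ) • z) (t + σ)) σ := by
    intro σ hσ z
    refine hφ.hasDerivAt_line (X := fun s => x + (2 * √s) • z) (S := fun s => t + s) ?_ ?_
    · have h1 : HasDerivAt (fun s : ℝ => 2 * √s) (√σ)⁻¹ σ := by
        convert! (Real.hasDerivAt_sqrt hσ.ne').const_mul 2 using 1
        field_simp
      exact (h1.smul_const z).const_add x
    · exact (hasDerivAt_id σ).const_add t
  -- The neighbourhood `(s/2, 2s)` keeps `1/√σ` bounded, so an affine function of `‖z‖` dominates.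
  have key := hasDerivAt_integral_of_dominated_loc_of_deriv_le (μ := gaussM d)
    (F := fun s z => φ (x + (2 * √s) • z) (t + s))
    (F' := fun s z => MFG.dd ((√s)⁻¹ • z, 1) φ (x + (2 * √s) • z) (t + s))
    (x₀ := s) (s := Ioo (s / 2) (2 * s)) (bound := fun z => C * ((√(s / 2))⁻¹ * ‖z‖ + 1))
    (Ioo_mem_nhds (by linarith) (by linarith)) ?_ (hφ.integrable_heat _ x _) ?_ ?_ ?_ ?_
  · refine key.2.congr_deriv ?_
    rw [heat_add hφ.lap (hφ.dd _), heat_apply, heat_apply]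
    simp_rw [dd_linear]
    have hint : ∀ i : Fin d, Integrable (fun z => inner ℝ z (EuclideanSpace.single i (1 : ℝ)) *
        MFG.dd (EuclideanSpace.single i 1, 0) φ (x + (2 * √s) • z) (t + s)) (gaussM d) := by
      intro i
      obtain ⟨C', hC'0, hC'⟩ := (hφ.dd (EuclideanSpace.single i 1, 0)).bdd_slice (t + s)
      refine Integrable.mono' (integrable_norm_gaussM.mul_const C') ?_
        (Eventually.of_forall fun z => ?_)
      · exact (Continuous.mul (by fun_prop) (((hφ.dd _).smooth_space _).continuous.comp
          (by fun_prop))).aestronglyMeasurable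
      · rw [norm_mul]
        refine mul_le_mul ?_ (hC' _) (norm_nonneg _) (norm_nonneg _)
        refine (norm_inner_le_norm _ _).trans ?_
        simp
    rw [integral_add ((integrable_finsetSum _ fun i _ => hint i).const_mul _)
      ((hφ.dd _).integrable_heat _ x _), integral_const_mul, integral_finsetSum _ fun i _ => hint i]
    congr 1
    simp only [MFG.lap]
    rw [integral_finsetSum _ fun i _ => ((hφ.dd _).dd _).integrable_heat _ x _, Finset.mul_sum]
    refine Finset.sum_congr rfl fun i _ => ?_
    rw [(hφ.dd _).integral_inner_mul, ← mul_assoc]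
    have : (√s)⁻¹ * (2 * √s / 2) = 1 := by
      have := Real.sqrt_pos.2 hs
      field_simp
    rw [this, one_mul]
  · exact Eventually.of_forall fun σ =>
      ((hφ.smooth_space _).continuous.comp (by fun_prop)).aestronglyMeasurable
  · simp only [MFG.dd]
    have := (hφ.smooth.fderiv_right (m := ∞) le_rfl).continuous
    exact ((this.comp (by fun_prop : Continuous fun z : Euc d => (x + (2 * √s) • z, t + s))).clm_apply
      (by fun_prop)).aestronglyMeasurable
  · refine Eventually.of_forall fun z σ hσ => ?_
    refine (ContinuousLinearMap.le_opNorm _ _).trans ?_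
    refine mul_le_mul (hC _ _ ?_) ?_ (norm_nonneg _) hC0
    · rw [mem_Icc, ← abs_le]
      refine (abs_add_le _ _).trans ?_
      rw [abs_of_pos (by linarith [hσ.1] : 0 < σ)]
      linarith [hσ.2]
    · have h0 : 0 ≤ (√(s / 2))⁻¹ * ‖z‖ := by positivity
      rw [Prod.norm_def]
      refine max_le ?_ ?_
      · rw [norm_smul, norm_inv, Real.norm_of_nonneg (Real.sqrt_nonneg _)]
        have : (√σ)⁻¹ ≤ (√(s / 2))⁻¹ :=
          inv_anti₀ (Real.sqrt_pos.2 (by linarith)) (Real.sqrt_le_sqrt hσ.1.le)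
        nlinarith [norm_nonneg z]
      · simpa using h0
  · exact ((integrable_norm_gaussM.const_mul _).add (integrable_const 1)).const_mul C
  · refine Eventually.of_forall fun z σ hσ => hdd σ (by linarith [hσ.1]) z

theorem PSmooth.heat_sub_self {φ : Euc d → ℝ → ℝ} (hφ : PSmooth φ) (x : Euc d) (t : ℝ) {θ : ℝ}
    (hθ : 0 ≤ θ) (hθ1 : θ ≤ 1) :
    ∫ s in (0 : ℝ)..θ, MFG.heat s (fun x t => MFG.lap φ x t + MFG.dd (0, 1) φ x t) x t =
      MFG.heat θ φ x t - φ x t := by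
  have hsub : Icc 0 θ ⊆ Icc 0 1 := Icc_subset_Icc_right hθ1
  rw [intervalIntegral.integral_eq_sub_of_hasDerivAt_of_le hθ
    ((hφ.continuousOn_heat x t).mono hsub) (fun s hs => hφ.hasDerivAt_heat x t hs.1), heat_zero]
  apply ContinuousOn.intervalIntegrable
  rw [uIcc_of_le hθ]
  exact ((hφ.lap.add (hφ.dd _)).continuousOn_heat x t).mono hsub

end Heat

end MFG

namespace MFG

/-! ### Smoothing estimates for the heat semigroup and the Duhamel corrector. -/

section HeatEstimates

variable {d : ℕ}

theorem exists_heat_le (d : ℕ) : ∃ C : ℝ, 0 < C ∧ ∀ φ : Euc d → ℝ → ℝ, PSmooth φ →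
    ∀ s t : ℝ, 0 < s → s ≤ 1 → (∀ x, 0 ≤ φ x (t + s)) → ∀ x,
      heat s φ x t ≤ C * s ^ (-(d / 2 : ℝ)) * ∫ w in cube d, φ w (t + s) := by
  obtain ⟨C, hC, h⟩ := exists_integral_gaussian_le d
  refine ⟨(gaussMass d)⁻¹ * C, mul_pos (inv_pos.2 gaussMass_pos) hC,
    fun φ hφ s t hs hs1 h0 x => ?_⟩
  have hN := inv_pos.2 (gaussMass_pos (d := d))
  have hc := (hφ.smooth_space (t + s)).continuous
  have := h (fun x => φ x (t + s)) hc (hφ.periodic _) h0 s hs hs1 x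
  rw [heat_apply, integral_gaussM]
  obtain ⟨B, hB0, hB⟩ := hφ.bdd_slice (t + s)
  calc ∫ z, gk z * φ (x + (2 * √s) • z) (t + s)
      ≤ ∫ z, (gaussMass d)⁻¹ *
          (Real.exp (-(1 / 2) * ‖z‖ ^ 2) * φ (x + (2 * √s) • z) (t + s)) := by
        refine integral_mono_of_nonneg
          (Eventually.of_forall fun z => mul_nonneg (gk_pos z).le (h0 _)) ?_
          (Eventually.of_forall fun z => ?_)
        · refine Integrable.const_mul ((integrable_exp_neg_sq (by norm_num)).mul_bdd (c := B)
            (Continuous.aestronglyMeasurable (hc.comp (by fun_prop)))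
            (Eventually.of_forall fun z => hB _)) _
        · simp only [gk]
          rw [mul_assoc]
          refine mul_le_mul_of_nonneg_left (mul_le_mul_of_nonneg_right ?_ (h0 _)) hN.le
          exact Real.exp_le_exp.2 (by nlinarith [sq_nonneg ‖z‖])
    _ = (gaussMass d)⁻¹ * ∫ z, Real.exp (-(1 / 2) * ‖z‖ ^ 2) * φ (x + (2 * √s) • z) (t + s) :=
        integral_const_mul _ _
    _ ≤ (gaussMass d)⁻¹ * (C * s ^ (-(d / 2 : ℝ)) * ∫ w in cube d, φ w (t + s)) :=
        mul_le_mul_of_nonneg_left this hN.le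
    _ = _ := by ring

/-- A pointwise substitute for Hölder's inequality: integrating it against a kernel and then
choosing the threshold `A` to balance both terms gives an `L^q` bound. -/
theorem le_add_rpow_mul {a A q : ℝ} (ha : 0 ≤ a) (hA : 0 < A) (hq : 1 ≤ q) :
    a ≤ A + A ^ (1 - q) * a ^ q := by
  by_cases h : a ≤ A
  · have : 0 ≤ A ^ (1 - q) * a ^ q := by positivity
    linarith
  · push Not at h
    have ha' : 0 < a := hA.trans h
    have h1 : A ^ (q - 1) ≤ a ^ (q - 1) := Real.rpow_le_rpow hA.le h.le (by linarith)
    have h2 : A ^ (1 - q) * a ^ q = (A ^ (q - 1))⁻¹ * a ^ (q - 1) * a := by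
      rw [← Real.rpow_neg hA.le, mul_assoc, ← Real.rpow_add_one ha'.ne']
      congr 2 <;> ring
    have h3 : 1 ≤ (A ^ (q - 1))⁻¹ * a ^ (q - 1) := by
      rw [inv_mul_eq_div, le_div_iff₀ (Real.rpow_pos_of_pos hA _)]
      linarith
    rw [h2]
    nlinarith

/-- The `L^q`–`L^∞` bound for the gradient of the semigroup. Integration by parts costs `s^(-1/2)`
and a factor `‖z‖`, which half of the Gaussian exponent absorbs; averaging an `L^q` function costs
`s^(-d/(2q))`. -/
theorem exists_abs_heat_dd_le (d : ℕ) {q : ℝ} (hq : 1 ≤ q) :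
    ∃ C : ℝ, 0 < C ∧ ∀ φ : Euc d → ℝ → ℝ, PSmooth φ → ∀ F : ℝ, 0 < F →
      ∀ s t : ℝ, 0 < s → s ≤ 1 → ∫ w in cube d, |φ w (t + s)| ^ q ≤ F ^ q →
        ∀ ξ : Euc d, ‖ξ‖ ≤ 1 → ∀ x,
          |heat s (dd (ξ, 0) φ) x t| ≤ C * F * s ^ ((1 / 2 - d / (2 * q)) - 1 : ℝ) := by
  obtain ⟨C, hC, h⟩ := exists_integral_gaussian_le d
  set N2 : ℝ := ∫ z : Euc d, Real.exp (-(1 / 2) * ‖z‖ ^ 2) with hN2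
  have hN20 : 0 ≤ N2 := integral_nonneg fun _ => (Real.exp_pos _).le
  have hN := inv_pos.2 (gaussMass_pos (d := d))
  refine ⟨(gaussMass d)⁻¹ * (N2 + C), by positivity, ?_⟩
  intro φ hφ F hF s t hs hs1 hint ξ hξ x
  have hq0 : 0 < q := by linarith
  have hc := (hφ.smooth_space (t + s)).continuous
  set g : Euc d → ℝ := fun y => |φ y (t + s)| ^ q with hg
  have hgc : Continuous g := hc.abs.rpow_const fun _ => Or.inr hq0.le
  have hgp : Periodic g := fun i y => by
    have := hφ.periodic (t + s) i y
    simp only at this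
    simp only [hg, this]
  have hgs := h g hgc hgp (fun y => by positivity) s hs hs1 x
  obtain ⟨B, hB0, hB⟩ := hφ.bdd_slice (t + s)
  obtain ⟨B', hB'0, hB'⟩ := hgp.exists_bound hgc
  have hsq : 0 < √s := Real.sqrt_pos.2 hs
  have hrep : heat s (dd (ξ, 0) φ) x t =
      (√s)⁻¹ * ∫ z, inner ℝ z ξ * φ (x + (2 * √s) • z) (t + s) ∂(gaussM d) := by
    rw [hφ.integral_inner_mul, heat_apply, ← mul_assoc]
    have : (√s)⁻¹ * (2 * √s / 2) = 1 := by field_simp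
    rw [this, one_mul]
  -- This threshold satisfies `A^q = s^(-d/2) F^q`, so both terms of `le_add_rpow_mul` contribute a
  -- multiple of `A`.
  set A : ℝ := s ^ (-(d / (2 * q)) : ℝ) * F with hA
  have hA0 : 0 < A := by positivity
  have hE : Integrable fun z : Euc d => Real.exp (-(1 / 2) * ‖z‖ ^ 2) :=
    integrable_exp_neg_sq (by norm_num)
  have hEg : Integrable fun z : Euc d => Real.exp (-(1 / 2) * ‖z‖ ^ 2) * g (x + (2 * √s) • z) :=
    hE.mul_bdd (c := B') (hgc.comp (by fun_prop)).aestronglyMeasurable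
      (Eventually.of_forall fun z => hB' _)
  have h1 : |∫ z, inner ℝ z ξ * φ (x + (2 * √s) • z) (t + s) ∂(gaussM d)| ≤
      ∫ z, (gaussMass d)⁻¹ * (A * Real.exp (-(1 / 2) * ‖z‖ ^ 2) +
        A ^ (1 - q) * (Real.exp (-(1 / 2) * ‖z‖ ^ 2) * g (x + (2 * √s) • z))) := by
    rw [integral_gaussM, ← Real.norm_eq_abs]
    refine norm_integral_le_of_norm_le
      (((hE.const_mul _).add (hEg.const_mul _)).const_mul _) (Eventually.of_forall fun z => ?_)
    rw [norm_mul, Real.norm_of_nonneg (gk_pos z).le, gk, mul_assoc]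
    refine mul_le_mul_of_nonneg_left ?_ hN.le
    have e1 : ‖inner ℝ z ξ * φ (x + (2 * √s) • z) (t + s)‖ ≤
        ‖z‖ * |φ (x + (2 * √s) • z) (t + s)| := by
      rw [norm_mul]
      refine mul_le_mul_of_nonneg_right ?_ (norm_nonneg _)
      refine (norm_inner_le_norm _ _).trans ?_
      nlinarith [norm_nonneg z]
    calc Real.exp (-1 * ‖z‖ ^ 2) * ‖inner ℝ z ξ * φ (x + (2 * √s) • z) (t + s)‖
        ≤ Real.exp (-1 * ‖z‖ ^ 2) * (‖z‖ * |φ (x + (2 * √s) • z) (t + s)|) :=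
          mul_le_mul_of_nonneg_left e1 (Real.exp_pos _).le
      _ = (‖z‖ * Real.exp (-1 * ‖z‖ ^ 2)) * |φ (x + (2 * √s) • z) (t + s)| := by ring
      _ ≤ Real.exp (-(1 / 2) * ‖z‖ ^ 2) * |φ (x + (2 * √s) • z) (t + s)| :=
          mul_le_mul_of_nonneg_right (norm_mul_exp_le z) (abs_nonneg _)
      _ ≤ Real.exp (-(1 / 2) * ‖z‖ ^ 2) * (A + A ^ (1 - q) * g (x + (2 * √s) • z)) :=
          mul_le_mul_of_nonneg_left (le_add_rpow_mul (abs_nonneg _) hA0 hq) (Real.exp_pos _).le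
      _ = _ := by ring
  rw [integral_const_mul, integral_add (hE.const_mul _) (hEg.const_mul _), integral_const_mul,
    integral_const_mul, ← hN2] at h1
  have h2 : A ^ (1 - q) * ∫ z, Real.exp (-(1 / 2) * ‖z‖ ^ 2) * g (x + (2 * √s) • z) ≤ C * A := by
    calc _ ≤ A ^ (1 - q) * (C * s ^ (-(d / 2 : ℝ)) * F ^ q) := by
          refine mul_le_mul_of_nonneg_left (hgs.trans ?_) (by positivity)
          exact mul_le_mul_of_nonneg_left hint (by positivity)
      _ = C * (A ^ (1 - q) * A ^ q) := by
          have : A ^ q = s ^ (-(d / 2 : ℝ)) * F ^ q := by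
            rw [hA, Real.mul_rpow (by positivity) hF.le, ← Real.rpow_mul hs.le]
            congr 2
            field_simp
          rw [this]; ring
      _ = C * A := by
          rw [← Real.rpow_add hA0]
          simp
  rw [hrep, abs_mul, abs_of_pos (inv_pos.2 hsq)]
  calc (√s)⁻¹ * |∫ z, inner ℝ z ξ * φ (x + (2 * √s) • z) (t + s) ∂(gaussM d)|
      ≤ (√s)⁻¹ * ((gaussMass d)⁻¹ * (A * N2 + C * A)) := by
        refine mul_le_mul_of_nonneg_left (h1.trans ?_) (inv_pos.2 hsq).le
        exact mul_le_mul_of_nonneg_left (by linarith) hN.le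
    _ = (gaussMass d)⁻¹ * (N2 + C) * F * ((√s)⁻¹ * s ^ (-(d / (2 * q)) : ℝ)) := by
        rw [hA]; ring
    _ = _ := by
        congr 1
        rw [Real.sqrt_eq_rpow, ← Real.rpow_neg hs.le, ← Real.rpow_add hs]
        congr 1
        ring

/-- The Duhamel average `∫₀^θ P_s φ (t + s) ds`. -/
noncomputable def duh (θ : ℝ) (φ : Euc d → ℝ → ℝ) : Euc d → ℝ → ℝ :=
  avg ((gaussM d).prod (volume.restrict (Ioc 0 θ))) (fun o => (2 * √o.2) • o.1)
    (fun o => o.2) φ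

theorem ae_abs_snd_le {θ : ℝ} (hθ1 : θ ≤ 1) :
    ∀ᵐ o ∂((gaussM d).prod (volume.restrict (Ioc 0 θ))), |o.2| ≤ 1 := by
  have h : ∀ᵐ s ∂(volume.restrict (Ioc 0 θ)), |s| ≤ 1 := by
    filter_upwards [ae_restrict_mem measurableSet_Ioc] with s hs
    rw [abs_of_pos hs.1]
    exact hs.2.trans hθ1
  exact Measure.quasiMeasurePreserving_snd.ae h

theorem PSmooth.integrable_duh {φ : Euc d → ℝ → ℝ} (hφ : PSmooth φ) {θ : ℝ} (hθ1 : θ ≤ 1)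
    (x : Euc d) (t : ℝ) :
    Integrable (fun o : Euc d × ℝ => φ (x + (2 * √o.2) • o.1) (t + o.2))
      ((gaussM d).prod (volume.restrict (Ioc 0 θ))) := by
  obtain ⟨C, hC0, hC⟩ := hφ.exists_bound (|t| + 1)
  refine Integrable.of_bound ?_ C ?_
  · exact (hφ.continuous.comp (f := fun o : Euc d × ℝ => (x + (2 * √o.2) • o.1, t + o.2))
      (by fun_prop)).aestronglyMeasurable
  · filter_upwards [ae_abs_snd_le hθ1] with o ho
    exact hC _ _ ((abs_add_le _ _).trans (by linarith))

theorem PSmooth.duh_eq {φ : Euc d → ℝ → ℝ} (hφ : PSmooth φ) {θ : ℝ} (hθ : 0 ≤ θ) (hθ1 : θ ≤ 1)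
    (x : Euc d) (t : ℝ) : MFG.duh θ φ x t = ∫ s in (0 : ℝ)..θ, MFG.heat s φ x t := by
  rw [MFG.duh, MFG.avg, integral_prod_symm _ (hφ.integrable_duh hθ1 x t),
    intervalIntegral.integral_of_le hθ]
  rfl

theorem PSmooth.duh {φ : Euc d → ℝ → ℝ} (hφ : PSmooth φ) {θ : ℝ} (hθ1 : θ ≤ 1) :
    PSmooth (duh θ φ) :=
  hφ.avg (by fun_prop) (by fun_prop) (ae_abs_snd_le hθ1)

theorem PSmooth.dd_duh {φ : Euc d → ℝ → ℝ} (hφ : PSmooth φ) {θ : ℝ} (hθ1 : θ ≤ 1)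
    (v : Euc d × ℝ) : MFG.dd v (MFG.duh θ φ) = MFG.duh θ (MFG.dd v φ) :=
  hφ.dd_avg (by fun_prop) (by fun_prop) (ae_abs_snd_le hθ1) v

theorem PSmooth.lap_duh {φ : Euc d → ℝ → ℝ} (hφ : PSmooth φ) {θ : ℝ} (hθ1 : θ ≤ 1) (x : Euc d)
    (t : ℝ) : MFG.lap (MFG.duh θ φ) x t = MFG.duh θ (MFG.lap φ) x t := by
  simp only [MFG.lap]
  simp_rw [hφ.dd_duh hθ1, (hφ.dd _).dd_duh hθ1]
  exact (integral_finsetSum Finset.univ fun i _ =>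
    ((hφ.dd (EuclideanSpace.single i 1, 0)).dd (EuclideanSpace.single i 1, 0)).integrable_duh
      hθ1 x t).symm

/-- The operator `Δ + ∂_t` applied to `P_s φ(t+s)` is its `s`-derivative, so the integral
telescopes. Subtracting `duh θ f` from a solution thus trades the source `f` for `P_θ f(t+θ)`. -/
theorem PSmooth.duh_equation {φ : Euc d → ℝ → ℝ} (hφ : PSmooth φ) {θ : ℝ} (hθ : 0 ≤ θ)
    (hθ1 : θ ≤ 1) (x : Euc d) (t : ℝ) :
    MFG.lap (MFG.duh θ φ) x t + MFG.dd (0, 1) (MFG.duh θ φ) x t =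
      MFG.heat θ φ x t - φ x t := by
  rw [← hφ.heat_sub_self x t hθ hθ1, ← (hφ.lap.add (hφ.dd _)).duh_eq hθ hθ1, hφ.lap_duh hθ1,
    hφ.dd_duh hθ1]
  exact (integral_add (hφ.lap.integrable_duh hθ1 x t) ((hφ.dd _).integrable_duh hθ1 x t)).symm

/-- Here `d < q` enters: it makes `1/2 - d/(2q)` positive and the singularity at `s = 0` integrable.
-/
theorem abs_integral_heat_dd_le {q C F : ℝ} (hqd : (d : ℝ) < q)
    {φ : Euc d → ℝ → ℝ} {ξ : Euc d} {x : Euc d} {t θ : ℝ} (hθ : 0 ≤ θ)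
    (h : ∀ s, 0 < s → s ≤ θ → 
      |heat s (dd (ξ, 0) φ) x t| ≤ C * F * s ^ ((1 / 2 - d / (2 * q)) - 1 : ℝ)) :
    |∫ s in (0 : ℝ)..θ, heat s (dd (ξ, 0) φ) x t| ≤
      C / (1 / 2 - d / (2 * q)) * F * θ ^ (1 / 2 - d / (2 * q) : ℝ) := by
  have hq0 : 0 < q := lt_of_le_of_lt (Nat.cast_nonneg d) hqd
  have hγ : (0 : ℝ) < 1 / 2 - d / (2 * q) := by
    rw [sub_pos, div_lt_div_iff₀ (by positivity) (by norm_num)]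
    linarith
  set γ : ℝ := 1 / 2 - d / (2 * q)
  have h1 := intervalIntegral.norm_integral_le_of_norm_le (μ := volume)
    (f := fun s => heat s (dd (ξ, 0) φ) x t) (g := fun s => C * F * s ^ (γ - 1)) hθ
    (Eventually.of_forall fun s hs => h s hs.1 hs.2)
    ((intervalIntegral.intervalIntegrable_rpow' (by linarith)).const_mul _)
  rw [Real.norm_eq_abs] at h1
  refine h1.trans (le_of_eq ?_)
  rw [intervalIntegral.integral_const_mul, integral_rpow (Or.inl (by linarith))]
  rw [sub_add_cancel, Real.zero_rpow hγ.ne']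
  field_simp
  ring

end HeatEstimates

end MFG

namespace MFG

/-! ### Pointwise inequalities for the Hamiltonian -/

section Hamiltonian

variable {d : ℕ} {H : Euc d → Euc d → ℝ} {μ : ℝ}

theorem IsHamiltonian.smooth_p (hH : IsHamiltonian H μ) (x : Euc d) : ContDiff ℝ ∞ (H x) :=
  hH.smooth.comp (contDiff_const.prodMk contDiff_id)

theorem IsHamiltonian.exists_growth (hH : IsHamiltonian H μ) :
    ∃ c A : ℝ, 0 < c ∧ 0 ≤ A ∧ ∀ x p, c * ‖p‖ ^ (2 + μ) ≤ H x p ∧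
      H x p ≤ A * (1 + ‖p‖ ^ (2 + μ)) := by
  obtain ⟨c₁, c₂, C₁, C₂, h1, h2, h3, h4, h⟩ := hH.growth
  refine ⟨c₁, c₂ + C₂, h1, by positivity, fun x p => ⟨by linarith [(h x p).1], ?_⟩⟩
  have h0 : 0 ≤ ‖p‖ ^ (2 + μ) := by positivity
  nlinarith [(h x p).2]

/-- The assumed bound on `|D_pH|²` and the growth of `H` give order `|p|^μ |p|^(2+μ)`, the square of
`|p|^(1+μ)`. -/
theorem IsHamiltonian.exists_gradP_le (hH : IsHamiltonian H μ) :
    ∃ C : ℝ, 0 ≤ C ∧ ∀ x p, ‖gradP H x p‖ ≤ C * (1 + ‖p‖ ^ (1 + μ)) := by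
  obtain ⟨c, A, hc, hA, hg⟩ := hH.exists_growth
  obtain ⟨C, hC⟩ := hH.gradP_le
  have hμ := hH.mu_pos
  refine ⟨1 + |C| * (A + 1), by positivity, fun x p => ?_⟩
  set y := ‖p‖ ^ (1 + μ) with hy
  have hy0 : 0 ≤ y := by positivity
  have hyμ : ‖p‖ ^ μ ≤ 1 + y := by
    rcases le_total ‖p‖ 1 with h | h
    · have := Real.rpow_le_one (norm_nonneg p) h hμ.le
      linarith
    · have := Real.rpow_le_rpow_of_exponent_le h (by linarith : μ ≤ 1 + μ)
      linarith
  have hyy : ‖p‖ ^ μ * ‖p‖ ^ (2 + μ) = y ^ 2 := by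
    rw [hy, ← Real.rpow_natCast, ← Real.rpow_mul (norm_nonneg p),
      ← Real.rpow_add_of_nonneg (norm_nonneg p) hμ.le (by linarith)]
    congr 1
    push_cast
    ring
  have hμ0 : 0 ≤ ‖p‖ ^ μ := by positivity
  have h1 : C * ‖p‖ ^ μ * H x p ≤ |C| * (‖p‖ ^ μ * H x p) := by
    rw [mul_assoc]
    exact mul_le_mul_of_nonneg_right (le_abs_self C)
      (mul_nonneg hμ0 (by linarith [hH.one_le x p]))
  have h2 : ‖p‖ ^ μ * H x p ≤ A * (1 + y + y ^ 2) := by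
    calc ‖p‖ ^ μ * H x p ≤ ‖p‖ ^ μ * (A * (1 + ‖p‖ ^ (2 + μ))) :=
          mul_le_mul_of_nonneg_left (hg x p).2 hμ0
      _ = A * (‖p‖ ^ μ + ‖p‖ ^ μ * ‖p‖ ^ (2 + μ)) := by ring
      _ ≤ _ := by rw [hyy]; exact mul_le_mul_of_nonneg_left (by linarith) hA
  have h3 : ‖gradP H x p‖ ^ 2 ≤ (|C| * (A + 1)) * (1 + y) ^ 2 := by
    have h4 := mul_le_mul_of_nonneg_left h2 (abs_nonneg C)
    have h5 := hC x p
    have h6 := le_abs_self C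
    have h7 := abs_nonneg C
    nlinarith [mul_nonneg h7 hy0, mul_nonneg (mul_nonneg h7 hA) hy0, mul_nonneg h7 (sq_nonneg y)]
  refine abs_le_of_sq_le_sq' (h3.trans ?_) (by positivity) |>.2
  rw [mul_pow]
  refine mul_le_mul_of_nonneg_right ?_ (sq_nonneg _)
  nlinarith [sq_nonneg (|C| * (A + 1)), mul_nonneg (abs_nonneg C) (by linarith : 0 ≤ A + 1)]

theorem IsHamiltonian.exists_abs_sub_le (hH : IsHamiltonian H μ) :
    ∃ C : ℝ, 0 ≤ C ∧ (∀ x p, ‖gradP H x p‖ ≤ C * (1 + ‖p‖ ^ (1 + μ))) ∧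
      ∀ x p e, |H x (p + e) - H x p| ≤ C * (1 + (‖p‖ + ‖e‖) ^ (1 + μ)) * ‖e‖ := by
  obtain ⟨C, hC0, hC⟩ := hH.exists_gradP_le
  have hμ := hH.mu_pos
  refine ⟨C, hC0, hC, fun x p e => ?_⟩
  have hdiff : Differentiable ℝ (H x) := (hH.smooth_p x).differentiable (by simp)
  have h := (convex_closedBall (0 : Euc d) (‖p‖ + ‖e‖)).norm_image_sub_le_of_norm_fderiv_le
    (𝕜 := ℝ) (f := H x) (C := C * (1 + (‖p‖ + ‖e‖) ^ (1 + μ))) (x := p) (y := p + e)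
    (fun q _ => hdiff q) (fun q hq => ?_) (by simp) (by simpa using norm_add_le p e)
  · simpa using h
  · have h1 : ‖fderiv ℝ (H x) q‖ = ‖gradP H x q‖ := by
      rw [gradP, gradient, LinearIsometryEquiv.norm_map]
    rw [h1]
    refine (hC x q).trans (mul_le_mul_of_nonneg_left ?_ hC0)
    have : ‖q‖ ≤ ‖p‖ + ‖e‖ := by simpa using hq
    have := Real.rpow_le_rpow (norm_nonneg q) this (by linarith : 0 ≤ 1 + μ)
    linarith

theorem neg_sq_add_le {Λ R β z : ℝ} {s : ℝ} (hΛ : 0 < Λ) (hz : 0 ≤ z) (hs : R / Λ + β ≤ s) :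
    -(1 / Λ) * z ^ 2 + (R / Λ) * z + β * z ≤ Λ * s ^ 2 / 4 := by
  have h1 : (R / Λ) * z + β * z ≤ s * z := by nlinarith
  have h2 : 0 ≤ (1 / Λ) * (z - Λ * s / 2) ^ 2 := by positivity
  have h3 : (1 / Λ) * (z - Λ * s / 2) ^ 2 = (1 / Λ) * z ^ 2 - s * z + Λ * s ^ 2 / 4 := by
    field_simp
    ring
  linarith

/-- The expression multiplying `λ exp (λ Φ)` in the energy identity. -/
noncomputable def bracket (H : Euc d → Euc d → ℝ) (Λ κ : ℝ) (x p e ξ ζ : Euc d) : ℝ :=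
  -(1 / Λ) * ‖ζ‖ ^ 2 + (1 / Λ) * ((H x (p + e) - H x p) * inner ℝ ζ ξ) - inner ℝ (gradX H x p) ξ
    - inner ℝ (gradP H x p) ζ - κ * (inner ℝ (gradP H x p) (p + e) - H x (p + e))

/-- In the application `p = DU`, `e = Dv` and `ζ = DΦ`. Only `ζ` is uncontrolled; it enters through
a negative square and linear terms, and completing the square eliminates it. -/
theorem bracket_le {Λ κ : ℝ} (hΛ : 0 < Λ) {x p e ξ ζ : Euc d} (hξ : ‖ξ‖ ≤ 1) {s : ℝ}
    (hs : |H x (p + e) - H x p| / Λ + ‖gradP H x p‖ ≤ s) :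
    bracket H Λ κ x p e ξ ζ ≤ Λ * s ^ 2 / 4 + ‖gradX H x p‖
      - κ * (inner ℝ (gradP H x p) (p + e) - H x (p + e)) := by
  have h1 := neg_sq_add_le hΛ (norm_nonneg ζ) hs
  have h2 : (1 / Λ) * ((H x (p + e) - H x p) * inner ℝ ζ ξ) ≤
      |H x (p + e) - H x p| / Λ * ‖ζ‖ := by
    rw [div_mul_eq_mul_div, div_mul_eq_mul_div, one_mul]
    refine div_le_div_of_nonneg_right ?_ hΛ.le
    refine (le_abs_self _).trans ?_
    rw [abs_mul]
    refine mul_le_mul_of_nonneg_left ?_ (abs_nonneg _)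
    refine (abs_real_inner_le_norm _ _).trans ?_
    nlinarith [norm_nonneg ζ]
  have h3 : -inner ℝ (gradX H x p) ξ ≤ ‖gradX H x p‖ := by
    refine (neg_le_abs _).trans ((abs_real_inner_le_norm _ _).trans ?_)
    nlinarith [norm_nonneg (gradX H x p)]
  have h4 : -inner ℝ (gradP H x p) ζ ≤ ‖gradP H x p‖ * ‖ζ‖ :=
    (neg_le_abs _).trans (abs_real_inner_le_norm _ _)
  unfold bracket
  linarith

set_option maxHeartbeats 1000000 in
-- When `|p| ≥ Γ Λ`, replacing `p` by `p + e` perturbs the Lagrangian by at most half of its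
-- coercive part, and `κ` is tuned so that the other half cancels the completed square and `D_xH`.
-- Without that lower bound on `|p|`, only a crude polynomial bound in `K` is claimed.
theorem IsHamiltonian.exists_bracket_le (hH : IsHamiltonian H μ) {L : ℝ} (hL : 0 ≤ L) :
    ∃ κ₁ κ₂ Γ C : ℝ, 0 ≤ κ₁ ∧ 0 ≤ κ₂ ∧ 1 ≤ Γ ∧ 0 ≤ C ∧
      ∀ K Λ : ℝ, 1 ≤ K → 0 < Λ → Λ ≤ L * K → ∀ x p e ξ ζ : Euc d, ‖e‖ ≤ Λ → ‖p + e‖ ≤ K →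
        ‖ξ‖ ≤ 1 →
        (Γ * Λ ≤ ‖p‖ →
          bracket H Λ (κ₁ + κ₂ * (Λ * K ^ μ)) x p e ξ ζ ≤ C * (1 + Λ * K ^ μ)) ∧
        bracket H Λ (κ₁ + κ₂ * (Λ * K ^ μ)) x p e ξ ζ ≤ C * K ^ 5 := by
  obtain ⟨Cb, hCb0, hCb, hR⟩ := hH.exists_abs_sub_le
  obtain ⟨c₁, A, hc₁, hA, hg⟩ := hH.exists_growth
  obtain ⟨c, Cl, hc, hCl, hl⟩ := hH.lagr_ge
  obtain ⟨Cx', hCx'⟩ := hH.derivX_le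
  have hμ := hH.mu_pos
  have hμ1 := hH.mu_lt_one
  set Cx := |Cx'| with hCxdef
  have hCx0 : 0 ≤ Cx := abs_nonneg _
  have hCx : ∀ x p, ‖gradX H x p‖ ≤ Cx * H x p + Cx := fun x p => by
    have h1 := (hCx' x p).1
    have h2 := hH.one_le x p
    have h3 := le_abs_self Cx'
    nlinarith
  -- `C₃ K^μ H` bounds the square of the linear coefficient in `ζ`. The values of `κ₁` and `κ₂` make
  -- `κ (c/2) H` equal to `Cx H + Λ C₃ K^μ H / 4`, exactly what must be cancelled, and `Γ` makes the
  -- error in the Lagrangian at most `(c/2) H`.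
  obtain ⟨C₃, hC₃⟩ : ∃ r, r = 50 * Cb ^ 2 * (1 + (1 + L) / c₁) := ⟨_, rfl⟩
  have hC₃0 : 0 ≤ C₃ := by rw [hC₃]; positivity
  obtain ⟨κ₁, hκ₁⟩ : ∃ r, r = 2 * Cx / c := ⟨_, rfl⟩
  obtain ⟨κ₂, hκ₂⟩ : ∃ r, r = C₃ / (2 * c) := ⟨_, rfl⟩
  have hκ₁0 : 0 ≤ κ₁ := by rw [hκ₁]; positivity
  have hκ₂0 : 0 ≤ κ₂ := by rw [hκ₂]; positivity
  obtain ⟨Γ, hΓ⟩ : ∃ r, r = 1 + 10 * Cb / c * (1 + 2 / c₁) := ⟨_, rfl⟩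
  have hΓ1 : 1 ≤ Γ := by
    have : 0 ≤ 10 * Cb / c * (1 + 2 / c₁) := by positivity
    rw [hΓ]
    linarith
  -- From `‖p‖ ≤ K + Λ` and `Λ ≤ L K` it follows that `‖p‖ + Λ ≤ (1 + 2L) K`.
  obtain ⟨B, hB⟩ : ∃ r, r = 1 + 2 * L := ⟨_, rfl⟩
  have hB1 : 1 ≤ B := by rw [hB]; linarith
  obtain ⟨D, hD⟩ : ∃ r, r = L * 4 * Cb ^ 2 + (Cx * (2 * A) + Cx) + (κ₁ + κ₂ * L) * (2 * Cb + 2 * A) := ⟨_, rfl⟩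
  have hD0 : 0 ≤ D := by rw [hD]; positivity
  refine ⟨κ₁, κ₂, Γ, (Cx + κ₁ * Cl + κ₂ * Cl) + D * B ^ 5, hκ₁0, hκ₂0, hΓ1, by positivity, ?_⟩
  intro K Λ hK hΛ hΛK x p e ξ ζ he hpe hξ
  have hKμ : 1 ≤ K ^ μ := Real.one_le_rpow hK hμ.le
  have hH1 := hH.one_le x p
  have hp : ‖p‖ ≤ K + Λ := by
    have := norm_sub_le (p + e) e
    rw [add_sub_cancel_right] at this
    linarith
  have hRe : |H x (p + e) - H x p| / Λ ≤ Cb * (1 + (‖p‖ + Λ) ^ (1 + μ)) := by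
    rw [div_le_iff₀ hΛ]
    refine (hR x p e).trans (mul_le_mul (mul_le_mul_of_nonneg_left ?_ hCb0) he (norm_nonneg _)
      (by positivity))
    have := Real.rpow_le_rpow (by positivity) (by linarith : ‖p‖ + ‖e‖ ≤ ‖p‖ + Λ)
      (by linarith : 0 ≤ 1 + μ)
    linarith
  set κ := κ₁ + κ₂ * (Λ * K ^ μ) with hκ
  have hκ0 : 0 ≤ κ := by positivity
  constructor
  · intro hgood
    have hΛp : Λ ≤ ‖p‖ := (le_mul_of_one_le_left hΛ.le hΓ1).trans hgood
    set y := ‖p‖ ^ (1 + μ) with hy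
    have hy0 : 0 ≤ y := by positivity
    have hpp : 0 < ‖p‖ := hΛ.trans_le hΛp
    have h2y : (‖p‖ + Λ) ^ (1 + μ) ≤ 4 * y := by
      calc (‖p‖ + Λ) ^ (1 + μ) ≤ (2 * ‖p‖) ^ (1 + μ) :=
            Real.rpow_le_rpow (by positivity) (by linarith) (by linarith)
        _ = 2 ^ (1 + μ) * y := Real.mul_rpow (by norm_num) hpp.le
        _ ≤ 4 * y := by
            refine mul_le_mul_of_nonneg_right ?_ hy0
            calc (2 : ℝ) ^ (1 + μ) ≤ 2 ^ (2 : ℝ) :=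
                  Real.rpow_le_rpow_of_exponent_le (by norm_num) (by linarith)
              _ = 4 := by norm_num
    have hS : |H x (p + e) - H x p| / Λ + ‖gradP H x p‖ ≤ 5 * Cb * (1 + y) := by
      have h1 := hCb x p
      have h2 := mul_le_mul_of_nonneg_left h2y hCb0
      linarith
    have hpy : ‖p‖ * y ≤ H x p / c₁ := by
      rw [le_div_iff₀ hc₁]
      have h1 := (hg x p).1
      have h2 : ‖p‖ ^ (2 + μ) = ‖p‖ * y := by
        rw [hy, ← Real.rpow_one_add' hpp.le (by linarith)]
        congr 1
        ring
      rw [h2] at h1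
      linarith
    have hp1 : ‖p‖ ≤ H x p + H x p / c₁ := by
      rcases le_total ‖p‖ 1 with h | h
      · have : 0 ≤ H x p / c₁ := by positivity
        linarith
      · have : ‖p‖ ≤ ‖p‖ * y := le_mul_of_one_le_right hpp.le (Real.one_le_rpow h (by linarith))
        linarith
    -- Since `y² = ‖p‖^μ ‖p‖^(2+μ)`, the part `‖p‖^(2+μ)` is paid by `H`, and `‖p‖^μ` by `K^μ`.
    have hS2 : (5 * Cb * (1 + y)) ^ 2 ≤ C₃ * (K ^ μ * H x p) := by
      have hyy : y ^ 2 = ‖p‖ ^ μ * (‖p‖ * y) := by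
        rw [hy, ← Real.rpow_one_add' hpp.le (by linarith), ← Real.rpow_add hpp,
          ← Real.rpow_natCast, ← Real.rpow_mul hpp.le]
        congr 1
        push_cast
        ring
      have hpμ : ‖p‖ ^ μ ≤ (1 + L) * K ^ μ := by
        calc ‖p‖ ^ μ ≤ ((1 + L) * K) ^ μ :=
              Real.rpow_le_rpow hpp.le (by linarith) hμ.le
          _ = (1 + L) ^ μ * K ^ μ := Real.mul_rpow (by linarith) (by linarith)
          _ ≤ (1 + L) * K ^ μ := by
              refine mul_le_mul_of_nonneg_right ?_ (by linarith)
              calc (1 + L) ^ μ ≤ (1 + L) ^ (1 : ℝ) :=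
                    Real.rpow_le_rpow_of_exponent_le (by linarith) hμ1.le
                _ = 1 + L := Real.rpow_one _
      have h1 : y ^ 2 ≤ (1 + L) * K ^ μ * (H x p / c₁) := by
        rw [hyy]
        exact mul_le_mul hpμ hpy (by positivity) (by positivity)
      have h2 : 1 ≤ K ^ μ * H x p := one_le_mul_of_one_le_of_one_le hKμ hH1
      have h3 : (1 + y) ^ 2 ≤ 2 * (1 + y ^ 2) := by linarith [sq_nonneg (1 - y)]
      have h4 : 1 + y ^ 2 ≤ (1 + (1 + L) / c₁) * (K ^ μ * H x p) := by
        have : (1 + L) * K ^ μ * (H x p / c₁) = (1 + L) / c₁ * (K ^ μ * H x p) := by ring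
        rw [this] at h1
        linarith
      calc (5 * Cb * (1 + y)) ^ 2 = 25 * Cb ^ 2 * (1 + y) ^ 2 := by ring
        _ ≤ 25 * Cb ^ 2 * (2 * ((1 + (1 + L) / c₁) * (K ^ μ * H x p))) :=
            mul_le_mul_of_nonneg_left (by linarith) (by positivity)
        _ = _ := by rw [hC₃]; ring
    have hlag : c / 2 * H x p - Cl ≤ inner ℝ (gradP H x p) (p + e) - H x (p + e) := by
      have h1 := hl x p
      rw [lagr] at h1
      rw [inner_add_right]
      have h2 : -inner ℝ (gradP H x p) e ≤ ‖gradP H x p‖ * Λ :=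
        (neg_le_abs _).trans ((abs_real_inner_le_norm _ _).trans
          (mul_le_mul_of_nonneg_left he (norm_nonneg _)))
      have h3 : H x (p + e) - H x p ≤ |H x (p + e) - H x p| / Λ * Λ := by
        rw [div_mul_cancel₀ _ hΛ.ne']
        exact le_abs_self _
      have h4 : (|H x (p + e) - H x p| / Λ + ‖gradP H x p‖) * Λ ≤ c / 2 * H x p := by
        have h5 : Λ ≤ ‖p‖ / Γ := by
          rw [le_div_iff₀ (by linarith)]
          linarith
        calc (|H x (p + e) - H x p| / Λ + ‖gradP H x p‖) * Λ
            ≤ (5 * Cb * (1 + y)) * (‖p‖ / Γ) := mul_le_mul hS h5 hΛ.le (by positivity)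
          _ = 5 * Cb * (‖p‖ + ‖p‖ * y) / Γ := by ring
          _ ≤ 5 * Cb * (H x p * (1 + 2 / c₁)) / Γ := by
              refine div_le_div_of_nonneg_right (mul_le_mul_of_nonneg_left ?_ (by positivity))
                (by linarith)
              have : H x p * (1 + 2 / c₁) = H x p + H x p / c₁ + H x p / c₁ := by ring
              linarith
          _ ≤ c / 2 * H x p := by
              rw [div_le_iff₀ (by linarith)]
              have : c / 2 * H x p * Γ = c / 2 * H x p + 5 * Cb * (H x p * (1 + 2 / c₁)) := by
                rw [hΓ]
                field_simp
                ring
              rw [this]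
              have : 0 ≤ c / 2 * H x p := by positivity
              linarith
      linarith
    refine (bracket_le hΛ hξ hS).trans ?_
    have h1 : Λ * (5 * Cb * (1 + y)) ^ 2 / 4 ≤ Λ * (C₃ * (K ^ μ * H x p)) / 4 := by
      have := mul_le_mul_of_nonneg_left hS2 hΛ.le
      linarith
    have h2 := mul_le_mul_of_nonneg_left hlag hκ0
    have h3 : κ * (c / 2 * H x p - Cl) =
        Cx * H x p + Λ * (C₃ * (K ^ μ * H x p)) / 4 - κ * Cl := by
      rw [hκ, hκ₁, hκ₂]
      field_simp
      ring
    have h4 := hCx x p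
    have h5 : κ * Cl = κ₁ * Cl + κ₂ * Cl * (Λ * K ^ μ) := by rw [hκ]; ring
    have h6 : 0 ≤ Λ * K ^ μ := by positivity
    have h7 : 0 ≤ D * B ^ 5 := by positivity
    have h8 : 0 ≤ κ₁ * Cl := by positivity
    have h9 : 0 ≤ κ₂ * Cl := by positivity
    calc _ ≤ Cx + κ₁ * Cl + κ₂ * Cl * (Λ * K ^ μ) := by linarith
      _ ≤ _ := by linarith [mul_nonneg hCx0 h6, mul_nonneg h7 h6, mul_nonneg h8 h6]
  -- All sizes are now powers of `Q`. The fifth power appears as `Λ s²` with `s` of order `Q²`, and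
  -- as `κ` of order `Q²` times a Lagrangian of order `Q³`.
  · set Q := B * K with hQ
    have hQ1 : 1 ≤ Q := one_le_mul_of_one_le_of_one_le hB1 hK
    have hKQ : K ≤ Q := le_mul_of_one_le_left (by linarith) hB1
    have hpQ : ‖p‖ + Λ ≤ Q := by
      rw [hQ, hB]
      linarith
    have hpow : ∀ r, 0 ≤ r → r ≤ Q → r ^ (1 + μ) ≤ Q ^ 2 ∧ r ^ (2 + μ) ≤ Q ^ 3 := by
      intro r hr hrQ
      constructor
      · calc r ^ (1 + μ) ≤ Q ^ (1 + μ) := Real.rpow_le_rpow hr hrQ (by linarith)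
          _ ≤ Q ^ (2 : ℝ) := Real.rpow_le_rpow_of_exponent_le hQ1 (by linarith)
          _ = Q ^ 2 := by norm_cast
      · calc r ^ (2 + μ) ≤ Q ^ (2 + μ) := Real.rpow_le_rpow hr hrQ (by linarith)
          _ ≤ Q ^ (3 : ℝ) := Real.rpow_le_rpow_of_exponent_le hQ1 (by linarith)
          _ = Q ^ 3 := by norm_cast
    have hQ2 : 1 ≤ Q ^ 2 := one_le_pow₀ hQ1
    have hQ3 : 1 ≤ Q ^ 3 := one_le_pow₀ hQ1
    have hQ35 : Q ^ 3 ≤ Q ^ 5 := pow_le_pow_right₀ hQ1 (by norm_num)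
    have hb : ‖gradP H x p‖ ≤ 2 * Cb * Q ^ 2 := by
      have h1 := hCb x p
      have h2 := (hpow ‖p‖ (norm_nonneg p) (by linarith)).1
      have h3 := mul_le_mul_of_nonneg_left (add_le_add hQ2 h2) hCb0
      linarith
    have hS : |H x (p + e) - H x p| / Λ + ‖gradP H x p‖ ≤ 4 * Cb * Q ^ 2 := by
      have h2 := (hpow (‖p‖ + Λ) (by positivity) hpQ).1
      have h3 := mul_le_mul_of_nonneg_left (add_le_add hQ2 h2) hCb0
      linarith
    have hHp : H x p ≤ 2 * A * Q ^ 3 := by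
      have h1 := (hg x p).2
      have h2 := (hpow ‖p‖ (norm_nonneg p) (by linarith)).2
      have h3 := mul_le_mul_of_nonneg_left (add_le_add hQ3 h2) hA
      linarith
    have hHpe : H x (p + e) ≤ 2 * A * Q ^ 3 := by
      have h1 := (hg x (p + e)).2
      have h2 := (hpow ‖p + e‖ (norm_nonneg _) (by linarith)).2
      have h3 := mul_le_mul_of_nonneg_left (add_le_add hQ3 h2) hA
      linarith
    have hlag : -(inner ℝ (gradP H x p) (p + e) - H x (p + e)) ≤ (2 * Cb + 2 * A) * Q ^ 3 := by
      have h1 : -inner ℝ (gradP H x p) (p + e) ≤ ‖gradP H x p‖ * ‖p + e‖ :=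
        (neg_le_abs _).trans (abs_real_inner_le_norm _ _)
      have h2 : ‖gradP H x p‖ * ‖p + e‖ ≤ 2 * Cb * Q ^ 2 * Q :=
        mul_le_mul hb (hpe.trans hKQ) (norm_nonneg _) (by positivity)
      linarith
    have hKμK : K ^ μ ≤ Q := by
      calc K ^ μ ≤ K ^ (1 : ℝ) := Real.rpow_le_rpow_of_exponent_le hK hμ1.le
        _ = K := Real.rpow_one K
        _ ≤ Q := hKQ
    have hΛQ : Λ ≤ L * Q := hΛK.trans (mul_le_mul_of_nonneg_left hKQ hL)
    have hκQ : κ ≤ (κ₁ + κ₂ * L) * Q ^ 2 := by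
      have h1 : Λ * K ^ μ ≤ L * Q * Q := mul_le_mul hΛQ hKμK (by positivity) (by positivity)
      have h2 := mul_le_mul_of_nonneg_left h1 hκ₂0
      have h3 : κ₁ ≤ κ₁ * Q ^ 2 := le_mul_of_one_le_right hκ₁0 hQ2
      rw [hκ]
      linarith
    refine (bracket_le hΛ hξ hS).trans ?_
    have h1 : Λ * (4 * Cb * Q ^ 2) ^ 2 / 4 ≤ L * 4 * Cb ^ 2 * Q ^ 5 := by
      have := mul_le_mul_of_nonneg_right hΛQ (by positivity : 0 ≤ (4 * Cb * Q ^ 2) ^ 2)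
      linarith
    have h2 : ‖gradX H x p‖ ≤ (Cx * (2 * A) + Cx) * Q ^ 5 := by
      have h3 := hCx x p
      have h4 := mul_le_mul_of_nonneg_left hHp hCx0
      have h5 : (Cx * (2 * A) + Cx) * Q ^ 3 ≤ (Cx * (2 * A) + Cx) * Q ^ 5 :=
        mul_le_mul_of_nonneg_left hQ35 (by positivity)
      have h6 := mul_le_mul_of_nonneg_left hQ3 hCx0
      linarith
    have h3 : -κ * (inner ℝ (gradP H x p) (p + e) - H x (p + e)) ≤
        (κ₁ + κ₂ * L) * (2 * Cb + 2 * A) * Q ^ 5 := by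
      calc -κ * (inner ℝ (gradP H x p) (p + e) - H x (p + e))
          = κ * -(inner ℝ (gradP H x p) (p + e) - H x (p + e)) := by ring
        _ ≤ κ * ((2 * Cb + 2 * A) * Q ^ 3) := mul_le_mul_of_nonneg_left hlag hκ0
        _ ≤ (κ₁ + κ₂ * L) * Q ^ 2 * ((2 * Cb + 2 * A) * Q ^ 3) :=
            mul_le_mul_of_nonneg_right hκQ (by positivity)
        _ = _ := by ring
    have h4 : 0 ≤ Cx + κ₁ * Cl + κ₂ * Cl := by positivity
    have h5 : Q ^ 5 = B ^ 5 * K ^ 5 := mul_pow B K 5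
    have h6 : D * Q ^ 5 = D * B ^ 5 * K ^ 5 := by rw [h5]; ring
    have h7 : 0 ≤ (Cx + κ₁ * Cl + κ₂ * Cl) * K ^ 5 := by positivity
    have h8 : D * Q ^ 5 = L * 4 * Cb ^ 2 * Q ^ 5 + (Cx * (2 * A) + Cx) * Q ^ 5
        + (κ₁ + κ₂ * L) * (2 * Cb + 2 * A) * Q ^ 5 := by rw [hD]; ring
    linarith

end Hamiltonian

end MFG

namespace MFG

/-! ### Exponential energy -/

section Energy

variable {d : ℕ}

theorem PSmooth.mul {φ ψ : Euc d → ℝ → ℝ} (hφ : PSmooth φ) (hψ : PSmooth ψ) :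
    PSmooth fun x t => φ x t * ψ x t :=
  ⟨hφ.smooth.mul hψ.smooth, fun t i x => by
    have h1 := hφ.periodic t i x
    have h2 := hψ.periodic t i x
    simp only at h1 h2 ⊢
    rw [h1, h2]⟩

theorem dd_mul {φ ψ : Euc d → ℝ → ℝ} (hφ : PSmooth φ) (hψ : PSmooth ψ) (v : Euc d × ℝ) (x : Euc d)
    (t : ℝ) : dd v (fun x t => φ x t * ψ x t) x t =
      φ x t * dd v ψ x t + dd v φ x t * ψ x t := by
  have := ((hφ.hasFDerivAt (x, t)).fun_mul (hψ.hasFDerivAt (x, t))).fderiv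
  rw [dd, this]
  simp [dd]
  ring

theorem PSmooth.exp {φ : Euc d → ℝ → ℝ} (hφ : PSmooth φ) (c : ℝ) :
    PSmooth fun x t => Real.exp (c * φ x t) :=
  ⟨(contDiff_const.mul hφ.smooth).exp, fun t i x => by
    have h1 := hφ.periodic t i x
    simp only at h1 ⊢
    rw [h1]⟩

theorem dd_exp {φ : Euc d → ℝ → ℝ} (hφ : PSmooth φ) (c : ℝ) (v : Euc d × ℝ) (x : Euc d)
    (t : ℝ) : dd v (fun x t => Real.exp (c * φ x t)) x t =
      c * (Real.exp (c * φ x t) * dd v φ x t) := by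
  have := ((hφ.hasFDerivAt (x, t)).const_mul c).exp.fderiv
  rw [dd, this]
  simp [dd]
  ring

theorem PSmooth.integrableOn_cube {φ : Euc d → ℝ → ℝ} (hφ : PSmooth φ) (t : ℝ) :
    IntegrableOn (fun x => φ x t) (cube d) :=
  (hφ.smooth_space t).continuous.continuousOn.integrableOn_compact isCompact_cube

theorem PSmooth.integral_cube_dd {φ : Euc d → ℝ → ℝ} (hφ : PSmooth φ) (ξ : Euc d) (t : ℝ) :
    ∫ x in cube d, MFG.dd (ξ, 0) φ x t = 0 := by
  have h := integral_cube_fderiv_eq_zero (hφ.periodic t) ((hφ.smooth_space t).of_le (by simp)) ξ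
  simp_rw [hφ.fderiv_space] at h
  exact h

theorem PSmooth.hasDerivAt_integral_cube {φ : Euc d → ℝ → ℝ} (hφ : PSmooth φ) (t : ℝ) :
    HasDerivAt (fun t => ∫ x in cube d, φ x t) (∫ x in cube d, MFG.dd (0, 1) φ x t) t := by
  have : IsFiniteMeasure (volume.restrict (cube d)) :=
    ⟨by simpa using isCompact_cube.measure_lt_top⟩
  obtain ⟨C, hC0, hC⟩ := (hφ.dd (0, 1)).exists_bound (|t| + 1)
  refine (hasDerivAt_integral_of_dominated_loc_of_deriv_le (μ := volume.restrict (cube d))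
    (F := fun t x => φ x t) (F' := fun t x => MFG.dd (0, 1) φ x t) (bound := fun _ => C)
    (Metric.ball_mem_nhds t one_pos) ?_ (hφ.integrableOn_cube t) ?_ ?_ (integrable_const _) ?_).2
  · exact Eventually.of_forall fun s => (hφ.smooth_space s).continuous.aestronglyMeasurable
  · exact ((hφ.dd _).smooth_space t).continuous.aestronglyMeasurable
  · refine Eventually.of_forall fun x s hs => hC x s ?_
    rw [Metric.mem_ball, Real.dist_eq] at hs
    have := abs_add_le t (s - t)
    rw [add_sub_cancel] at this
    linarith
  · exact Eventually.of_forall fun x s _ => hφ.hasDerivAt_time x s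

/-- The gradient in the space variables. -/
noncomputable def gr (φ : Euc d → ℝ → ℝ) (x : Euc d) (t : ℝ) : Euc d :=
  gradient (fun y => φ y t) x

theorem PSmooth.inner_gr {φ : Euc d → ℝ → ℝ} (hφ : PSmooth φ) (x : Euc d) (t : ℝ)
    (ξ : Euc d) : inner ℝ (gr φ x t) ξ = MFG.dd (ξ, 0) φ x t := hφ.inner_gradient x t ξ

theorem PSmooth.gr_apply {φ : Euc d → ℝ → ℝ} (hφ : PSmooth φ) (x : Euc d) (t : ℝ) (i : Fin d) :
    gr φ x t i = MFG.dd (EuclideanSpace.single i 1, 0) φ x t := by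
  rw [← hφ.inner_gr, EuclideanSpace.inner_single_right]
  simp

theorem PSmooth.contDiff_gr {φ : Euc d → ℝ → ℝ} (hφ : PSmooth φ) :
    ContDiff ℝ ∞ fun z : Euc d × ℝ => gr φ z.1 z.2 := by
  rw [contDiff_euclidean]
  intro i
  simp_rw [hφ.gr_apply]
  exact (hφ.dd _).smooth

theorem PSmooth.periodic_gr {φ : Euc d → ℝ → ℝ} (hφ : PSmooth φ) (t : ℝ) :
    Periodic fun x => gr φ x t := by
  intro i x
  ext j
  simp only [hφ.gr_apply]
  exact (hφ.dd _).periodic t i x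

theorem PSmooth.gr_sub {φ ψ : Euc d → ℝ → ℝ} (hφ : PSmooth φ) (hψ : PSmooth ψ) (x : Euc d)
    (t : ℝ) : gr (fun x t => φ x t - ψ x t) x t = gr φ x t - gr ψ x t := by
  ext j
  rw [(hφ.sub hψ).gr_apply, dd_sub hφ hψ, PiLp.sub_apply, hφ.gr_apply, hψ.gr_apply]

theorem PSmooth.gr_const_mul {φ : Euc d → ℝ → ℝ} (hφ : PSmooth φ) (c : ℝ) (x : Euc d)
    (t : ℝ) : gr (fun x t => c * φ x t) x t = c • gr φ x t := by
  ext j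
  rw [(hφ.const_mul c).gr_apply, dd_const_mul hφ, PiLp.smul_apply, hφ.gr_apply, smul_eq_mul]

theorem PSmooth.norm_gr_sq {φ : Euc d → ℝ → ℝ} (hφ : PSmooth φ) (x : Euc d) (t : ℝ) :
    ‖gr φ x t‖ ^ 2 = ∑ i, MFG.dd (EuclideanSpace.single i 1, 0) φ x t *
      MFG.dd (EuclideanSpace.single i 1, 0) φ x t := by
  rw [EuclideanSpace.norm_sq_eq]
  refine Finset.sum_congr rfl fun i _ => ?_
  rw [hφ.gr_apply, Real.norm_eq_abs, sq_abs, sq]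

theorem PSmooth.norm_gr_le {φ : Euc d → ℝ → ℝ} (hφ : PSmooth φ) {x : Euc d} {t c : ℝ}
    (hc : 0 ≤ c) (h : ∀ ξ : Euc d, ‖ξ‖ ≤ 1 → MFG.dd (ξ, 0) φ x t ≤ c) : ‖gr φ x t‖ ≤ c := by
  by_cases h0 : gr φ x t = 0
  · rw [h0, norm_zero]
    exact hc
  · have hn : 0 < ‖gr φ x t‖ := norm_pos_iff.2 h0
    have := h (‖gr φ x t‖⁻¹ • gr φ x t) (by
      rw [norm_smul, norm_inv, norm_norm, inv_mul_cancel₀ hn.ne'])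
    rw [← hφ.inner_gr, inner_smul_right, real_inner_self_eq_norm_sq, sq, ← mul_assoc,
      inv_mul_cancel₀ hn.ne', one_mul] at this
    exact this

theorem PSmooth.abs_dd_le_norm_gr {φ : Euc d → ℝ → ℝ} (hφ : PSmooth φ) (x : Euc d) (t : ℝ)
    {ξ : Euc d} (hξ : ‖ξ‖ ≤ 1) : |MFG.dd (ξ, 0) φ x t| ≤ ‖gr φ x t‖ := by
  rw [← hφ.inner_gr]
  refine (abs_real_inner_le_norm _ _).trans ?_
  nlinarith [norm_nonneg (gr φ x t)]

/-- The integrand is the divergence of `exp (cΦ) (DΦ - R ξ)`. The identity trades `∂_ξ R` for `R`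
itself and brings in `c ‖DΦ‖²` from the exponential. -/
theorem integral_exp_divergence {Φ R : Euc d → ℝ → ℝ} (hΦ : PSmooth Φ) (hR : PSmooth R)
    (c : ℝ) (ξ : Euc d) (t : ℝ) :
    ∫ x in cube d, Real.exp (c * Φ x t) * (lap Φ x t - dd (ξ, 0) R x t + c * ‖gr Φ x t‖ ^ 2
      - c * (R x t * inner ℝ (gr Φ x t) ξ)) = 0 := by
  have h1 : ∀ i : Fin d, PSmooth fun x t =>
      Real.exp (c * Φ x t) * dd (EuclideanSpace.single i 1, 0) Φ x t := fun i =>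
    (hΦ.exp c).mul (hΦ.dd _)
  have h2 : PSmooth fun x t => Real.exp (c * Φ x t) * R x t := (hΦ.exp c).mul hR
  have key : ∀ x, Real.exp (c * Φ x t) * (lap Φ x t - dd (ξ, 0) R x t + c * ‖gr Φ x t‖ ^ 2
      - c * (R x t * inner ℝ (gr Φ x t) ξ)) =
      ∑ i : Fin d, dd (EuclideanSpace.single i 1, 0) (fun x t =>
        Real.exp (c * Φ x t) * dd (EuclideanSpace.single i 1, 0) Φ x t) x t
      - dd (ξ, 0) (fun x t => Real.exp (c * Φ x t) * R x t) x t := by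
    intro x
    simp_rw [dd_mul (hΦ.exp c) (hΦ.dd _), dd_mul (hΦ.exp c) hR, dd_exp hΦ]
    rw [Finset.sum_add_distrib, ← Finset.mul_sum, hΦ.norm_gr_sq, hΦ.inner_gr, lap]
    simp_rw [mul_assoc]
    rw [← Finset.mul_sum, ← Finset.mul_sum]
    ring
  simp_rw [key]
  rw [integral_sub, integral_finsetSum]
  · rw [h2.integral_cube_dd, Finset.sum_eq_zero fun i _ => (h1 i).integral_cube_dd _ t, sub_zero]
  · exact fun i _ => ((h1 i).dd _).integrableOn_cube t
  · exact integrable_finsetSum _ fun i _ => ((h1 i).dd _).integrableOn_cube t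
  · exact (h2.dd _).integrableOn_cube t

/-- Gronwall's inequality backward in time: with `E` the energy, `exp (cGt) (E(t) + B/G)` is
nondecreasing. -/
theorem exp_energy_le {Φ : Euc d → ℝ → ℝ} (hΦ : PSmooth Φ) {c G B a b : ℝ} (hc : 0 < c)
    (hG : 0 < G)
    (h : ∀ t ∈ Ioo a b, -∫ x in cube d, Real.exp (c * Φ x t) * dd (0, 1) Φ x t ≤
      G * (∫ x in cube d, Real.exp (c * Φ x t)) + B) {t : ℝ} (ht : t ∈ Icc a b) :
    ∫ x in cube d, Real.exp (c * Φ x t) ≤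
      Real.exp (c * G * (b - t)) * ((∫ x in cube d, Real.exp (c * Φ x b)) + B / G) - B / G := by
  set E : ℝ → ℝ := fun t => ∫ x in cube d, Real.exp (c * Φ x t) with hE
  have hE' : ∀ t, HasDerivAt E (c * ∫ x in cube d, Real.exp (c * Φ x t) * dd (0, 1) Φ x t) t := by
    intro t
    refine ((hΦ.exp c).hasDerivAt_integral_cube t).congr_deriv ?_
    simp_rw [dd_exp hΦ]
    rw [integral_const_mul]
  set Z : ℝ → ℝ := fun t => Real.exp (c * G * t) * (E t + B / G) with hZ
  have hZ' : ∀ t, HasDerivAt Z (Real.exp (c * G * t) * (c * G) * (E t + B / G) +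
      Real.exp (c * G * t) *
        (c * ∫ x in cube d, Real.exp (c * Φ x t) * dd (0, 1) Φ x t)) t := by
    intro t
    have h1 : HasDerivAt (fun t => Real.exp (c * G * t)) (Real.exp (c * G * t) * (c * G)) t := by
      simpa using ((hasDerivAt_id t).const_mul (c * G)).exp
    exact h1.mul ((hE' t).add_const _)
  have hmono : MonotoneOn Z (Icc a b) := by
    refine monotoneOn_of_deriv_nonneg (convex_Icc a b)
      (fun t _ => (hZ' t).continuousAt.continuousWithinAt)
      (fun t _ => (hZ' t).differentiableAt.differentiableWithinAt) fun t ht => ?_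
    rw [interior_Icc] at ht
    rw [(hZ' t).deriv]
    have h1 := h t ht
    have h2 : Real.exp (c * G * t) * (c * G) * (E t + B / G) +
        Real.exp (c * G * t) * (c * ∫ x in cube d, Real.exp (c * Φ x t) * dd (0, 1) Φ x t) =
        Real.exp (c * G * t) * c * (G * E t + B +
          ∫ x in cube d, Real.exp (c * Φ x t) * dd (0, 1) Φ x t) := by
      field_simp
    rw [h2]
    refine mul_nonneg (by positivity) ?_
    linarith
  have hb : b ∈ Icc a b := ⟨ht.1.trans ht.2, le_rfl⟩
  have h1 := hmono ht hb ht.2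
  have h2 : E t + B / G ≤ Real.exp (c * G * (b - t)) * (E b + B / G) := by
    have h3 : Real.exp (c * G * (b - t)) = Real.exp (c * G * b) / Real.exp (c * G * t) := by
      rw [← Real.exp_sub]; ring_nf
    rw [h3, div_mul_eq_mul_div, le_div_iff₀ (Real.exp_pos _)]
    simp only [hZ] at h1
    linarith
  linarith

end Energy

end MFG

namespace MFG

/-! ### The energy identity for Hamilton-Jacobi equations -/

section HamiltonJacobi

variable {d : ℕ} {H : Euc d → Euc d → ℝ} {μ : ℝ}

theorem IsHamiltonian.fderiv_eq (hH : IsHamiltonian H μ) (x p ξ e : Euc d) :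
    fderiv ℝ (fun z : Euc d × Euc d => H z.1 z.2) (x, p) (ξ, e) =
      inner ℝ (gradX H x p) ξ + inner ℝ (gradP H x p) e := by
  have hd := (hH.smooth.differentiable (by simp) (x, p)).hasFDerivAt
  have h1 : HasFDerivAt (fun y => H y p) _ x :=
    HasFDerivAt.comp (f := fun y : Euc d => (y, p)) x hd
      ((hasFDerivAt_id x).prodMk (hasFDerivAt_const p x))
  have h2 : HasFDerivAt (fun q => H x q) _ p :=
    HasFDerivAt.comp (f := fun q : Euc d => (x, q)) p hd
      ((hasFDerivAt_const x p).prodMk (hasFDerivAt_id p))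
  rw [gradX, gradP, gradient, gradient, InnerProductSpace.toDual_symm_apply,
    InnerProductSpace.toDual_symm_apply, h1.fderiv, h2.fderiv]
  simp only [ContinuousLinearMap.comp_apply, ContinuousLinearMap.prod_apply,
    zero_apply, ContinuousLinearMap.id_apply]
  rw [← map_add]
  simp

theorem IsHamiltonian.pSmooth_comp (hH : IsHamiltonian H μ) {U : Euc d → ℝ → ℝ}
    (hU : PSmooth U) : PSmooth fun x t => H x (gr U x t) where
  smooth := hH.smooth.comp (contDiff_fst.prodMk hU.contDiff_gr)
  periodic t i x := by
    have h1 := hU.periodic_gr t i x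
    simp only at h1 ⊢
    rw [h1]
    exact hH.periodic _ i x

theorem PSmooth.fderiv_gr {U : Euc d → ℝ → ℝ} (hU : PSmooth U) (x : Euc d) (t : ℝ) (ξ : Euc d) :
    fderiv ℝ (fun z : Euc d × ℝ => gr U z.1 z.2) (x, t) (ξ, 0) = gr (MFG.dd (ξ, 0) U) x t := by
  ext i
  rw [(hU.dd _).gr_apply, hU.dd_comm]
  have hd := (hU.contDiff_gr.differentiable (by simp) (x, t)).hasFDerivAt
  have h2 : HasFDerivAt (fun z : Euc d × ℝ => gr U z.1 z.2 i) _ (x, t) :=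
    HasFDerivAt.comp (x, t) (EuclideanSpace.proj (𝕜 := ℝ) i).hasFDerivAt hd
  simp_rw [hU.gr_apply] at h2
  rw [MFG.dd, h2.fderiv]
  rfl

theorem IsHamiltonian.dd_comp (hH : IsHamiltonian H μ) {U : Euc d → ℝ → ℝ}
    (hU : PSmooth U) (x : Euc d) (t : ℝ) (ξ : Euc d) :
    dd (ξ, 0) (fun x t => H x (gr U x t)) x t =
      inner ℝ (gradX H x (gr U x t)) ξ + inner ℝ (gradP H x (gr U x t)) (gr (dd (ξ, 0) U) x t) := by
  rw [← hH.fderiv_eq, ← hU.fderiv_gr]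
  have hd := (hU.contDiff_gr.differentiable (by simp) (x, t)).hasFDerivAt
  have hHd := (hH.smooth.differentiable (by simp) (x, gr U x t)).hasFDerivAt
  have h : HasFDerivAt (fun z : Euc d × ℝ => H z.1 (gr U z.1 z.2)) _ (x, t) :=
    HasFDerivAt.comp (f := fun z : Euc d × ℝ => (z.1, gr U z.1 z.2)) (x, t) hHd
      (hasFDerivAt_fst.prodMk hd)
  rw [dd, h.fderiv]
  rfl

theorem PSmooth.dd_congr {φ ψ : Euc d → ℝ → ℝ} (hφ : PSmooth φ) (hψ : PSmooth ψ) {t : ℝ}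
    (h : ∀ x, φ x t = ψ x t) (ξ x : Euc d) : MFG.dd (ξ, 0) φ x t = MFG.dd (ξ, 0) ψ x t := by
  rw [← hφ.fderiv_space, ← hψ.fderiv_space, funext h]

/-- In the equation of `∂_ξ U`, the part `H(x, DU)` is differentiated by the chain rule, while `H(x,
Du) - H(x, DU)` keeps its outer derivative for `integral_exp_divergence`. As `D∂_ξ U = DΦ + κ Du`,
the chain rule term `D_pH · D∂_ξ U` joins `κ` times the equation of `u` to form the Lagrangian-type
term in `bracket`. -/
theorem IsHamiltonian.energy_identity (hH : IsHamiltonian H μ) {u f : Euc d → ℝ → ℝ}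
    (hu : PSmooth u) (hf : PSmooth f) {θ Λ κ t : ℝ} (hθ : 0 ≤ θ) (hθ1 : θ ≤ 1) (ξ : Euc d)
    (heq : ∀ x, dd (0, 1) u x t + lap u x t = H x (gr u x t) - f x t)
    {U Φ : Euc d → ℝ → ℝ} (hUdef : U = fun x t => u x t - duh θ f x t)
    (hΦdef : Φ = fun x t => dd (ξ, 0) U x t - κ * u x t) :
    IntegrableOn (fun x => Real.exp (1 / Λ * Φ x t) *
        (bracket H Λ κ x (gr U x t) (gr (duh θ f) x t) ξ (gr Φ x t)
          + dd (ξ, 0) (heat θ f) x t - κ * f x t)) (cube d) ∧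
    -∫ x in cube d, Real.exp (1 / Λ * Φ x t) * dd (0, 1) Φ x t =
      ∫ x in cube d, Real.exp (1 / Λ * Φ x t) *
        (bracket H Λ κ x (gr U x t) (gr (duh θ f) x t) ξ (gr Φ x t)
          + dd (ξ, 0) (heat θ f) x t - κ * f x t) := by
  have hv : PSmooth (duh θ f) := hf.duh hθ1
  have hU : PSmooth U := hUdef ▸ hu.sub hv
  have hw : PSmooth (dd (ξ, 0) U) := hU.dd _
  have hκu : PSmooth fun x t => κ * u x t := hu.const_mul κ
  have hΦ : PSmooth Φ := hΦdef ▸ hw.sub hκu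
  have hψ := hH.pSmooth_comp hu
  have hψ' := hH.pSmooth_comp hU
  have hR : PSmooth fun x t => H x (gr u x t) - H x (gr U x t) := hψ.sub hψ'
  have hgr : ∀ x, gr u x t = gr U x t + gr (duh θ f) x t := fun x => by
    rw [hUdef, hu.gr_sub hv, sub_add_cancel]
  have hUeq : ∀ x, dd (0, 1) U x t + lap U x t = H x (gr u x t) - heat θ f x t := fun x => by
    have h1 := hf.duh_equation hθ hθ1 x t
    rw [hUdef, dd_sub hu hv, lap_sub hu hv]
    linarith [heq x]
  have hweq : ∀ x, dd (0, 1) (dd (ξ, 0) U) x t + lap (dd (ξ, 0) U) x t =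
      dd (ξ, 0) (fun x t => H x (gr u x t)) x t - dd (ξ, 0) (heat θ f) x t := fun x => by
    have h1 := ((hU.dd (0, 1)).add hU.lap).dd_congr (hψ.sub (hf.heat hθ hθ1)) hUeq ξ x
    rw [dd_add (hU.dd _) hU.lap, dd_sub hψ (hf.heat hθ hθ1), hU.dd_comm, dd_lap hU] at h1
    exact h1
  have hdt : ∀ x, dd (0, 1) Φ x t = dd (0, 1) (dd (ξ, 0) U) x t - κ * dd (0, 1) u x t := fun x => by
    rw [hΦdef, dd_sub hw hκu, dd_const_mul hu]
  have hlap : ∀ x, lap Φ x t = lap (dd (ξ, 0) U) x t - κ * lap u x t := fun x => by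
    rw [hΦdef, lap_sub hw hκu, lap_const_mul hu]
  have hgrw : ∀ x, gr (dd (ξ, 0) U) x t = gr Φ x t + κ • gr u x t := fun x => by
    rw [hΦdef, hw.gr_sub hκu, hu.gr_const_mul, sub_add_cancel]
  have hpt : ∀ x, -dd (0, 1) Φ x t =
      (lap Φ x t - dd (ξ, 0) (fun x t => H x (gr u x t) - H x (gr U x t)) x t
        + 1 / Λ * ‖gr Φ x t‖ ^ 2
        - 1 / Λ * ((H x (gr u x t) - H x (gr U x t)) * inner ℝ (gr Φ x t) ξ))
      + (bracket H Λ κ x (gr U x t) (gr (duh θ f) x t) ξ (gr Φ x t)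
          + dd (ξ, 0) (heat θ f) x t - κ * f x t) := by
    intro x
    have h1 := hweq x
    have h2 := hH.dd_comp hU x t ξ
    rw [hgrw, inner_add_right, inner_smul_right] at h2
    rw [dd_sub hψ hψ', h2, hlap, hdt, bracket, ← hgr]
    linear_combination (-1) * h1 + κ * heq x
  have hbr : (fun x => Real.exp (1 / Λ * Φ x t) *
      (bracket H Λ κ x (gr U x t) (gr (duh θ f) x t) ξ (gr Φ x t)
          + dd (ξ, 0) (heat θ f) x t - κ * f x t)) =
      fun x => (-(Real.exp (1 / Λ * Φ x t) * dd (0, 1) Φ x t)) - Real.exp (1 / Λ * Φ x t) *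
        (lap Φ x t - dd (ξ, 0) (fun x t => H x (gr u x t) - H x (gr U x t)) x t
        + 1 / Λ * ‖gr Φ x t‖ ^ 2
        - 1 / Λ * ((H x (gr u x t) - H x (gr U x t)) * inner ℝ (gr Φ x t) ξ)) := by
    funext x
    linear_combination (-Real.exp (1 / Λ * Φ x t)) * hpt x
  have hgc : Continuous fun x => gr Φ x t :=
    hΦ.contDiff_gr.continuous.comp (f := fun x : Euc d => (x, t)) (by fun_prop)
  have i1 : IntegrableOn (fun x => -(Real.exp (1 / Λ * Φ x t) * dd (0, 1) Φ x t)) (cube d) :=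
    (((hΦ.exp (1 / Λ)).mul (hΦ.dd (0, 1))).integrableOn_cube t).neg
  have i2 : IntegrableOn (fun x => Real.exp (1 / Λ * Φ x t) *
        (lap Φ x t - dd (ξ, 0) (fun x t => H x (gr u x t) - H x (gr U x t)) x t
        + 1 / Λ * ‖gr Φ x t‖ ^ 2
        - 1 / Λ * ((H x (gr u x t) - H x (gr U x t)) * inner ℝ (gr Φ x t) ξ))) (cube d) := by
    refine ContinuousOn.integrableOn_compact isCompact_cube (Continuous.continuousOn ?_)
    have c1 := ((hΦ.exp (1 / Λ)).smooth_space t).continuous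
    have c2 := (hΦ.lap.smooth_space t).continuous
    have c3 := ((hR.dd (ξ, 0)).smooth_space t).continuous
    have c4 := (hR.smooth_space t).continuous
    exact c1.mul (((c2.sub c3).add (continuous_const.mul (hgc.norm.pow 2))).sub
      (continuous_const.mul (c4.mul (hgc.inner continuous_const))))
  refine ⟨by rw [hbr]; exact i1.sub i2, ?_⟩
  rw [hbr, integral_sub i1 i2, integral_exp_divergence hΦ hR (1 / Λ) ξ t, sub_zero, integral_neg]

end HamiltonJacobi

end MFG

namespace MFG

/-! ### The gradient estimate for Hamilton-Jacobi equations -/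

section GradientEstimate

variable {d : ℕ} {H : Euc d → Euc d → ℝ} {μ q T C₀ : ℝ}

/-- `u` solves `-u_t + H (x, Du) = Δu + f` for `t ∈ (a, b)`, where `f ≥ 0`, and `K`, `M`, `F` bound
`Du`, `u` and the `L^q` norm of `f`. -/
structure HJBound (H : Euc d → Euc d → ℝ) (μ q T C₀ : ℝ) (u f : Euc d → ℝ → ℝ)
    (a b K M F : ℝ) : Prop where
  u_smooth : PSmooth u
  f_smooth : PSmooth f
  sub_le : b - a ≤ T
  one_le : 1 ≤ K
  M_nonneg : 0 ≤ M
  F_pos : 0 < F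
  F_mul_le : F * K ^ μ ≤ 2 * K
  equation : ∀ t ∈ Ioo a b, ∀ x, dd (0, 1) u x t + lap u x t = H x (gr u x t) - f x t
  f_nonneg : ∀ x t, 0 ≤ f x t
  f_le : ∀ t, ∫ x in cube d, |f x t| ^ q ≤ F ^ q
  u_le : ∀ x t, |u x t| ≤ M
  gr_le : ∀ x t, ‖gr u x t‖ ≤ K
  gr_end_le : ∀ x, ‖gr u x b‖ ≤ C₀

theorem HJBound.one_le_rpow (hμ : 0 ≤ μ) {u f : Euc d → ℝ → ℝ} {a b K M F : ℝ}
    (h : HJBound H μ q T C₀ u f a b K M F) : 1 ≤ K ^ μ := Real.one_le_rpow h.one_le hμ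

theorem HJBound.F_le (hμ : 0 ≤ μ) {u f : Euc d → ℝ → ℝ} {a b K M F : ℝ}
    (h : HJBound H μ q T C₀ u f a b K M F) : F ≤ F * K ^ μ :=
  le_mul_of_one_le_right h.F_pos.le (h.one_le_rpow hμ)

theorem exponent_pos (hqd : (d : ℝ) < q) : 0 < (1 / 2 - d / (2 * q) : ℝ) := by
  have hq0 : 0 < q := lt_of_le_of_lt (Nat.cast_nonneg d) hqd
  rw [sub_pos, div_lt_div_iff₀ (by positivity) (by norm_num)]
  linarith

theorem integral_cube_le {f : Euc d → ℝ} {c : ℝ} (hf : IntegrableOn f (cube d))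
    (h : ∀ x, f x ≤ c) : ∫ x in cube d, f x ≤ c := by
  have hfin : volume (cube d) ≠ ⊤ := isCompact_cube.measure_ne_top
  have h1 : ∫ x in cube d, f x ≤ ∫ _x in cube d, c :=
    setIntegral_mono hf (integrableOn_const hfin) h
  simpa [volume_cube, measureReal_def] using h1

/-- The energy bound splits into an exponential of a quantity over `Λ` and a polynomial factor
`K^5`. After taking `Λ` times the logarithm, the latter costs only a multiple of `Λ (1 + log K)`. -/
theorem IsHamiltonian.exists_energy_bound (hH : IsHamiltonian H μ) (hq : 1 ≤ q)
    (hqd : (d : ℝ) < q) (hT : 0 < T) (hC₀ : 0 ≤ C₀) :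
    ∃ Cv κ₁ κ₂ D : ℝ, 0 < Cv ∧ 0 ≤ κ₁ ∧ 0 ≤ κ₂ ∧ 0 < D ∧
      ∀ (u f : Euc d → ℝ → ℝ) (a b K M F : ℝ), HJBound H μ q T C₀ u f a b K M F →
      ∀ ξ : Euc d, ‖ξ‖ ≤ 1 → ∀ Λ κ : ℝ, Λ = Cv * F * K ^ (-(μ * (1 / 2 - d / (2 * q)))) →
      κ = κ₁ + κ₂ * (Λ * K ^ μ) →
      ∃ Φ : Euc d → ℝ → ℝ, PSmooth Φ ∧ (∀ x t, dd (ξ, 0) u x t ≤ Φ x t + κ * M + Λ) ∧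
        ∀ t ∈ Icc a b, ∫ x in cube d, Real.exp (1 / Λ * Φ x t) ≤
          Real.exp (1 / Λ * (C₀ + κ * M + D * (1 + F * K ^ μ))) * (D * K ^ 5) := by
  obtain ⟨Cg, hCg, hheat⟩ := exists_abs_heat_dd_le d hq
  have hμ := hH.mu_pos
  obtain ⟨γ, hγdef⟩ : ∃ γ : ℝ, γ = 1 / 2 - d / (2 * q) := ⟨_, rfl⟩
  have hγ : 0 < γ := hγdef ▸ exponent_pos hqd
  obtain ⟨Cv, hCvdef⟩ : ∃ Cv, Cv = Cg / γ := ⟨_, rfl⟩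
  have hCv : 0 < Cv := by rw [hCvdef]; positivity
  -- The choice `L = 2 Cv` is valid because `Λ ≤ Cv F` and `F ≤ 2K`.
  obtain ⟨κ₁, κ₂, Γ, C₂, hκ₁, hκ₂, hΓ, hC₂, hbr⟩ :=
    hH.exists_bracket_le (L := 2 * Cv) (by positivity)
  obtain ⟨C₄, hC₄⟩ : ∃ C₄, C₄ = C₂ + 2 * Cg := ⟨_, rfl⟩
  have hC₄0 : 0 < C₄ := by rw [hC₄]; positivity
  refine ⟨Cv, κ₁, κ₂, (C₂ + C₂ * Cv + Cg + 1) * T + Real.exp (1 + Γ) * (1 + C₄), hCv, hκ₁, hκ₂,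
    by positivity, ?_⟩
  intro u f a b K M F h ξ hξ Λ κ hΛdef hκdef
  rw [← hγdef] at hΛdef
  have hK := h.one_le
  have hK0 : 0 < K := by linarith
  have hF := h.F_pos
  have hKμ := h.one_le_rpow hμ.le
  have hFF := h.F_le hμ.le
  have hM := h.M_nonneg
  have hu := h.u_smooth
  have hf := h.f_smooth
  -- This `θ` makes `|Dv|`, of order `F θ^γ`, smaller than `F` by a power of `K`, while `|D P_θ f|`,
  -- of order `F θ^(γ-1)`, stays below `F K^μ`.
  obtain ⟨θ, hθdef⟩ : ∃ θ, θ = K ^ (-μ) := ⟨_, rfl⟩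
  have hθ : 0 < θ := by rw [hθdef]; positivity
  have hθ1 : θ ≤ 1 := by rw [hθdef]; exact Real.rpow_le_one_of_one_le_of_nonpos hK (by linarith)
  have hθγ : θ ^ γ = K ^ (-(μ * γ)) := by
    rw [hθdef, ← Real.rpow_mul hK0.le]
    congr 1
    ring
  have hΛ : 0 < Λ := by rw [hΛdef]; positivity
  have hΛF : Λ ≤ Cv * F := by
    rw [hΛdef]
    refine mul_le_of_le_one_right (by positivity) ?_
    exact Real.rpow_le_one_of_one_le_of_nonpos hK (by nlinarith)
  have hΛK : Λ ≤ 2 * Cv * K := by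
    have := mul_le_mul_of_nonneg_left (hFF.trans h.F_mul_le) hCv.le
    linarith
  have hκ0 : 0 ≤ κ := by rw [hκdef]; positivity
  obtain ⟨v, hvdef⟩ : ∃ v, v = duh θ f := ⟨_, rfl⟩
  have hv : PSmooth v := hvdef ▸ hf.duh hθ1
  have hvb : ∀ ξ : Euc d, ‖ξ‖ ≤ 1 → ∀ x t, |dd (ξ, 0) v x t| ≤ Λ := by
    intro ξ hξ x t
    rw [hvdef, hf.dd_duh hθ1, (hf.dd _).duh_eq hθ.le hθ1]
    have := abs_integral_heat_dd_le (C := Cg) (F := F) hqd (φ := f) (ξ := ξ) (x := x) (t := t)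
      hθ.le (fun s hs hs1 => hheat f hf F hF s t hs (hs1.trans hθ1) (h.f_le _) ξ hξ x)
    rw [← hγdef, ← hCvdef, hθγ, ← hΛdef] at this
    exact this
  have hgv : ∀ x t, ‖gr v x t‖ ≤ Λ := fun x t =>
    hv.norm_gr_le hΛ.le fun ξ hξ => (le_abs_self _).trans (hvb ξ hξ x t)
  have hfd : ∀ x t, dd (ξ, 0) (heat θ f) x t ≤ Cg * (F * K ^ μ) := by
    intro x t
    rw [hf.dd_heat hθ.le hθ1]
    refine (le_abs_self _).trans ((hheat f hf F hF θ t hθ hθ1 (h.f_le _) ξ hξ x).trans ?_)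
    rw [← hγdef, mul_assoc]
    refine mul_le_mul_of_nonneg_left (mul_le_mul_of_nonneg_left ?_ hF.le) hCg.le
    rw [hθdef, ← Real.rpow_mul hK0.le]
    exact Real.rpow_le_rpow_of_exponent_le hK (by nlinarith)
  obtain ⟨U, hUdef⟩ : ∃ U : Euc d → ℝ → ℝ, U = fun x t => u x t - duh θ f x t := ⟨_, rfl⟩
  obtain ⟨Φ, hΦdef⟩ : ∃ Φ : Euc d → ℝ → ℝ, Φ = fun x t => dd (ξ, 0) U x t - κ * u x t :=
    ⟨_, rfl⟩
  have hU : PSmooth U := by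
    rw [hUdef, ← hvdef]
    exact hu.sub hv
  have hΦ : PSmooth Φ := by
    rw [hΦdef]
    exact (hU.dd _).sub (hu.const_mul _)
  have hddU : ∀ x t, dd (ξ, 0) U x t = dd (ξ, 0) u x t - dd (ξ, 0) v x t := fun x t => by
    rw [hUdef, ← hvdef, dd_sub hu hv]
  have hκu : ∀ x t, |κ * u x t| ≤ κ * M := fun x t => by
    rw [abs_mul, abs_of_nonneg hκ0]
    exact mul_le_mul_of_nonneg_left (h.u_le x t) hκ0
  refine ⟨Φ, hΦ, fun x t => ?_, ?_⟩
  · have h1 := (abs_le.1 (hκu x t)).2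
    have h2 := (abs_le.1 (hvb ξ hξ x t)).2
    have h3 := hddU x t
    rw [hΦdef]
    simp only
    linarith
  have hgU : ∀ x t, gr u x t = gr U x t + gr v x t := fun x t => by
    rw [hUdef, ← hvdef, hu.gr_sub hv, sub_add_cancel]
  obtain ⟨G, hG⟩ : ∃ G, G = C₂ * (1 + Λ * K ^ μ) + Cg * (F * K ^ μ) + 1 := ⟨_, rfl⟩
  have hG1 : 1 ≤ G := by
    have : 0 ≤ C₂ * (1 + Λ * K ^ μ) + Cg * (F * K ^ μ) := by positivity
    linarith
  obtain ⟨B, hB⟩ : ∃ B, B = C₄ * K ^ 5 * Real.exp (1 / Λ * (Γ * Λ + κ * M)) := ⟨_, rfl⟩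
  have hB0 : 0 ≤ B := by rw [hB]; positivity
  -- For large `|DU|` the bracket is at most part of the rate `G`. Otherwise it may be as large as
  -- `K^5`, but there the weight is at most `exp ((Γ Λ + κ M)/Λ)`, which makes it an additive term
  -- `B`. The source term `-κ f` has a favourable sign.
  have hpt : ∀ x t, Real.exp (1 / Λ * Φ x t) *
      (bracket H Λ κ x (gr U x t) (gr (duh θ f) x t) ξ (gr Φ x t)
          + dd (ξ, 0) (heat θ f) x t - κ * f x t) ≤ G * Real.exp (1 / Λ * Φ x t) + B := by
    intro x t
    have h1 := hbr K Λ hK hΛ hΛK x (gr U x t) (gr (duh θ f) x t) ξ (gr Φ x t)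
      (by rw [← hvdef]; exact hgv x t) (by rw [← hvdef, ← hgU]; exact h.gr_le x t) hξ
    rw [← hκdef] at h1
    have h2 := hfd x t
    have h3 : 0 ≤ κ * f x t := mul_nonneg hκ0 (h.f_nonneg x t)
    have h0 := Real.exp_pos (1 / Λ * Φ x t)
    by_cases hgood : Γ * Λ ≤ ‖gr U x t‖
    · have h4 := h1.1 hgood
      have h5 := mul_le_mul_of_nonneg_left (by linarith :
        bracket H Λ κ x (gr U x t) (gr (duh θ f) x t) ξ (gr Φ x t)
          + dd (ξ, 0) (heat θ f) x t - κ * f x t ≤ G) h0.le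
      linarith
    · have h4 := h1.2
      have h5 : Cg * (F * K ^ μ) ≤ 2 * Cg * K ^ 5 := by
        have h6 := mul_le_mul_of_nonneg_left h.F_mul_le hCg.le
        have h7 : K ≤ K ^ 5 := le_self_pow₀ hK (by norm_num)
        have h8 := mul_le_mul_of_nonneg_left h7 hCg.le
        linarith
      have h6 : bracket H Λ κ x (gr U x t) (gr (duh θ f) x t) ξ (gr Φ x t)
          + dd (ξ, 0) (heat θ f) x t - κ * f x t ≤ C₄ * K ^ 5 := by
        rw [hC₄]
        linarith
      have h7 : Φ x t ≤ Γ * Λ + κ * M := by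
        have h8 := (le_abs_self _).trans (hU.abs_dd_le_norm_gr x t hξ)
        have h9 := (abs_le.1 (hκu x t)).1
        rw [hΦdef]
        simp only
        linarith
      have h8 : Real.exp (1 / Λ * Φ x t) ≤ Real.exp (1 / Λ * (Γ * Λ + κ * M)) :=
        Real.exp_le_exp.2 (mul_le_mul_of_nonneg_left h7 (by positivity))
      have h9 : Real.exp (1 / Λ * Φ x t) * (C₄ * K ^ 5) ≤ B := by
        rw [hB, mul_comm]
        exact mul_le_mul_of_nonneg_left h8 (by positivity)
      have h10 := mul_le_mul_of_nonneg_left h6 h0.le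
      have h11 : 0 ≤ G * Real.exp (1 / Λ * Φ x t) := by positivity
      linarith
  have henergy : ∀ t ∈ Ioo a b, -∫ x in cube d, Real.exp (1 / Λ * Φ x t) * dd (0, 1) Φ x t ≤
      G * (∫ x in cube d, Real.exp (1 / Λ * Φ x t)) + B := by
    intro t ht
    obtain ⟨hi, he⟩ := hH.energy_identity hu hf hθ.le hθ1 ξ (Λ := Λ) (κ := κ) (h.equation t ht)
      hUdef hΦdef
    have hie : IntegrableOn (fun x => Real.exp (1 / Λ * Φ x t)) (cube d) :=
      (hΦ.exp (1 / Λ)).integrableOn_cube t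
    have hfin : volume (cube d) ≠ ⊤ := isCompact_cube.measure_ne_top
    rw [he]
    calc _ ≤ ∫ x in cube d, (G * Real.exp (1 / Λ * Φ x t) + B) :=
          setIntegral_mono hi ((hie.const_mul G).add (integrableOn_const hfin)) fun x => hpt x t
      _ = _ := by
          rw [integral_add (hie.const_mul G) (integrableOn_const hfin), integral_const_mul]
          simp [volume_cube, measureReal_def]
  intro t ht
  refine (exp_energy_le hΦ (by positivity : 0 < 1 / Λ) (by linarith) henergy ht).trans ?_
  have hEb : ∫ x in cube d, Real.exp (1 / Λ * Φ x b) ≤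
      Real.exp (1 / Λ * (C₀ + Λ + κ * M)) := by
    refine integral_cube_le ((hΦ.exp (1 / Λ)).integrableOn_cube b) fun x => ?_
    refine Real.exp_le_exp.2 (mul_le_mul_of_nonneg_left ?_ (by positivity))
    have h1 := (abs_le.1 (hκu x b)).1
    have h2 := (abs_le.1 (hvb ξ hξ x b)).1
    have h3 := (le_abs_self _).trans ((hu.abs_dd_le_norm_gr x b hξ).trans (h.gr_end_le x))
    rw [hΦdef]
    simp only
    rw [hddU]
    linarith
  have hBG0 : 0 ≤ B / G := by positivity
  have hBG : B / G ≤ B := div_le_self hB0 hG1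
  -- The end value of the energy and `B` share this factor; what remains is `exp (1 + Γ)` times a
  -- polynomial.
  obtain ⟨Y, hY⟩ : ∃ Y, Y = Real.exp (1 / Λ * (C₀ + κ * M)) := ⟨_, rfl⟩
  have hY0 : 0 < Y := by rw [hY]; exact Real.exp_pos _
  have hE1 : Real.exp (1 / Λ * (C₀ + Λ + κ * M)) ≤ Y * Real.exp (1 + Γ) := by
    rw [hY, ← Real.exp_add]
    refine Real.exp_le_exp.2 ?_
    have : 1 / Λ * (C₀ + Λ + κ * M) = 1 / Λ * (C₀ + κ * M) + 1 := by field_simp; ring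
    linarith
  have hE2 : Real.exp (1 / Λ * (Γ * Λ + κ * M)) ≤ Y * Real.exp (1 + Γ) := by
    rw [hY, ← Real.exp_add]
    refine Real.exp_le_exp.2 ?_
    have h1 : 1 / Λ * (Γ * Λ + κ * M) = 1 / Λ * (C₀ + κ * M) + Γ - 1 / Λ * C₀ := by
      field_simp; ring
    have h2 : 0 ≤ 1 / Λ * C₀ := by positivity
    linarith
  have hK5 : 1 ≤ K ^ 5 := one_le_pow₀ hK
  have hsum : (∫ x in cube d, Real.exp (1 / Λ * Φ x b)) + B / G ≤
      Y * (Real.exp (1 + Γ) * (1 + C₄) * K ^ 5) := by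
    have h1 : B ≤ C₄ * K ^ 5 * (Y * Real.exp (1 + Γ)) := by
      rw [hB]
      exact mul_le_mul_of_nonneg_left hE2 (by positivity)
    have h2 : Y * Real.exp (1 + Γ) ≤ Y * Real.exp (1 + Γ) * K ^ 5 :=
      le_mul_of_one_le_right (by positivity) hK5
    linarith
  have hΛKμ : Λ * K ^ μ ≤ Cv * (F * K ^ μ) := by
    rw [← mul_assoc]
    exact mul_le_mul_of_nonneg_right hΛF (by positivity)
  have hX0 : 0 ≤ F * K ^ μ := by positivity
  have hGT : G * (b - t) ≤ (C₂ + C₂ * Cv + Cg + 1) * T * (1 + F * K ^ μ) := by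
    have h1 : b - t ≤ T := by linarith [ht.1, h.sub_le]
    have h2 : G * (b - t) ≤ G * T := mul_le_mul_of_nonneg_left h1 (by linarith)
    have h3 : G ≤ (C₂ + C₂ * Cv + Cg + 1) * (1 + F * K ^ μ) := by
      have h4 := mul_le_mul_of_nonneg_left hΛKμ hC₂
      have h5 := mul_nonneg hC₂ hX0
      have h6 := mul_nonneg hC₂ hCv.le
      rw [hG]
      linarith
    have h4 := mul_le_mul_of_nonneg_right h3 hT.le
    linarith
  have hexp : Real.exp (1 / Λ * G * (b - t)) * Y ≤ Real.exp (1 / Λ * (C₀ + κ * M +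
      ((C₂ + C₂ * Cv + Cg + 1) * T + Real.exp (1 + Γ) * (1 + C₄)) * (1 + F * K ^ μ))) := by
    rw [hY, ← Real.exp_add, mul_assoc, ← mul_add]
    refine Real.exp_le_exp.2 (mul_le_mul_of_nonneg_left ?_ (by positivity))
    have : 0 ≤ Real.exp (1 + Γ) * (1 + C₄) * (1 + F * K ^ μ) := by positivity
    linarith
  have hKD : Real.exp (1 + Γ) * (1 + C₄) * K ^ 5 ≤
      ((C₂ + C₂ * Cv + Cg + 1) * T + Real.exp (1 + Γ) * (1 + C₄)) * K ^ 5 := by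
    refine mul_le_mul_of_nonneg_right ?_ (by positivity)
    have : 0 ≤ (C₂ + C₂ * Cv + Cg + 1) * T := by positivity
    linarith
  calc _ ≤ Real.exp (1 / Λ * G * (b - t)) *
        (Y * (Real.exp (1 + Γ) * (1 + C₄) * K ^ 5)) := by
        have := mul_le_mul_of_nonneg_left hsum (Real.exp_pos (1 / Λ * G * (b - t))).le
        linarith
    _ = Real.exp (1 / Λ * G * (b - t)) * Y * (Real.exp (1 + Γ) * (1 + C₄) * K ^ 5) := by ring
    _ ≤ _ := mul_le_mul hexp hKD (by positivity) (by positivity)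

end GradientEstimate

end MFG

namespace MFG

/-! ### From the energy to a pointwise gradient bound. -/

section ShortTime

variable {d : ℕ} {H : Euc d → Euc d → ℝ} {μ q T C₀ : ℝ}

/-- By Duhamel's formula the difference is `∫₀^τ P_s ∂_ξ(f - H(x, Du)) ds`. It has size `τ^γ` times
a polynomial in `K`, so a small enough power of `K` as `τ` makes it bounded. -/
theorem IsHamiltonian.exists_short_time (hH : IsHamiltonian H μ) (hq : 1 ≤ q)
    (hqd : (d : ℝ) < q) :
    ∃ C : ℝ, 0 ≤ C ∧
      ∀ (u f : Euc d → ℝ → ℝ) (a b K M F : ℝ), HJBound H μ q T C₀ u f a b K M F →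
      ∀ ξ : Euc d, ‖ξ‖ ≤ 1 → ∀ t τ : ℝ, a ≤ t → 0 < τ →
      τ ≤ K ^ (-(4 / (1 / 2 - d / (2 * q))) : ℝ) → t + τ ≤ b → ∀ x,
        dd (ξ, 0) u x t ≤ heat τ (dd (ξ, 0) u) x t + C := by
  obtain ⟨Cg, hCg, hheat⟩ := exists_abs_heat_dd_le d hq
  obtain ⟨c₁, A, hc₁, hA, hg⟩ := hH.exists_growth
  have hμ := hH.mu_pos
  have hμ1 := hH.mu_lt_one
  obtain ⟨γ, hγdef⟩ : ∃ γ : ℝ, γ = 1 / 2 - d / (2 * q) := ⟨_, rfl⟩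
  have hγ : 0 < γ := hγdef ▸ exponent_pos hqd
  refine ⟨Cg / γ * (3 + 2 * A), by positivity, ?_⟩
  intro u f a b K M F h ξ hξ t τ hat hτ hτK htb x
  rw [← hγdef] at hτK
  have hK := h.one_le
  have hK0 : 0 < K := by linarith
  have hu := h.u_smooth
  have hf := h.f_smooth
  have hψ := hH.pSmooth_comp hu
  have hτ1 : τ ≤ 1 := hτK.trans (Real.rpow_le_one_of_one_le_of_nonpos hK
    (neg_nonpos.2 (by positivity)))
  -- The fourth power suffices, as `H(x, Du)` is of order `K³` and `F ≤ 2K`.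
  have hτγ : τ ^ γ * K ^ 4 ≤ 1 := by
    have h1 : τ ^ γ ≤ K ^ (-4 : ℝ) := by
      refine (Real.rpow_le_rpow hτ.le hτK hγ.le).trans (le_of_eq ?_)
      rw [← Real.rpow_mul hK0.le]
      congr 1
      field_simp
    have h2 : K ^ (-4 : ℝ) * K ^ 4 = 1 := by
      rw [Real.rpow_neg hK0.le]
      have : K ^ (4 : ℝ) = K ^ 4 := by norm_cast
      rw [this]
      exact inv_mul_cancel₀ (by positivity)
    rw [← h2]
    exact mul_le_mul_of_nonneg_right h1 (by positivity)
  have hK3 : K ^ (2 + μ) ≤ K ^ 3 := by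
    calc K ^ (2 + μ) ≤ K ^ (3 : ℝ) := Real.rpow_le_rpow_of_exponent_le hK (by linarith)
      _ = K ^ 3 := by norm_cast
  obtain ⟨P, hP⟩ : ∃ P, P = 2 * A * K ^ 3 + 1 := ⟨_, rfl⟩
  have hP0 : 0 < P := by rw [hP]; positivity
  have hψP : ∀ x t, |H x (gr u x t)| ≤ P := by
    intro x t
    have h1 := hH.one_le x (gr u x t)
    rw [abs_of_pos (by linarith)]
    have h2 := (hg x (gr u x t)).2
    have h3 : ‖gr u x t‖ ^ (2 + μ) ≤ K ^ (2 + μ) :=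
      Real.rpow_le_rpow (norm_nonneg _) (h.gr_le x t) (by linarith)
    have h4 : 1 ≤ K ^ 3 := one_le_pow₀ hK
    have h5 := mul_le_mul_of_nonneg_left (add_le_add h4 (h3.trans hK3)) hA
    rw [hP]
    linarith
  have hψq : ∀ t, ∫ x in cube d, |H x (gr u x t)| ^ q ≤ P ^ q := by
    intro t
    refine integral_cube_le ?_ fun x =>
      Real.rpow_le_rpow (abs_nonneg _) (hψP x t) (by linarith)
    refine ContinuousOn.integrableOn_compact isCompact_cube (Continuous.continuousOn ?_)
    exact (hψ.smooth_space t).continuous.abs.rpow_const fun _ => Or.inr (by linarith)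
  have e1 := abs_integral_heat_dd_le (C := Cg) (F := F) hqd (φ := f) (ξ := ξ) (x := x) (t := t)
    hτ.le fun s hs hs1 => hheat f hf F h.F_pos s t hs (hs1.trans hτ1) (h.f_le _) ξ hξ x
  have e2 := abs_integral_heat_dd_le (C := Cg) (F := P) hqd (φ := fun x t => H x (gr u x t))
    (ξ := ξ) (x := x) (t := t) hτ.le
    fun s hs hs1 => hheat _ hψ P hP0 s t hs (hs1.trans hτ1) (hψq _) ξ hξ x
  rw [← hγdef] at e1 e2
  have hrep := (hu.dd (ξ, 0)).heat_sub_self x t hτ.le hτ1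
  have hsub : Icc 0 τ ⊆ Icc 0 1 := Icc_subset_Icc_right hτ1
  have hint : ∫ s in (0 : ℝ)..τ, heat s (fun x t => lap (dd (ξ, 0) u) x t
      + dd (0, 1) (dd (ξ, 0) u) x t) x t =
      (∫ s in (0 : ℝ)..τ, heat s (dd (ξ, 0) fun x t => H x (gr u x t)) x t) -
        ∫ s in (0 : ℝ)..τ, heat s (dd (ξ, 0) f) x t := by
    rw [← intervalIntegral.integral_sub]
    -- The equation holds only on the open time interval, so the endpoints of the `s`-interval are
    -- discarded.
    · rw [intervalIntegral.integral_of_le hτ.le, intervalIntegral.integral_of_le hτ.le,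
        integral_Ioc_eq_integral_Ioo, integral_Ioc_eq_integral_Ioo]
      refine setIntegral_congr_fun measurableSet_Ioo fun s hs => ?_
      rw [← heat_sub (hψ.dd _) (hf.dd _), heat_apply, heat_apply]
      congr 1
      funext z
      have hts : t + s ∈ Ioo a b := ⟨by linarith [hs.1], by linarith [hs.2]⟩
      have h1 := ((hu.dd (0, 1)).add hu.lap).dd_congr (hψ.sub hf) (h.equation _ hts) ξ
        (x + (2 * √s) • z)
      rw [dd_add (hu.dd _) hu.lap, dd_sub hψ hf, hu.dd_comm, dd_lap hu] at h1
      rw [← h1, add_comm]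
    · apply ContinuousOn.intervalIntegrable
      rw [uIcc_of_le hτ.le]
      exact ((hψ.dd _).continuousOn_heat x t).mono hsub
    · apply ContinuousOn.intervalIntegrable
      rw [uIcc_of_le hτ.le]
      exact ((hf.dd _).continuousOn_heat x t).mono hsub
  rw [hint] at hrep
  have h1 := (abs_le.1 e2).1
  have h2 := (abs_le.1 e1).2
  have h3 : Cg / γ * P * τ ^ γ + Cg / γ * F * τ ^ γ ≤ Cg / γ * (3 + 2 * A) := by
    have h4 : P + F ≤ (3 + 2 * A) * K ^ 4 := by
      have h5 := (h.F_le hμ.le).trans h.F_mul_le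
      have h6 : K ≤ K ^ 4 := le_self_pow₀ hK (by norm_num)
      have h7 : K ^ 3 ≤ K ^ 4 := pow_le_pow_right₀ hK (by norm_num)
      have h8 := mul_le_mul_of_nonneg_left h7 hA
      have h9 : 1 ≤ K ^ 4 := one_le_pow₀ hK
      rw [hP]
      linarith
    have h5 : (P + F) * τ ^ γ ≤ 3 + 2 * A := by
      have h6 := mul_le_mul_of_nonneg_right h4 (by positivity : 0 ≤ τ ^ γ)
      have h7 := mul_le_mul_of_nonneg_left hτγ (by positivity : 0 ≤ 3 + 2 * A)
      linarith
    have h6 := mul_le_mul_of_nonneg_left h5 (by positivity : 0 ≤ Cg / γ)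
    linarith
  linarith

/-- The tangent line to `exp` at `Y` lies below its graph. Unlike Jensen's inequality, this linear
bound can be averaged by `heat` directly. -/
theorem mul_le_exp_bound {Λ z Y : ℝ} (hΛ : 0 < Λ) :
    z ≤ Λ * Real.exp (-Y) * Real.exp (1 / Λ * z) + Λ * (Y - 1) := by
  have h1 := Real.add_one_le_exp (1 / Λ * z - Y)
  have h2 : Real.exp (1 / Λ * z - Y) = Real.exp (-Y) * Real.exp (1 / Λ * z) := by
    rw [← Real.exp_add]; ring_nf
  rw [h2] at h1
  have h3 := mul_le_mul_of_nonneg_left h1 hΛ.le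
  have h4 : Λ * (1 / Λ * z - Y + 1) = z - Λ * (Y - 1) := by field_simp; ring
  linarith

theorem IsHamiltonian.exists_gradient_bound (hH : IsHamiltonian H μ) (hq : 1 ≤ q)
    (hqd : (d : ℝ) < q) (hT : 0 < T) (hC₀ : 0 ≤ C₀) :
    ∃ C : ℝ, 0 ≤ C ∧
      ∀ (u f : Euc d → ℝ → ℝ) (a b K M F : ℝ), HJBound H μ q T C₀ u f a b K M F →
        ∀ t ∈ Ico a b, ∀ x, ‖gr u x t‖ ≤ C + C * M + C * F * (K ^ μ * (1 + M)) := by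
  obtain ⟨Cv, κ₁, κ₂, D, hCv, hκ₁, hκ₂, hD, henergy⟩ :=
    hH.exists_energy_bound hq hqd hT hC₀
  obtain ⟨Cs, hCs, hshort⟩ := hH.exists_short_time (T := T) (C₀ := C₀) hq hqd
  obtain ⟨Ch, hCh, hheat⟩ := exists_heat_le d
  have hμ := hH.mu_pos
  have hμ1 := hH.mu_lt_one
  obtain ⟨γ, hγdef⟩ : ∃ γ : ℝ, γ = 1 / 2 - d / (2 * q) := ⟨_, rfl⟩
  have hγ : 0 < γ := hγdef ▸ exponent_pos hqd
  rw [← hγdef] at henergy hshort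
  obtain ⟨N, hN⟩ : ∃ N, N = |Real.log Ch| + |Real.log D| + (5 + 2 * d / γ) / (μ * γ) := ⟨_, rfl⟩
  have hN0 : 0 ≤ N := by rw [hN]; positivity
  refine ⟨C₀ + Cs + D + 2 * κ₁ + 2 * κ₂ * Cv + Cv * N + Cv, by positivity, ?_⟩
  intro u f a b K M F h t ht x
  have hK := h.one_le
  have hK0 : 0 < K := by linarith
  have hF := h.F_pos
  have hM := h.M_nonneg
  have hu := h.u_smooth
  have hFF := h.F_le hμ.le
  obtain ⟨X, hX⟩ : ∃ X, X = F * K ^ μ := ⟨_, rfl⟩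
  have hX0 : 0 ≤ X := by rw [hX]; positivity
  have hXM : 0 ≤ X * M := mul_nonneg hX0 hM
  obtain ⟨Λ, hΛdef⟩ : ∃ Λ, Λ = Cv * F * K ^ (-(μ * γ)) := ⟨_, rfl⟩
  obtain ⟨κ, hκdef⟩ : ∃ κ, κ = κ₁ + κ₂ * (Λ * K ^ μ) := ⟨_, rfl⟩
  have hΛ : 0 < Λ := by rw [hΛdef]; positivity
  have hΛF : Λ ≤ Cv * F := by
    rw [hΛdef]
    refine mul_le_of_le_one_right (by positivity) ?_
    exact Real.rpow_le_one_of_one_le_of_nonpos hK (by nlinarith)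
  have hΛX : Λ ≤ Cv * X := by
    rw [hX]
    exact hΛF.trans (mul_le_mul_of_nonneg_left hFF hCv.le)
  -- The factor `K^(-μγ)` in `Λ` pays for the logarithm, via `log K ≤ K^(μγ)/(μγ)`.
  have hΛlog : Λ * Real.log K ≤ Cv * F * (1 / (μ * γ)) := by
    have h1 := Real.log_le_rpow_div hK0.le (mul_pos hμ hγ)
    have h2 := mul_le_mul_of_nonneg_left h1 hΛ.le
    refine h2.trans (le_of_eq ?_)
    rw [hΛdef]
    have : K ^ (-(μ * γ)) * K ^ (μ * γ) = 1 := by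
      rw [← Real.rpow_add hK0, neg_add_cancel, Real.rpow_zero]
    calc Cv * F * K ^ (-(μ * γ)) * (K ^ (μ * γ) / (μ * γ))
        = Cv * F * (K ^ (-(μ * γ)) * K ^ (μ * γ)) * (1 / (μ * γ)) := by ring
      _ = _ := by rw [this, mul_one]
  have hκM : κ * M ≤ κ₁ * M + κ₂ * Cv * (X * M) := by
    have h1 : Λ * K ^ μ ≤ Cv * X := by
      rw [hX, ← mul_assoc]
      exact mul_le_mul_of_nonneg_right hΛF (by positivity)
    have h2 := mul_le_mul_of_nonneg_right (mul_le_mul_of_nonneg_left h1 hκ₂) hM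
    rw [hκdef]
    linarith
  obtain ⟨τ₀, hτ₀⟩ : ∃ τ₀, τ₀ = K ^ (-(4 / γ)) := ⟨_, rfl⟩
  have hτ₀0 : 0 < τ₀ := by rw [hτ₀]; positivity
  have hτ₀1 : τ₀ ≤ 1 := by
    rw [hτ₀]
    exact Real.rpow_le_one_of_one_le_of_nonpos hK (neg_nonpos.2 (by positivity))
  have hgoal : C₀ + Cs + (D * (1 + X) + 2 * (κ * M) + Cv * F * N + Λ) ≤
      C₀ + Cs + D + 2 * κ₁ + 2 * κ₂ * Cv + Cv * N + Cv +
      (C₀ + Cs + D + 2 * κ₁ + 2 * κ₂ * Cv + Cv * N + Cv) * M +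
      (C₀ + Cs + D + 2 * κ₁ + 2 * κ₂ * Cv + Cv * N + Cv) * F * (K ^ μ * (1 + M)) := by
    have h1 : (C₀ + Cs + D + 2 * κ₁ + 2 * κ₂ * Cv + Cv * N + Cv) * F * (K ^ μ * (1 + M)) =
        (C₀ + Cs + D + 2 * κ₁ + 2 * κ₂ * Cv + Cv * N + Cv) * (X + X * M) := by
      rw [hX]; ring
    rw [h1]
    have h2 : Cv * F * N ≤ Cv * N * X := by
      rw [hX]
      have := mul_le_mul_of_nonneg_left hFF (mul_nonneg hCv.le hN0)
      linarith
    have p1 : 0 ≤ C₀ * (M + X + X * M) := by positivity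
    have p2 : 0 ≤ Cs * (M + X + X * M) := by positivity
    have p3 : 0 ≤ D * (M + X * M) := by positivity
    have p4 : 0 ≤ κ₁ * (1 + X + X * M) := by positivity
    have p5 : 0 ≤ κ₂ * Cv * (1 + M + X) := by positivity
    have p6 : 0 ≤ Cv * N * (1 + M + X * M) := by positivity
    have p7 : 0 ≤ Cv * (1 + M + X * M) := by positivity
    linarith
  refine hu.norm_gr_le ?_ fun ξ hξ => le_trans ?_ hgoal
  · refine le_trans ?_ hgoal
    have h1 : 0 ≤ κ := by rw [hκdef]; positivity
    positivity
  -- If a full step `τ₀` fits before `b`, the energy bound at `t + τ₀` is used. Otherwise one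
  -- shorter step reaches `b`, where the gradient is at most `C₀`.
  by_cases hcase : t + τ₀ ≤ b
  · refine (hshort u f a b K M F h ξ hξ t τ₀ ht.1 hτ₀0 hτ₀.le hcase x).trans ?_
    obtain ⟨Φ, hΦ, hΦu, hΦE⟩ := henergy u f a b K M F h ξ hξ Λ κ hΛdef hκdef
    have hE := hΦE (t + τ₀) ⟨by linarith [ht.1], hcase⟩
    rw [← hX] at hE
    -- `exp Y` is the energy bound times the smoothing constant `Ch τ₀^(-d/2)`, so `P_τ₀` of `Λ exp
    -- (-Y) exp (Φ/Λ)` is at most `Λ`.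
    obtain ⟨Y, hY⟩ : ∃ Y, Y = 1 / Λ * (C₀ + κ * M + D * (1 + X)) + Real.log (D * K ^ 5) +
      Real.log (Ch * τ₀ ^ (-(d / 2 : ℝ))) := ⟨_, rfl⟩
    have hexpY : Real.exp Y = Real.exp (1 / Λ * (C₀ + κ * M + D * (1 + X))) * (D * K ^ 5) *
        (Ch * τ₀ ^ (-(d / 2 : ℝ))) := by
      rw [hY, Real.exp_add, Real.exp_add, Real.exp_log (by positivity),
        Real.exp_log (by positivity)]
    have hg : PSmooth fun x t => Λ * Real.exp (-Y) * Real.exp (1 / Λ * Φ x t) :=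
      (hΦ.exp _).const_mul _
    have h1 := hheat _ hg τ₀ t hτ₀0 hτ₀1 (fun x => by positivity) x
    rw [integral_const_mul] at h1
    have h2 : Ch * τ₀ ^ (-(d / 2 : ℝ)) * (Λ * Real.exp (-Y) *
        ∫ w in cube d, Real.exp (1 / Λ * Φ w (t + τ₀))) ≤ Λ := by
      calc Ch * τ₀ ^ (-(d / 2 : ℝ)) * (Λ * Real.exp (-Y) *
            ∫ w in cube d, Real.exp (1 / Λ * Φ w (t + τ₀)))
          ≤ Ch * τ₀ ^ (-(d / 2 : ℝ)) * (Λ * Real.exp (-Y) *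
            (Real.exp (1 / Λ * (C₀ + κ * M + D * (1 + X))) * (D * K ^ 5))) :=
            mul_le_mul_of_nonneg_left (mul_le_mul_of_nonneg_left hE (by positivity))
              (by positivity)
        _ = Λ * (Real.exp (-Y) * Real.exp Y) := by rw [hexpY]; ring
        _ = Λ := by rw [← Real.exp_add, neg_add_cancel, Real.exp_zero, mul_one]
    have h3 := ((hu.dd (ξ, 0)).sub hg).heat_le (s := τ₀) (t := t)
      (c := Λ * (Y - 1) + κ * M + Λ) (fun y => by
        have h4 := hΦu y (t + τ₀)
        have h5 := mul_le_exp_bound (z := Φ y (t + τ₀)) (Y := Y) hΛ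
        linarith) x
    rw [heat_sub (hu.dd _) hg] at h3
    have hlog1 : Real.log (D * K ^ 5) ≤ |Real.log D| + 5 * Real.log K := by
      rw [Real.log_mul hD.ne' (by positivity), Real.log_pow]
      have := le_abs_self (Real.log D)
      push_cast
      linarith
    have hlog2 : Real.log (Ch * τ₀ ^ (-(d / 2 : ℝ))) ≤
        |Real.log Ch| + 2 * d / γ * Real.log K := by
      rw [Real.log_mul hCh.ne' (by positivity), Real.log_rpow hτ₀0, hτ₀, Real.log_rpow hK0]
      have h4 := le_abs_self (Real.log Ch)
      have h5 : -(d / 2 : ℝ) * (-(4 / γ) * Real.log K) = 2 * d / γ * Real.log K := by ring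
      linarith
    have hΛY : Λ * Y ≤ C₀ + κ * M + D * (1 + X) + Cv * F * N := by
      have e1 : Λ * Y = C₀ + κ * M + D * (1 + X) + Λ * (Real.log (D * K ^ 5) +
          Real.log (Ch * τ₀ ^ (-(d / 2 : ℝ)))) := by
        rw [hY]
        field_simp
        ring
      have e2 := mul_le_mul_of_nonneg_left (add_le_add hlog1 hlog2) hΛ.le
      have e3 : Λ * (|Real.log D| + |Real.log Ch|) ≤ Cv * F * (|Real.log D| + |Real.log Ch|) :=
        mul_le_mul_of_nonneg_right hΛF (by positivity)
      have e4 : (5 + 2 * d / γ) * (Λ * Real.log K) ≤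
          (5 + 2 * d / γ) * (Cv * F * (1 / (μ * γ))) :=
        mul_le_mul_of_nonneg_left hΛlog (by positivity)
      have e5 : Cv * F * N = Cv * F * (|Real.log D| + |Real.log Ch|) +
          (5 + 2 * d / γ) * (Cv * F * (1 / (μ * γ))) := by
        rw [hN]; ring
      rw [e1, e5]
      linarith
    linarith
  · push Not at hcase
    have hbt : 0 < b - t := by linarith [ht.2]
    refine (hshort u f a b K M F h ξ hξ t (b - t) ht.1 hbt (by rw [← hτ₀]; linarith)
      (by linarith) x).trans ?_
    have h1 := (hu.dd (ξ, 0)).heat_le (s := b - t) (t := t) (c := C₀) (fun y => by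
      rw [add_sub_cancel]
      exact (le_abs_self _).trans ((hu.abs_dd_le_norm_gr y b hξ).trans (h.gr_end_le y))) x
    have h2 : 0 ≤ κ := by rw [hκdef]; positivity
    have h3 : 0 ≤ D * (1 + X) + 2 * (κ * M) + Cv * F * N + Λ := by positivity
    linarith

end ShortTime

end MFG

namespace MFG

/-! ### Essential suprema of continuous functions -/

section MixedNorm

variable {d : ℕ}

/-- The subset of `U` where the bound fails is open and null, hence empty. -/
theorem forall_le_of_ae_le {X Y : Type*} [TopologicalSpace X] [MeasurableSpace X]
    [OpensMeasurableSpace X] {ν : Measure X} [ν.IsOpenPosMeasure] [TopologicalSpace Y]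
    [LinearOrder Y] [OrderTopology Y] {U : Set X} (hU : IsOpen U) {φ : X → Y}
    (hφ : ContinuousOn φ U) {c : Y} (h : ∀ᵐ t ∂ν.restrict U, φ t ≤ c) :
    ∀ t ∈ U, φ t ≤ c := by
  have ho : IsOpen (U ∩ φ ⁻¹' Ioi c) := hφ.isOpen_inter_preimage hU isOpen_Ioi
  rw [ae_restrict_iff' hU.measurableSet, ae_iff] at h
  have h0 : ν (U ∩ φ ⁻¹' Ioi c) = 0 := by
    convert h using 2
    ext t
    simp
  have h1 := (ho.measure_eq_zero_iff ν).1 h0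
  intro t ht
  by_contra! hc
  exact (h1 ▸ ⟨ht, hc⟩ : t ∈ (∅ : Set X))

theorem Periodic.ae_of_ae_cube {P : Euc d → Prop} (hP : Periodic P)
    (hm : MeasurableSet {x | P x}) (h : ∀ᵐ x ∂volume.restrict (cube d), P x) :
    ∀ᵐ x ∂(volume : Measure (Euc d)), P x := by
  have hc : MeasurableSet {x | ¬P x} := hm.compl
  rw [Measure.restrict_congr_set cube_ae_eq, ae_iff, Measure.restrict_apply hc] at h
  refine isAddFundamentalDomain_latt.measure_zero_of_invariant _ (fun g => ?_) h
  ext x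
  rw [mem_vadd_set_iff_neg_vadd_mem]
  change ¬P (-g +ᵥ x) ↔ ¬P x
  rw [hP.vadd_latt]

/-- The bound holds at almost every time and almost every point of the cube. Periodicity extends it
to almost every point of space, and continuity to every point and then to every time. -/
theorem enorm_le_mixedNorm_top {F : Type*} [NormedAddCommGroup F] {T : ℝ} {f : Euc d → ℝ → F}
    (hf : ContinuousOn (fun z : Euc d × ℝ => f z.1 z.2) (univ ×ˢ Ioo 0 T))
    (hp : ∀ t ∈ Ioo 0 T, Periodic fun x => f x t) (x : Euc d) {t : ℝ} (ht : t ∈ Ioo 0 T) :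
    ‖f x t‖ₑ ≤ mixedNorm T ∞ f := by
  have h1 : ∀ᵐ t ∂volume.restrict (Ioo 0 T), ‖f x t‖ₑ ≤ mixedNorm T ∞ f := by
    filter_upwards [ENNReal.ae_le_essSup (μ := volume.restrict (Ioo 0 T))
      fun t => eLpNorm (fun x => f x t) ∞ (volume.restrict (cube d)),
      ae_restrict_mem measurableSet_Ioo] with t ht hmem
    have hc : Continuous fun x => ‖f x t‖ₑ := by
      refine continuous_enorm.comp (continuousOn_univ.1 ?_)
      exact hf.comp (f := fun y : Euc d => (y, t)) (by fun_prop) fun y _ => ⟨mem_univ _, hmem⟩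
    have h2 : ∀ᵐ y ∂volume.restrict (cube d), ‖f y t‖ₑ ≤ mixedNorm T ∞ f := by
      filter_upwards [enorm_ae_le_eLpNormEssSup (fun x => f x t) (volume.restrict (cube d))]
        with y hy
      refine hy.trans ?_
      rw [← eLpNorm_exponent_top]
      exact ht
    have h3 := Periodic.ae_of_ae_cube (fun i y => by
      have := hp t hmem i y
      simp only at this ⊢
      rw [this]) (measurableSet_le hc.measurable measurable_const) h2
    exact forall_le_of_ae_le isOpen_univ hc.continuousOn (by rwa [Measure.restrict_univ]) x
      (mem_univ x)
  refine forall_le_of_ae_le isOpen_Ioo ?_ h1 t ht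
  refine continuous_enorm.comp_continuousOn ?_
  exact hf.comp (f := fun s : ℝ => (x, s)) (by fun_prop) fun s hs => ⟨mem_univ _, hs⟩

theorem mixedNorm_top_le {F : Type*} [NormedAddCommGroup F] {T : ℝ} {f : Euc d → ℝ → F}
    {R : ℝ} (hR : ∀ x, ∀ t ∈ Ioo 0 T, ‖f x t‖ ≤ R) :
    mixedNorm T ∞ f ≤ ENNReal.ofReal R := by
  refine essSup_le_of_ae_le _ ?_
  filter_upwards [ae_restrict_mem measurableSet_Ioo] with t ht
  rw [eLpNorm_exponent_top]
  exact eLpNormEssSup_le_of_ae_bound (Eventually.of_forall fun x => hR x t ht)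

theorem integral_rpow_le_of_eLpNorm_le {f : Euc d → ℝ} (hf : Continuous f) {q F : ℝ} (hq : 0 < q)
    (hF : 0 ≤ F) {p : ℝ≥0∞} (hqp : ENNReal.ofReal q ≤ p)
    (h : eLpNorm f p (volume.restrict (cube d)) ≤ ENNReal.ofReal F) :
    ∫ x in cube d, |f x| ^ q ≤ F ^ q := by
  have : IsProbabilityMeasure (volume.restrict (cube d)) :=
    ⟨by rw [Measure.restrict_apply_univ, volume_cube]⟩
  have h1 := (eLpNorm_le_eLpNorm_of_exponent_le hqp hf.aestronglyMeasurable).trans h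
  have h2 : MemLp f (ENNReal.ofReal q) (volume.restrict (cube d)) :=
    ⟨hf.aestronglyMeasurable, h1.trans_lt ENNReal.ofReal_lt_top⟩
  rw [h2.eLpNorm_eq_integral_rpow_norm (by simpa using hq) ENNReal.ofReal_ne_top,
    ENNReal.toReal_ofReal hq.le, ENNReal.ofReal_le_ofReal_iff hF] at h1
  have h0 : 0 ≤ ∫ x in cube d, ‖f x‖ ^ q := integral_nonneg fun x => by positivity
  have h3 := Real.rpow_le_rpow (by positivity) h1 hq.le
  rwa [← Real.rpow_mul h0, inv_mul_cancel₀ hq.ne', Real.rpow_one] at h3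

end MixedNorm

/-! ### Localization in time -/

section Localization

variable {d : ℕ} {H : Euc d → Euc d → ℝ} {μ α T ε : ℝ} {η uT m0 : Euc d → ℝ}
  {u m : Euc d → ℝ → ℝ}

/-- Composing with such a reparametrisation of time turns a function given on `[0, T]` into one
smooth for all times, unchanged on `[a, b]` and taking only values of the original. -/
theorem exists_smooth_clamp {a b δ : ℝ} (hab : a < b) (hδ : 0 < δ) :
    ∃ β : ℝ → ℝ, ContDiff ℝ ∞ β ∧ (∀ t ∈ Icc a b, β t = t) ∧
      ∀ t, β t ∈ Icc (a - δ) (b + δ) := by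
  obtain ⟨φ, hin, hout⟩ : ∃ φ : ContDiffBump ((a + b) / 2),
      φ.rIn = (b - a) / 2 ∧ φ.rOut = (b - a) / 2 + δ :=
    ⟨⟨(b - a) / 2, (b - a) / 2 + δ, by linarith, by linarith⟩, rfl, rfl⟩
  refine ⟨fun t => (a + b) / 2 + φ t * (t - (a + b) / 2), ?_, fun t ht => ?_, fun t => ?_⟩
  · exact contDiff_const.add (φ.contDiff.mul (contDiff_id.sub contDiff_const))
  · have : φ t = 1 := by
      refine φ.one_of_mem_closedBall ?_
      rw [Real.closedBall_eq_Icc, hin]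
      exact ⟨by linarith [ht.1], by linarith [ht.2]⟩
    simp only [this]
    ring
  · have h1 : |φ t * (t - (a + b) / 2)| ≤ (b - a) / 2 + δ := by
      rw [abs_mul, abs_of_nonneg φ.nonneg, ← hout]
      rcases le_total φ.rOut (dist t ((a + b) / 2)) with h | h
      · rw [φ.zero_of_le_dist h, zero_mul]
        exact φ.rOut_pos.le
      · rw [Real.dist_eq] at h
        exact (mul_le_of_le_one_left (abs_nonneg _) φ.le_one).trans h
    rw [abs_le] at h1
    exact ⟨by linarith [h1.1], by linarith [h1.2]⟩

theorem PSmooth.comp_time {φ : Euc d → ℝ → ℝ} (hφ : PSmooth φ) {β : ℝ → ℝ}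
    (hβ : ContDiff ℝ ∞ β) : PSmooth fun x t => φ x (β t) :=
  ⟨hφ.smooth.comp (contDiff_fst.prodMk (hβ.comp contDiff_snd)), fun t => hφ.periodic (β t)⟩

theorem IsSolution.pSmooth_comp_time (h : IsSolution H η α T uT m0 ε u m) {β : ℝ → ℝ}
    (hβ : ContDiff ℝ ∞ β) (hβT : ∀ t, β t ∈ Ioo 0 T) : PSmooth fun x t => u x (β t) where
  smooth := by
    have h1 := h.smooth_u.comp (f := fun z : Euc d × ℝ => (z.1, β z.2)) (s := univ)
      (contDiff_fst.prodMk (hβ.comp contDiff_snd)).contDiffOn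
      fun z _ => ⟨mem_univ _, Ioo_subset_Icc_self (hβT z.2)⟩
    exact contDiffOn_univ.1 h1
  periodic t := h.periodic_u _ (Ioo_subset_Icc_self (hβT t))

theorem IsSolution.equation_comp_time (h : IsSolution H η α T uT m0 ε u m) {β : ℝ → ℝ}
    (hβ : ContDiff ℝ ∞ β) (hβT : ∀ t, β t ∈ Ioo 0 T) {a b : ℝ} (hβab : ∀ t ∈ Icc a b, β t = t)
    {t : ℝ} (ht : t ∈ Ioo a b) (x : Euc d) :
    dd (0, 1) (fun x t => u x (β t)) x t + lap (fun x t => u x (β t)) x t =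
      H x (gr (fun x t => u x (β t)) x t) - gReg η α ε (fun y => m y t) x := by
  have hU := h.pSmooth_comp_time hβ hβT
  have hβt := hβab t (Ioo_subset_Icc_self ht)
  have htT : t ∈ Ioo 0 T := hβt ▸ hβT t
  have h1 : dd (0, 1) (fun x t => u x (β t)) x t = deriv (fun s => u x s) t := by
    have h2 := (hU.hasDerivAt_time x t).congr_of_eventuallyEq (f₁ := fun s => u x s) (by
      filter_upwards [isOpen_Ioo.mem_nhds ht] with s hs
      rw [hβab s (Ioo_subset_Icc_self hs)])
    exact h2.deriv.symm
  have h2 := hU.laplacian_eq x t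
  have h3 := h.hamiltonJacobi x t htT
  simp only [hβt] at h2
  rw [h1, ← h2, gr]
  simp only [hβt]
  linarith

/-- Smoothness of the clamped source is read off the equation, which expresses `g_ε(m)` through
derivatives of `u`. Two clamps are nested: `γ` is the identity on a neighbourhood of the range of
`β`, so the equation for the `γ`-clamped solution holds at every time `β t`. -/
theorem IsSolution.exists_localization (hH : IsHamiltonian H μ)
    (h : IsSolution H η α T uT m0 ε u m) {a b : ℝ} (ha : 0 < a) (hab : a < b) (hb : b < T) :
    ∃ U G : Euc d → ℝ → ℝ, PSmooth U ∧ PSmooth G ∧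
      (∀ t ∈ Icc a b, ∀ x, U x t = u x t ∧ G x t = gReg η α ε (fun y => m y t) x) ∧
      (∀ t, ∃ s ∈ Ioo 0 T, ∀ x, U x t = u x s ∧ G x t = gReg η α ε (fun y => m y s) x) ∧
      ∀ t ∈ Ioo a b, ∀ x, dd (0, 1) U x t + lap U x t = H x (gr U x t) - G x t := by
  obtain ⟨δ, hδ, hδa, hδb⟩ : ∃ δ > 0, 3 * δ < a ∧ b + 3 * δ < T :=
    ⟨min a (T - b) / 4, by have := lt_min ha (sub_pos.2 hb); positivity,
      by linarith [min_le_left a (T - b), lt_min ha (sub_pos.2 hb)],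
      by linarith [min_le_right a (T - b), lt_min ha (sub_pos.2 hb)]⟩
  obtain ⟨β, hβ, hβab, hβδ⟩ := exists_smooth_clamp hab hδ
  obtain ⟨γ, hγ, hγab, hγδ⟩ := exists_smooth_clamp (a := a - 2 * δ) (b := b + 2 * δ) (δ := δ)
    (by linarith) hδ
  have hβT : ∀ t, β t ∈ Ioo 0 T := fun t =>
    ⟨by linarith [(hβδ t).1], by linarith [(hβδ t).2]⟩
  have hγT : ∀ t, γ t ∈ Ioo 0 T := fun t =>
    ⟨by linarith [(hγδ t).1], by linarith [(hγδ t).2]⟩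
  have hV := h.pSmooth_comp_time hγ hγT
  have hG : PSmooth fun x t => H x (gr (fun x t => u x (γ t)) x t) -
      (dd (0, 1) (fun x t => u x (γ t)) x t + lap (fun x t => u x (γ t)) x t) :=
    (hH.pSmooth_comp hV).sub ((hV.dd _).add hV.lap)
  have hGeq : (fun (x : Euc d) (t : ℝ) => gReg η α ε (fun y => m y (β t)) x) =
      fun x t => H x (gr (fun x t => u x (γ t)) x (β t)) -
      (dd (0, 1) (fun x t => u x (γ t)) x (β t) + lap (fun x t => u x (γ t)) x (β t)) := by
    funext x t
    rw [h.equation_comp_time hγ hγT hγab (t := β t)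
      ⟨by linarith [(hβδ t).1], by linarith [(hβδ t).2]⟩]
    ring
  refine ⟨fun x t => u x (β t), fun x t => gReg η α ε (fun y => m y (β t)) x,
    h.pSmooth_comp_time hβ hβT, ?_, fun t ht x => ?_, fun t => ⟨β t, hβT t, fun x => ⟨rfl, rfl⟩⟩,
    fun t ht x => ?_⟩
  · rw [hGeq]
    exact hG.comp_time hβ
  · simp only [hβab t ht, and_self]
  · simp only [h.equation_comp_time hβ hβT hβab ht, hβab t (Ioo_subset_Icc_self ht)]

theorem gReg_nonneg (hη : IsMollifier η) (hε : 0 ≤ ε) {f : Euc d → ℝ} (hf : ∀ x, 0 ≤ f x)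
    (x : Euc d) : 0 ≤ gReg η α ε f x := by
  have key : ∀ f : Euc d → ℝ, (∀ x, 0 ≤ f x) → ∀ x, 0 ≤ mollify η ε f x := by
    intro f hf x
    refine integral_nonneg fun y => ?_
    exact mul_nonneg (mul_nonneg (by positivity) (hη.nonneg _)) (hf _)
  unfold gReg
  split_ifs
  · exact Real.rpow_nonneg (hf x) _
  · exact key _ (fun y => Real.rpow_nonneg (key f hf y) _) x

theorem IsSolution.continuousOn_gradient (h : IsSolution H η α T uT m0 ε u m) (hT : 0 < T) :
    ContinuousOn (fun z : Euc d × ℝ => gradient (fun y => u y z.2) z.1) (univ ×ˢ Icc 0 T) := by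
  have hu : UniqueDiffOn ℝ (univ ×ˢ Icc 0 T : Set (Euc d × ℝ)) :=
    uniqueDiffOn_univ.prod (uniqueDiffOn_Icc hT)
  have h1 := h.smooth_u.continuousOn_fderivWithin hu (by simp)
  have h2 : ∀ z ∈ (univ ×ˢ Icc 0 T : Set (Euc d × ℝ)), gradient (fun y => u y z.2) z.1 =
      (InnerProductSpace.toDual ℝ (Euc d)).symm
        ((fderivWithin ℝ (fun z : Euc d × ℝ => u z.1 z.2) (univ ×ˢ Icc 0 T) z).comp
          (ContinuousLinearMap.inl ℝ (Euc d) ℝ)) := by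
    intro z hz
    have h3 := (h.smooth_u.differentiableOn (by simp) z hz).hasFDerivWithinAt
    have h4 : HasFDerivWithinAt (fun y : Euc d => (y, z.2))
        (ContinuousLinearMap.inl ℝ (Euc d) ℝ) univ z.1 :=
      ((hasFDerivAt_id z.1).prodMk (hasFDerivAt_const z.2 z.1)).hasFDerivWithinAt.congr_fderiv
        (by ext <;> simp)
    have h5 := HasFDerivWithinAt.comp z.1 (f := fun y : Euc d => (y, z.2)) h3 h4
      fun y _ => ⟨mem_univ _, hz.2⟩
    rw [hasFDerivWithinAt_univ] at h5
    rw [gradient, ← h5.fderiv]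
    rfl
  refine ContinuousOn.congr ?_ h2
  refine (LinearIsometryEquiv.continuous _).comp_continuousOn ?_
  exact h1.clm_comp continuousOn_const

theorem Periodic.gradient {f : Euc d → ℝ} (hf : Periodic f) : Periodic (gradient f) := by
  intro i x
  simp only [_root_.gradient]
  rw [hf.fderiv i x]

/-- Localization requires an end time strictly before `T`; continuity of the gradient up to `T`,
uniform on the compact cube, carries the terminal bound there. -/
theorem IsSolution.eventually_gradient_le (h : IsSolution H η α T uT m0 ε u m) (hT : 0 < T)
    {R : ℝ} (hR : ∀ x, ‖gradient uT x‖ ≤ R) :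
    ∃ s < T, ∀ t ∈ Ioo s T, 0 ≤ t → ∀ x, ‖gradient (fun y => u y t) x‖ ≤ R + 1 := by
  have hTT : T ∈ Icc 0 T := ⟨hT.le, le_rfl⟩
  have h1 : ∀ᶠ t in nhds T, ∀ y ∈ cube d, t ∈ Icc 0 T →
      ‖gradient (fun y => u y t) y‖ < R + 1 := by
    refine isCompact_cube.eventually_forall_of_forall_eventually (fun y _ => ?_)
    have h2 := (h.continuousOn_gradient hT (y, T) ⟨mem_univ _, hTT⟩).norm
    have h3 : ‖gradient (fun y => u y T) y‖ < R + 1 := by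
      rw [funext h.terminal]
      linarith [hR y]
    have h4 := h2.eventually_lt_const h3
    rw [eventually_nhdsWithin_iff] at h4
    have h5 := (continuous_swap (X := ℝ) (Y := Euc d)).tendsto (T, y)
    filter_upwards [h5.eventually h4] with z hz hmem
    exact hz ⟨mem_univ _, hmem⟩
  obtain ⟨s, hs, hsT⟩ := exists_Ioc_subset_of_mem_nhds h1 ⟨T - 1, by linarith⟩
  refine ⟨s, hs, fun t ht h0 x => ?_⟩
  have htI : t ∈ Icc 0 T := ⟨h0, ht.2.le⟩
  obtain ⟨y, hy, hxy⟩ := (h.periodic_u t htI).gradient.exists_mem_cube x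
  rw [← hxy]
  exact (hsT ⟨ht.1, ht.2.le⟩ y hy htI).le

/-- The mixed norm controls almost every time only. The integral is continuous in time, so the bound
holds at every interior time. -/
theorem IsSolution.integral_gReg_le (hH : IsHamiltonian H μ)
    (h : IsSolution H η α T uT m0 ε u m) {q F : ℝ} (hq : 0 < q) (hF : 0 ≤ F) {p : ℝ≥0∞}
    (hqp : ENNReal.ofReal q ≤ p)
    (hm : mixedNorm T p (fun x t => gReg η α ε (fun y => m y t) x) ≤ ENNReal.ofReal F)
    {t : ℝ} (ht : t ∈ Ioo 0 T) :
    ∫ x in cube d, |gReg η α ε (fun y => m y t) x| ^ q ≤ F ^ q := by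
  obtain ⟨a, ha, hat⟩ := exists_between ht.1
  obtain ⟨b, htb, hb⟩ := exists_between ht.2
  obtain ⟨U, G, -, hG, hGm, -⟩ := h.exists_localization hH ha (hat.trans htb) hb
  have hGt : ∀ t ∈ Icc a b, (fun x => G x t) = gReg η α ε fun y => m y t :=
    fun t ht => funext fun x => (hGm t ht x).2
  have h1 : Continuous fun t => ∫ x in cube d, |G x t| ^ q := by
    refine continuous_parametric_integral_of_continuous (f := fun t x => |G x t| ^ q) ?_
      isCompact_cube
    exact (hG.continuous.comp continuous_swap).abs.rpow_const fun _ => Or.inr hq.le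
  have h2 : ∀ᵐ t ∂volume.restrict (Ioo a b), ∫ x in cube d, |G x t| ^ q ≤ F ^ q := by
    have hsub : Ioo a b ⊆ Ioo 0 T := Ioo_subset_Ioo ha.le hb.le
    filter_upwards [ae_restrict_of_ae_restrict_of_subset hsub (ENNReal.ae_le_essSup
      (μ := volume.restrict (Ioo 0 T)) fun t => eLpNorm (fun x => gReg η α ε (fun y => m y t) x) p
        (volume.restrict (cube d))), ae_restrict_mem measurableSet_Ioo] with s hs hmem
    refine integral_rpow_le_of_eLpNorm_le (hG.smooth_space s).continuous hq hF hqp ?_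
    rw [hGt s (Ioo_subset_Icc_self hmem)]
    exact hs.trans hm
  have h3 := forall_le_of_ae_le isOpen_Ioo h1.continuousOn h2 t ⟨hat, htb⟩
  simp only [(hGm t ⟨hat.le, htb.le⟩ _).2] at h3
  exact h3

theorem IsHamiltonian.exists_solution_gradient_bound (hH : IsHamiltonian H μ) (hT : 0 < T)
    (hdata : IsData uT m0) (hη : IsMollifier η) {q : ℝ} (hq : 1 ≤ q) (hqd : (d : ℝ) < q)
    {p : ℝ≥0∞} (hqp : ENNReal.ofReal q ≤ p) :
    ∃ C : ℝ, 0 ≤ C ∧ ∀ ε : ℝ, 0 ≤ ε → ∀ u m : Euc d → ℝ → ℝ, IsSolution H η α T uT m0 ε u m →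
      ∀ K M F : ℝ, 1 ≤ K → 0 ≤ M → 0 ≤ F → F * K ^ μ ≤ K →
      mixedNorm T ∞ u ≤ ENNReal.ofReal M →
      mixedNorm T p (fun x t => gReg η α ε (fun y => m y t) x) ≤ ENNReal.ofReal F →
      mixedNorm T ∞ (fun x t => gradient (fun y => u y t) x) ≤ ENNReal.ofReal K →
      mixedNorm T ∞ (fun x t => gradient (fun y => u y t) x) ≤
        ENNReal.ofReal (C + C * M + C * F * (K ^ μ * (1 + M))) := by
  obtain ⟨R, hR0, hR⟩ := hdata.periodic_uT.gradient.exists_bound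
    ((LinearIsometryEquiv.continuous _).comp (hdata.smooth_uT.continuous_fderiv (by simp)))
  obtain ⟨C, hC, hbound⟩ := hH.exists_gradient_bound hq hqd hT (C₀ := R + 1) (by linarith)
  refine ⟨2 * C, by positivity, fun ε hε u m h K M F hK hM hF hFK hu hg hDu => ?_⟩
  obtain ⟨s, hsT, hs⟩ := h.eventually_gradient_le hT hR
  have hK0 : 0 < K := by linarith
  -- `HJBound` needs a strictly positive `F`. This increment raises `F K^μ (1 + M)` by exactly `1`,
  -- which is the reason for the constant `2 * C`.
  obtain ⟨F', hF'⟩ : ∃ F', F' = F + 1 / (K ^ μ * (1 + M)) := ⟨_, rfl⟩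
  have hKμ : 1 ≤ K ^ μ := Real.one_le_rpow hK hH.mu_pos.le
  have hFF' : F ≤ F' := by rw [hF']; linarith [show 0 ≤ 1 / (K ^ μ * (1 + M)) by positivity]
  have hF'1 : F' * (K ^ μ * (1 + M)) = F * (K ^ μ * (1 + M)) + 1 := by
    rw [hF']; field_simp
  have hF'2 : F' * K ^ μ ≤ 2 * K := by
    have h1 : F' * K ^ μ = F * K ^ μ + 1 / (1 + M) := by rw [hF']; field_simp
    have h2 : 1 / (1 + M) ≤ 1 := by
      rw [div_le_one (by linarith)]; linarith
    linarith
  refine mixedNorm_top_le fun x t ht => ?_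
  -- The interval `[t, b]` starts at the time under study and ends close enough to `T` for the
  -- terminal gradient bound `R + 1` to hold at `b`.
  obtain ⟨b, hbt, hbT⟩ := exists_between (max_lt hsT ht.2)
  have htb : t < b := lt_of_le_of_lt (le_max_right _ _) hbt
  have hsb : s < b := lt_of_le_of_lt (le_max_left _ _) hbt
  obtain ⟨U, G, hU, hG, hloc, hval, heq⟩ := h.exists_localization hH ht.1 htb hbT
  have hgr : ∀ t r, (∀ x, U x t = u x r) → ∀ x, gr U x t = gradient (fun y => u y r) x :=
    fun t r hr x => by rw [gr, funext hr]
  have hsub : (univ ×ˢ Ioo 0 T : Set (Euc d × ℝ)) ⊆ univ ×ˢ Icc 0 T :=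
    prod_mono le_rfl Ioo_subset_Icc_self
  have hB : HJBound H μ q T (R + 1) U G t b K M F' :=
    { u_smooth := hU
      f_smooth := hG
      sub_le := by linarith [ht.1]
      one_le := hK
      M_nonneg := hM
      F_pos := by rw [hF']; positivity
      F_mul_le := hF'2
      equation := heq
      f_nonneg := fun x r => by
        obtain ⟨r', hr', hv⟩ := hval r
        rw [(hv x).2]
        exact gReg_nonneg hη hε (fun y => h.m_nonneg y r' (Ioo_subset_Icc_self hr')) x
      f_le := fun r => by
        obtain ⟨r', hr', hv⟩ := hval r
        simp only [(hv _).2]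
        exact (h.integral_gReg_le hH (by linarith) hF hqp hg hr').trans
          (Real.rpow_le_rpow hF hFF' (by linarith))
      u_le := fun x r => by
        obtain ⟨r', hr', hv⟩ := hval r
        rw [(hv x).1]
        have := (enorm_le_mixedNorm_top (h.smooth_u.continuousOn.mono hsub)
          (fun t ht => h.periodic_u t (Ioo_subset_Icc_self ht)) x hr').trans hu
        rwa [← ofReal_norm, ENNReal.ofReal_le_ofReal_iff hM] at this
      gr_le := fun x r => by
        obtain ⟨r', hr', hv⟩ := hval r
        rw [hgr r r' fun x => (hv x).1]
        have := (enorm_le_mixedNorm_top (f := fun x t => gradient (fun y => u y t) x)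
          ((h.continuousOn_gradient hT).mono hsub)
          (fun t ht => (h.periodic_u t (Ioo_subset_Icc_self ht)).gradient) x hr').trans hDu
        rwa [← ofReal_norm, ENNReal.ofReal_le_ofReal_iff hK0.le] at this
      gr_end_le := fun x => by
        rw [hgr b b fun x => (hloc b (right_mem_Icc.2 htb.le) x).1]
        exact hs b ⟨hsb, hbT⟩ (ht.1.trans htb).le x }
  have h1 := hbound U G t b K M F' hB t ⟨le_rfl, htb⟩ x
  rw [hgr t t fun x => (hloc t (left_mem_Icc.2 htb.le) x).1] at h1
  have h2 : C * F' * (K ^ μ * (1 + M)) = C * (F * (K ^ μ * (1 + M))) + C := by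
    rw [mul_assoc, hF'1]; ring
  have h3 : 0 ≤ C * (F * (K ^ μ * (1 + M))) := by positivity
  have h4 : 0 ≤ C * M := by positivity
  linarith

theorem IsSolution.mixedNorm_gradient_ne_top (h : IsSolution H η α T uT m0 ε u m) (hT : 0 < T) :
    mixedNorm T ∞ (fun x t => gradient (fun y => u y t) x) ≠ ⊤ := by
  obtain ⟨R, -, hR⟩ := exists_bound_of_periodic isCompact_Icc
    (fun t ht => (h.periodic_u t ht).gradient) (h.continuousOn_gradient hT)
  exact ne_top_of_le_ne_top ENNReal.ofReal_ne_top
    (mixedNorm_top_le fun x t ht => hR x t (Ioo_subset_Icc_self ht))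

end Localization

end MFG

/-! ### The theorem: reduction to finite norms and to the case `K ≥ 1`, `F K^μ ≤ K`. -/

theorem mainTheorem3 (d : ℕ) (hd : 1 ≤ d) (H : MFG.Euc d → MFG.Euc d → ℝ) (μ : ℝ)
    (hH : MFG.IsHamiltonian H μ) (α : ℝ) (hα : 0 < α) (T : ℝ) (hT : 0 < T)
    (uT m0 : MFG.Euc d → ℝ) (hdata : MFG.IsData uT m0)
    (η : MFG.Euc d → ℝ) (hη : MFG.IsMollifier η) (p : ℝ≥0∞) (hp : (d : ℝ≥0∞) < p) :
    ∃ C : ℝ≥0, ∀ ε : ℝ, 0 ≤ ε → ∀ u m : MFG.Euc d → ℝ → ℝ,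
      MFG.IsSolution H η α T uT m0 ε u m →
      MFG.mixedNorm T ∞ (fun x t => gradient (fun y => u y t) x)
        ≤ C + C * MFG.mixedNorm T ∞ u
          + C * MFG.mixedNorm T p (fun x t => MFG.gReg η α ε (fun y => m y t) x)
              * (MFG.mixedNorm T ∞ (fun x t => gradient (fun y => u y t) x) ^ μ
                  * (1 + MFG.mixedNorm T ∞ u)) := by
  -- A finite exponent is needed in the heat estimates; for `p = ∞` any `q > d` serves, as the cube
  -- has measure one.
  obtain ⟨q, hqd, hqp⟩ : ∃ q : ℝ, (d : ℝ) < q ∧ ENNReal.ofReal q ≤ p := by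
    rcases eq_or_ne p ⊤ with rfl | hp'
    · exact ⟨d + 1, by linarith, le_top⟩
    · refine ⟨p.toReal, ?_, ENNReal.ofReal_toReal_le⟩
      have := (ENNReal.toReal_lt_toReal (ENNReal.natCast_ne_top d) hp').2 hp
      simpa using this
  have hq : 1 ≤ q := by
    have : (1 : ℝ) ≤ d := by exact_mod_cast hd
    linarith
  obtain ⟨C, hC, hbound⟩ := hH.exists_solution_gradient_bound (α := α) hT hdata hη hq hqd hqp
  refine ⟨(C + 1).toNNReal, fun ε hε u m h => ?_⟩
  rw [show ((C + 1).toNNReal : ℝ≥0∞) = ENNReal.ofReal (C + 1) from rfl]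
  have hb := hbound ε hε u m h
  have hK := h.mixedNorm_gradient_ne_top hT
  generalize MFG.mixedNorm T ∞ (fun x t => gradient (fun y => u y t) x) = K at hb hK ⊢
  generalize MFG.mixedNorm T ∞ u = M at hb ⊢
  generalize MFG.mixedNorm T p (fun x t => MFG.gReg η α ε (fun y => m y t) x) = F at hb ⊢
  have hC1 : ENNReal.ofReal (C + 1) ≠ 0 := by simpa using by linarith
  have hμ := hH.mu_pos
  rcases eq_or_ne M ⊤ with rfl | hM
  · simp [ENNReal.mul_top hC1]
  rcases eq_or_ne K 0 with rfl | hK0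
  · exact zero_le
  -- This excludes the product `∞ · 0`, so an infinite `F` makes the right-hand side infinite.
  have hKM : K ^ μ * (1 + M) ≠ 0 :=
    mul_ne_zero (by simp [ENNReal.rpow_eq_zero_iff, hK0, hK]) (by simp)
  rcases eq_or_ne F ⊤ with rfl | hF
  · simp [ENNReal.mul_top hC1, ENNReal.top_mul hKM]
  lift K to ℝ≥0 using hK
  lift M to ℝ≥0 using hM
  lift F to ℝ≥0 using hF
  have hRHS : ∀ A : ℝ, 0 ≤ A → ENNReal.ofReal A + ENNReal.ofReal A * M +
      ENNReal.ofReal A * F * ((K : ℝ≥0∞) ^ μ * (1 + M)) =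
      ENNReal.ofReal (A + A * M + A * F * ((K : ℝ) ^ μ * (1 + M))) := by
    intro A hA
    rw [ENNReal.ofReal_add (by positivity) (by positivity),
      ENNReal.ofReal_add (by positivity) (by positivity),
      ENNReal.ofReal_mul (by positivity), ENNReal.ofReal_mul (by positivity),
      ENNReal.ofReal_mul (by positivity), ENNReal.ofReal_mul (by positivity),
      ENNReal.ofReal_add zero_le_one (by positivity), ENNReal.ofReal_one,
      ← ENNReal.ofReal_rpow_of_nonneg (by positivity) hμ.le]
    simp only [ENNReal.ofReal_coe_nnreal]
  rw [hRHS _ (by positivity)]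
  have hX : 0 ≤ (F : ℝ) * ((K : ℝ) ^ μ * (1 + M)) := by positivity
  have hM0 : (0 : ℝ) ≤ M := M.2
  have hF0 : (0 : ℝ) ≤ F := F.2
  have hCM : 0 ≤ C * (M : ℝ) := by positivity
  have hCX : 0 ≤ C * ((F : ℝ) * ((K : ℝ) ^ μ * (1 + M))) := by positivity
  -- The `1` in `C + 1` settles both trivial cases: `K ≤ 1`, and below `K ≤ F K^μ`.
  rcases le_total (K : ℝ) 1 with hK1 | hK1
  · rw [← ENNReal.ofReal_coe_nnreal]
    exact ENNReal.ofReal_le_ofReal (by linarith)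
  rcases le_total ((F : ℝ) * (K : ℝ) ^ μ) K with hFK | hFK
  · have h1 := hb K M F hK1 hM0 hF0 hFK (by simp) (by simp) (by simp)
    exact h1.trans (ENNReal.ofReal_le_ofReal (by linarith))
  · rw [← ENNReal.ofReal_coe_nnreal]
    refine ENNReal.ofReal_le_ofReal ?_
    have h1 : 0 ≤ (F : ℝ) * (K : ℝ) ^ μ * M := by positivity
    linarith
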